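/- **Setting.** Fix $q>0$, and for $n\ge 2$, $x_0\in\mathbb R$ put $V_n(x_0)=[x_0-(1/\log n)^{1/q},\,x_0+(1/\log n)^{1/q}]$. Let $\mathbb X=(X_i)_{i\in\mathbb Z}$ be a real-valued process, observed through $(X_1,\dots,X_n)$, whose variables all have the same marginal density $f\ge 0$ on $\mathbb R$. For $u\ge1$ let $\mathbb G_u$ be the set of functions $g:\mathbb R^u\to\mathbb R$ with support in $V_n(x_0)^u$, $\|g\|_\infty=\sup_{\mathbb R^u}|g|<\infty$ and $\mathrm{Lip}_u(g)=\sup_{x\ne y}|g(x)-g(y)|/\sum_k|x_k-y_k|<\infty$. For $r\ge 1$ let $$\rho_r(\mathbb X)=\sup\frac{|\mathrm{Cov}(g(X_{i_1},\dots,X_{i_u}),\tilde g(X_{j_1},\dots,X_{j_v}))|}{\max(\Psi_1,\Psi_2)},$$ the supremum being over $u,v\ge1$, $i\in\mathbb Z^u$, $j\in\mathbb Z^v$ with $\min j-\max i\ge r$, $g\in\mathbb G_u$, $\tilde g\in\mathbb G_v$ (with $0/0=0$), where $\Psi_1=4\|g\|_\infty\|\tilde g\|_\infty$ and $\Psi_2=u\|\tilde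 g\|_\infty\mathrm{Lip}_u(g)+v\|g\|_\infty\mathrm{Lip}_v(\tilde g)+uv\,\mathrm{Lip}_u(g)\mathrm{Lip}_v(\tilde g)$. Let $$\mu(\mathbb X)=\sup_{g,\tilde g\in\mathbb G_1\setminus\{0\}}\ \sup_{i\neq j}\frac{|\mathbb E(g(X_i)\tilde g(X_j))|}{\|g\|_1\|\tilde g\|_1},\qquad \|g\|_1=\int_{\mathbb R}|g|.$$ For $s,\mathfrak L,\mathfrak B>0$ let $m_s=\sup\{k\in\mathbb N:k<s\}$ (where $0\in\mathbb N$), and let $\mathcal H(s,\mathfrak L,\mathfrak B)$ be the set of $f:\mathbb R\to\mathbb R$ with $\sup_{V_n(x_0)}f\le\mathfrak B$ that are $m_s$ times differentiable and satisfy $|f^{(m_s)}(x)-f^{(m_s)}(y)|\le\mathfrak L|x-y|^{s-m_s}$ for all $x,y\in\mathbb R$. **Estimator.** Let $K:\mathbb R\to\mathbb R$ be Lipschitz, supported in $[-1,1]$, with $\int K=1$, and write $K_h(y)=h^{-1}K(h^{-1}y)$. Let $\mathcal H_n=\{2^{-k}:k\in\mathbb N\}\cap[n^{-1}e^{\sqrt{\log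 n}},(\log n)^{-1/q}]$. For $h,\eta\in\mathcal H_n$ put $\hat f_h(x_0)=\frac1n\sum_{i=1}^nK_h(x_0-X_i)$, $\hat J_n(h)=\frac1{n^2}\sum_{i=1}^nK_h^2(x_0-X_i)$, $\delta_n=(\log n)^{-1/2}$, $$\hat M_n(h)=\sqrt{2q|\log h|\Big(\hat J_n(h)+\frac{\delta_n}{nh}\Big)},\qquad \hat M_n(h,\eta)=\hat M_n(\eta)+\hat M_n(\max(h,\eta)),$$ $$A(h,x_0)=\max_{\eta\in\mathcal H_n}\max\big(0,\ |\hat f_{\max(h,\eta)}(x_0)-\hat f_\eta(x_0)|-\hat M_n(h,\eta)\big).$$ Let $\hat h(x_0)$ be any minimizer over $\mathcal H_n$ of $h\mapsto A(h,x_0)+\hat M_n(h)$, chosen as a measurable function of the data, and $\hat f(x_0)=\hat f_{\hat h(x_0)}(x_0)$. This estimator depends on $n,x_0,K,q$ and the data only; it is defined whenever $\mathcal H_n\neq\emptyset$, in particular for all large $n$. **Theorem 2.** Let $\mathfrak a,\mathfrak b,\mathfrak c,\mathfrak B,\mathfrak C,\mathfrak L,s,q>0$, let $K$ be as above and of order $m\in\mathbb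 N$, i.e. $\int K(x)x^\ell\,dx=0$ for $1\le\ell\le m$, and suppose $m_s\le m$. There is a constant $C_2^*>0$, depending only on $\mathfrak a,\mathfrak b,\mathfrak c,\mathfrak B,\mathfrak C,s,\mathfrak L,K$ and $q$, such that for all $n\ge2$ with $\mathcal H_n\ne\emptyset$ and all $x_0\in\mathbb R$, $$\sup\Big(\mathbb E|\hat f(x_0)-f(x_0)|^q\Big)^{1/q}\le C_2^*\Big(\frac{\log n}{n}\Big)^{\frac s{2s+1}},$$ where the supremum is over all processes $\mathbb X$ as above with $\rho_r(\mathbb X)\le\mathfrak c\exp(-\mathfrak a r^{\mathfrak b})$ for all $r\ge1$, $\mu(\mathbb X)\le\mathfrak C$ and marginal density $f\in\mathcal H(s,\mathfrak L,\mathfrak B)$. -/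

import Mathlib

open MeasureTheory ProbabilityTheory

noncomputable section

namespace WeakDepDensity

/-- The neighbourhood `V_n(x₀) = [x₀ - (1 / log n)^{1/q}, x₀ + (1 / log n)^{1/q}]`. -/
def nbhd (q : ℝ) (n : ℕ) (x₀ : ℝ) : Set ℝ :=
  Set.Icc (x₀ - (1 / Real.log n) ^ (1 / q)) (x₀ + (1 / Real.log n) ^ (1 / q))

/-! ### Dependence coefficients -/

/-- The supremum norm of a function on `ℝ^u`. -/
def supNorm {u : ℕ} (g : (Fin u → ℝ) → ℝ) : ℝ := ⨆ x, |g x|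

/-- The difference quotient of `g` at a pair of points, with the `ℓ¹` distance on `ℝ^u`
(it is `0` on the diagonal). -/
def lipQuotient {u : ℕ} (g : (Fin u → ℝ) → ℝ) (p : (Fin u → ℝ) × (Fin u → ℝ)) : ℝ :=
  |g p.1 - g p.2| / ∑ k, |p.1 k - p.2 k|

/-- The Lipschitz constant `Lip_u(g)` for the `ℓ¹` distance. -/
def lipConst {u : ℕ} (g : (Fin u → ℝ) → ℝ) : ℝ := ⨆ p, lipQuotient g p

/-- The class `𝔾_u` for a window `V`: bounded Lipschitz functions on `ℝ^u` whose support is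
included in `V^u`. -/
def testClass (V : Set ℝ) (u : ℕ) : Set ((Fin u → ℝ) → ℝ) :=
  {g | Function.support g ⊆ Set.univ.pi (fun _ => V) ∧
    BddAbove (Set.range fun x => |g x|) ∧ BddAbove (Set.range (lipQuotient g))}

def Psi₁ {u v : ℕ} (g : (Fin u → ℝ) → ℝ) (g' : (Fin v → ℝ) → ℝ) : ℝ :=
  4 * supNorm g * supNorm g'

def Psi₂ {u v : ℕ} (g : (Fin u → ℝ) → ℝ) (g' : (Fin v → ℝ) → ℝ) : ℝ :=
  u * supNorm g' * lipConst g + v * supNorm g * lipConst g' + u * v * lipConst g * lipConst g'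

def Psi {u v : ℕ} (g : (Fin u → ℝ) → ℝ) (g' : (Fin v → ℝ) → ℝ) : ℝ :=
  max (Psi₁ g g') (Psi₂ g g')

section Dependence

variable {Ω : Type*} [MeasurableSpace Ω]

/-- The coefficient `ρ_r(𝕏)`. The condition on `i, j` says that the gap
`min j - max i` is at least `r`. The quotient is `0` when `Psi g g' = 0`, which happens only if
`g = 0` or `g' = 0`. -/
def rho (V : Set ℝ) (P : Measure Ω) (X : ℤ → Ω → ℝ) (r : ℕ) : ENNReal :=
  ⨆ (u : ℕ) (v : ℕ) (_ : 0 < u) (_ : 0 < v)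
    (i : Fin u → ℤ) (j : Fin v → ℤ) (_ : ∀ k l, (r : ℤ) ≤ j l - i k)
    (g ∈ testClass V u) (g' ∈ testClass V v),
    ENNReal.ofReal
      (|covariance (fun ω => g fun k => X (i k) ω) (fun ω => g' fun l => X (j l) ω) P|
        / Psi g g')

/-- `∫_ℝ |g(t)| dt` for a function `g` of one real variable. -/
def norm₁ (g : (Fin 1 → ℝ) → ℝ) : ℝ := ∫ t : ℝ, |g fun _ => t|

/-- The coefficient `μ(𝕏)`. -/
def mu (V : Set ℝ) (P : Measure Ω) (X : ℤ → Ω → ℝ) : ENNReal :=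
  ⨆ (g ∈ testClass V 1 \ {0}) (g' ∈ testClass V 1 \ {0}) (i : ℤ) (j : ℤ) (_ : i ≠ j),
    ENNReal.ofReal
      (|∫ ω, (g fun _ => X i ω) * (g' fun _ => X j ω) ∂P| / (norm₁ g * norm₁ g'))

/-- `𝕏` is a real process indexed by `ℤ`, all of whose one-dimensional marginals have density `f`
with respect to the Lebesgue measure. -/
structure HasMarginalDensity (P : Measure Ω) (X : ℤ → Ω → ℝ) (f : ℝ → ℝ) : Prop where
  measurable : ∀ i, Measurable (X i)
  nonneg : ∀ x, 0 ≤ f x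
  map_eq : ∀ i, P.map (X i) = volume.withDensity (fun x => ENNReal.ofReal (f x))

end Dependence

/-! ### Hölder classes -/

/-- `m_s = sup {k ∈ ℕ : k < s}`. -/
def holderIndex (s : ℝ) : ℕ := sSup {k : ℕ | (k : ℝ) < s}

/-- The Hölder class `H(s, L, B)`, with the bound by `B` imposed on the window `V`. -/
structure IsHolderClass (V : Set ℝ) (s L B : ℝ) (f : ℝ → ℝ) : Prop where
  le_on_window : ∀ x ∈ V, f x ≤ B
  differentiable : ∀ k < holderIndex s, Differentiable ℝ (iteratedDeriv k f)
  holder : ∀ x y, |iteratedDeriv (holderIndex s) f x - iteratedDeriv (holderIndex s) f y|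
    ≤ L * |x - y| ^ (s - holderIndex s)

/-! ### Kernels -/

structure IsKernel (K : ℝ → ℝ) : Prop where
  support_subset : Function.support K ⊆ Set.Icc (-1) 1
  lipschitz : ∃ C, LipschitzWith C K
  integral_eq_one : ∫ x, K x = 1

def HasOrder (K : ℝ → ℝ) (m : ℕ) : Prop :=
  ∀ l : ℕ, 1 ≤ l → l ≤ m → ∫ x, K x * x ^ l = 0

/-- `K_h(y) = h⁻¹ K(h⁻¹ y)`. -/
def scaled (K : ℝ → ℝ) (h y : ℝ) : ℝ := h⁻¹ * K (h⁻¹ * y)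

/-! ### The estimation procedure, as functions of the data `x = (x_1, …, x_n)` -/

/-- `h_* = n⁻¹ exp(√(log n))`. -/
def hLow (n : ℕ) : ℝ := (n : ℝ)⁻¹ * Real.exp (Real.sqrt (Real.log n))

/-- `h^* = (log n)^{-1/q}`. -/
def hHigh (q : ℝ) (n : ℕ) : ℝ := Real.log n ^ (-1 / q)

/-- The bandwidth grid `ℋ_n = {2^{-k} : k ∈ ℕ} ∩ [h_*, h^*]`. -/
def bandwidths (q : ℝ) (n : ℕ) : Set ℝ :=
  {h | ∃ k : ℕ, h = ((2 : ℝ) ^ k)⁻¹} ∩ Set.Icc (hLow n) (hHigh q n)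

variable (K : ℝ → ℝ) (q x₀ : ℝ) {n : ℕ}

/-- The kernel estimator `f̂_h(x₀)`. -/
def kernelEstimator (h : ℝ) (x : Fin n → ℝ) : ℝ :=
  (1 / (n : ℝ)) * ∑ i, scaled K h (x₀ - x i)

/-- `Ĵ_n(h)`. -/
def JHat (h : ℝ) (x : Fin n → ℝ) : ℝ :=
  (1 / (n : ℝ) ^ 2) * ∑ i, scaled K h (x₀ - x i) ^ 2

/-- `δ_n = (log n)^{-1/2}`. -/
def delta (n : ℕ) : ℝ := Real.log n ^ (-(1 / 2) : ℝ)

/-- The penalty `M̂_n(h)`. -/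
def MHat (h : ℝ) (x : Fin n → ℝ) : ℝ :=
  Real.sqrt (2 * q * |Real.log h| * (JHat K x₀ h x + delta n / (n * h)))

/-- The penalty `M̂_n(h, η) = M̂_n(η) + M̂_n(h ∨ η)`. -/
def MHat₂ (h η : ℝ) (x : Fin n → ℝ) : ℝ :=
  MHat K q x₀ η x + MHat K q x₀ (max h η) x

/-- `A(h, x₀)`, a maximum over the finite grid `ℋ_n`. -/
def biasProxy (h : ℝ) (x : Fin n → ℝ) : ℝ :=
  ⨆ η : bandwidths q n,
    max 0 (|kernelEstimator K x₀ (max h η) x - kernelEstimator K x₀ η x| - MHat₂ K q x₀ h η x)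

/-- `hhat` is a (measurable) bandwidth selection rule: for every data vector it picks a minimizer
over `ℋ_n` of `h ↦ A(h, x₀) + M̂_n(h)`. -/
structure IsSelectionRule (hhat : (Fin n → ℝ) → ℝ) : Prop where
  measurable : Measurable hhat
  mem : ∀ x, hhat x ∈ bandwidths q n
  minimizes : ∀ x, ∀ h ∈ bandwidths q n,
    biasProxy K q x₀ (hhat x) x + MHat K q x₀ (hhat x) x
      ≤ biasProxy K q x₀ h x + MHat K q x₀ h x

/-- The adaptive estimator `f̂(x₀) = f̂_{ĥ(x₀)}(x₀)`. -/
def adaptiveEstimator (hhat : (Fin n → ℝ) → ℝ) (x : Fin n → ℝ) : ℝ :=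
  kernelEstimator K x₀ (hhat x) x

/-- The observations `(X_1, …, X_n)`. -/
def observations {Ω : Type*} (X : ℤ → Ω → ℝ) (n : ℕ) (ω : Ω) : Fin n → ℝ :=
  fun k => X ((k : ℤ) + 1) ω

/-- The pointwise risk `(𝔼 |f̂(x₀) - y|^q)^{1/q}`, as an extended nonnegative real. -/
def risk {Ω : Type*} [MeasurableSpace Ω] (P : Measure Ω) (Z : Ω → ℝ) (y : ℝ) : ENNReal :=
  (∫⁻ ω, ENNReal.ofReal (|Z ω - y| ^ q) ∂P) ^ (1 / q)

end WeakDepDensity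

end

/-! The selection rule is of Goldenshluger–Lepski type; its analysis combines a pathwise comparison
with moment bounds for sums of dependent variables.

Pathwise (`abs_adaptiveEstimator_sub_le`): if every kernel estimator of the grid is within `MHat +
ζ` of its mean, the selected one errs by at most a constant times `ζ + MHat h + β`, for any grid
point `h` such that all bandwidths up to `h` have bias at most `β`. For `h` of order `(log n /
n)^{1/(2s+1)}`, the bias `h^s` and the penalty `√(log n / (n h))` are both of the order of the
claimed rate. There remains the `q`-th moment of `ζ`, the largest normalised excess of a centred
kernel sum over `√(2q |log h| T)`, where `T` is `varProxy`. Outside an event of polynomially small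
probability the random penalty dominates this threshold (`sqrt_varProxy_le_MHat`); on that event a
bound of order `n` on the error suffices.

The dependence coefficient only controls functions supported in the window. Products of kernel
values qualify, exponentials of sums do not, so integer moments of order `O(log n)` replace Laplace
transforms. Powers of centred sums expand into such products (`abs_covariance_pow_le`). With blocks
of length about `(log n)^Q`, `Q b ≥ 3`, covariances of order `exp(-a (log n)^3)` beat the
`exp(O((log n)^2))` size of the expansion (`eventually_decorrelation`). Blocks of equal parity thus
behave as if independent, and an induction over blocks imitates the exponential-moment bound
(`abs_integral_pow_sum_le`). The coefficient `mu` controls the correlations inside a block.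

The constants matter. Splitting into two parities gives moments of order `(4kT/e)^k`, against
`(2kT/e)^k` for a Gaussian of variance `T`. With `k ≈ q |log h| / 2` the excess has `q`-th moment
about `(T |log h| h)^{q/2}`; as `T = O(n h)`, division by `(n h)^q` leaves `n^{-q/2}` up to small
powers of `n`. This is enough because `s/(2s+1) < 1/2`. For `h ≥ n^{-ε/2}`, where correlations
inside a block need not be negligible, a cruder moment bound works since `n h` is almost `n`. -/

namespace WeakDepDensity

universe u

/-! ### Bounded measurable functions and their covariances -/

section BoundedMeasurable

variable {Ω : Type*} [MeasurableSpace Ω]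

/-- Bounded measurable real functions. -/
def BddMeas (F : Ω → ℝ) : Prop := Measurable F ∧ ∃ C, ∀ ω, |F ω| ≤ C

namespace BddMeas

variable {F G : Ω → ℝ}

theorem const (r : ℝ) : BddMeas (fun _ : Ω => r) := ⟨measurable_const, |r|, fun _ => le_rfl⟩

theorem add (hF : BddMeas F) (hG : BddMeas G) : BddMeas (fun ω => F ω + G ω) := by
  obtain ⟨hF, C, hC⟩ := hF
  obtain ⟨hG, D, hD⟩ := hG
  exact ⟨hF.add hG, C + D, fun ω => (abs_add_le _ _).trans (add_le_add (hC ω) (hD ω))⟩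

theorem mul (hF : BddMeas F) (hG : BddMeas G) : BddMeas (fun ω => F ω * G ω) := by
  obtain ⟨hF, C, hC⟩ := hF
  obtain ⟨hG, D, hD⟩ := hG
  refine ⟨hF.mul hG, C * D, fun ω => ?_⟩
  rw [abs_mul]
  exact mul_le_mul (hC ω) (hD ω) (abs_nonneg _) ((abs_nonneg _).trans (hC ω))

theorem const_mul (r : ℝ) (hF : BddMeas F) : BddMeas (fun ω => r * F ω) := (const r).mul hF

theorem sub (hF : BddMeas F) (hG : BddMeas G) : BddMeas (fun ω => F ω - G ω) := by
  simpa [sub_eq_add_neg] using hF.add (hG.const_mul (-1))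

theorem pow (hF : BddMeas F) (n : ℕ) : BddMeas (fun ω => F ω ^ n) := by
  induction n with
  | zero => simpa using const (1 : ℝ)
  | succ n ih => simpa [pow_succ] using ih.mul hF

theorem sum {ι : Type*} (s : Finset ι) {F : ι → Ω → ℝ} (h : ∀ i ∈ s, BddMeas (F i)) :
    BddMeas (fun ω => ∑ i ∈ s, F i ω) := by
  classical
  induction s using Finset.induction_on with
  | empty => simpa using const (0 : ℝ)
  | insert a s ha ih =>
    simp only [Finset.sum_insert ha]
    exact (h a (by simp)).add (ih fun i hi => h i (by simp [hi]))

theorem prod {ι : Type*} (s : Finset ι) {F : ι → Ω → ℝ} (h : ∀ i ∈ s, BddMeas (F i)) :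
    BddMeas (fun ω => ∏ i ∈ s, F i ω) := by
  classical
  induction s using Finset.induction_on with
  | empty => simpa using const (1 : ℝ)
  | insert a s ha ih =>
    simp only [Finset.prod_insert ha]
    exact (h a (by simp)).mul (ih fun i hi => h i (by simp [hi]))

theorem integrable (P : Measure Ω) [IsFiniteMeasure P] (hF : BddMeas F) : Integrable F P := by
  obtain ⟨hF, C, hC⟩ := hF
  exact Integrable.of_bound hF.aestronglyMeasurable C (Filter.Eventually.of_forall hC)

theorem memLp (P : Measure Ω) [IsFiniteMeasure P] (hF : BddMeas F) : MemLp F 2 P := by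
  obtain ⟨hF, C, hC⟩ := hF
  exact MemLp.of_bound hF.aestronglyMeasurable C (Filter.Eventually.of_forall hC)

theorem covariance_eq (P : Measure Ω) [IsProbabilityMeasure P] (hF : BddMeas F) (hG : BddMeas G) :
    cov[F, G; P] = ∫ ω, F ω * G ω ∂P - (∫ ω, F ω ∂P) * ∫ ω, G ω ∂P :=
  covariance_eq_sub (hF.memLp P) (hG.memLp P)

end BddMeas

theorem abs_integral_le_of_abs_le {P : Measure Ω} [IsProbabilityMeasure P] {F : Ω → ℝ} {C : ℝ}
    (hC : ∀ ω, |F ω| ≤ C) : |∫ ω, F ω ∂P| ≤ C := by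
  have := norm_integral_le_of_norm_le_const (μ := P) (f := F) (Filter.Eventually.of_forall hC)
  simpa using this

/-- Expansion of a covariance of linear combinations. -/
theorem abs_covariance_sum_le (P : Measure Ω) [IsProbabilityMeasure P] {ι κ : Type*}
    (s : Finset ι) (t : Finset κ) (c : ι → ℝ) (d : κ → ℝ) (F : ι → Ω → ℝ) (G : κ → Ω → ℝ)
    (hF : ∀ i ∈ s, BddMeas (F i)) (hG : ∀ j ∈ t, BddMeas (G j)) :
    |cov[fun ω => ∑ i ∈ s, c i * F i ω, fun ω => ∑ j ∈ t, d j * G j ω; P]|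
      ≤ ∑ i ∈ s, ∑ j ∈ t, |c i| * |d j| * |cov[F i, G j; P]| := by
  have e : cov[fun ω => ∑ i ∈ s, c i * F i ω, fun ω => ∑ j ∈ t, d j * G j ω; P]
      = ∑ i ∈ s, ∑ j ∈ t, c i * (d j * cov[F i, G j; P]) := by
    rw [covariance_fun_sum_fun_sum' (fun i hi => ((hF i hi).const_mul _).memLp P)
      (fun j hj => ((hG j hj).const_mul _).memLp P)]
    refine Finset.sum_congr rfl fun i _ => Finset.sum_congr rfl fun j _ => ?_
    rw [covariance_const_mul_left, covariance_const_mul_right]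
  rw [e]
  refine (Finset.abs_sum_le_sum_abs _ _).trans (Finset.sum_le_sum fun i _ => ?_)
  refine (Finset.abs_sum_le_sum_abs _ _).trans (Finset.sum_le_sum fun j _ => ?_)
  rw [abs_mul, abs_mul, mul_assoc]

end BoundedMeasurable

/-! ### Moments of sums of almost uncorrelated variables -/

section Moments

variable {Ω : Type*} [MeasurableSpace Ω] (P : Measure Ω) [IsProbabilityMeasure P]

/-- A truncated exponential series of a bounded centred variable. -/
theorem sum_moments_le {W : Ω → ℝ} (hW : BddMeas W) {β w t : ℝ} (ht : 0 ≤ t)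
    (hβ : ∀ ω, |W ω| ≤ β) (h1 : ∫ ω, W ω ∂P = 0) (h2 : ∫ ω, W ω ^ 2 ∂P ≤ w) (N : ℕ) :
    ∑ r ∈ Finset.range N, t ^ r / r.factorial * |∫ ω, W ω ^ r ∂P|
      ≤ 1 + t ^ 2 * w * Real.exp (t * β) / 2 := by
  obtain ⟨ω₀⟩ : Nonempty Ω := nonempty_of_isProbabilityMeasure P
  have hβ0 : 0 ≤ β := (abs_nonneg _).trans (hβ ω₀)
  have hw : 0 ≤ w := (integral_nonneg fun ω => sq_nonneg _).trans h2
  have hmom : ∀ r : ℕ, |∫ ω, W ω ^ (r + 2) ∂P| ≤ β ^ r * w := by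
    intro r
    calc |∫ ω, W ω ^ (r + 2) ∂P| ≤ ∫ ω, |W ω ^ (r + 2)| ∂P := abs_integral_le_integral_abs
      _ ≤ ∫ ω, β ^ r * W ω ^ 2 ∂P := by
          refine integral_mono ((hW.pow _).integrable P).abs (((hW.pow 2).const_mul _).integrable P)
            fun ω => ?_
          change |W ω ^ (r + 2)| ≤ β ^ r * W ω ^ 2
          rw [pow_add, abs_mul, abs_pow, abs_pow, sq_abs]
          exact mul_le_mul_of_nonneg_right (pow_le_pow_left₀ (abs_nonneg _) (hβ ω) r) (sq_nonneg _)
      _ ≤ β ^ r * w := by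
          rw [integral_const_mul]
          exact mul_le_mul_of_nonneg_left h2 (by positivity)
  calc ∑ r ∈ Finset.range N, t ^ r / r.factorial * |∫ ω, W ω ^ r ∂P|
      ≤ ∑ r ∈ Finset.range (N + 2), t ^ r / r.factorial * |∫ ω, W ω ^ r ∂P| :=
        Finset.sum_le_sum_of_subset_of_nonneg (Finset.range_mono (by omega))
          fun _ _ _ => by positivity
    -- The order-zero term is 1 and centring kills the order-one term; the range was extended to `N
    -- + 2` so that both can be split off.
    _ = ∑ r ∈ Finset.range N, t ^ (r + 2) / (r + 2).factorial * |∫ ω, W ω ^ (r + 2) ∂P| + 1 := by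
        rw [Finset.sum_range_succ', Finset.sum_range_succ']
        simp [h1]
    _ ≤ ∑ r ∈ Finset.range N, (t ^ 2 * w / 2) * ((t * β) ^ r / r.factorial) + 1 := by
        refine add_le_add (Finset.sum_le_sum fun r _ => ?_) le_rfl
        have hf : (2 * r.factorial : ℝ) ≤ (r + 2).factorial := by
          have : 2 * r.factorial ≤ (r + 2).factorial := by
            have : (r + 2).factorial = (r + 2) * ((r + 1) * r.factorial) := by
              simp [Nat.factorial]
            rw [this]
            nlinarith [Nat.factorial_pos r, Nat.zero_le (r * r * r.factorial),
              Nat.zero_le (r * r.factorial)]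
          exact_mod_cast this
        calc t ^ (r + 2) / (r + 2).factorial * |∫ ω, W ω ^ (r + 2) ∂P|
            ≤ t ^ (r + 2) / (2 * r.factorial) * (β ^ r * w) := by
              gcongr
              exact hmom r
          _ = (t ^ 2 * w / 2) * ((t * β) ^ r / r.factorial) := by
              rw [mul_pow]
              field_simp
              ring
    _ ≤ _ := by
        rw [← Finset.mul_sum, add_comm]
        have := Real.sum_le_exp_of_nonneg (mul_nonneg ht hβ0) N
        have h3 : 0 ≤ t ^ 2 * w / 2 := by positivity
        nlinarith [mul_le_mul_of_nonneg_left this h3]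

/-- Moments of a sum of bounded centred variables such that the low moments of each variable are
almost uncorrelated with those of the preceding partial sum. -/
theorem abs_integral_pow_sum_le (W : ℕ → Ω → ℝ) (m N : ℕ) {β w t ε : ℝ} (ht : 0 < t) (ht1 : t ≤ 1)
    (hε : 0 ≤ ε)
    (hW : ∀ j, BddMeas (W j)) (hβ : ∀ j ω, |W j ω| ≤ β)
    (h1 : ∀ j, ∫ ω, W j ω ∂P = 0) (h2 : ∀ j, ∫ ω, W j ω ^ 2 ∂P ≤ w)
    (hcov : ∀ j < m, ∀ l r, l + r ≤ N →
      |cov[fun ω => (∑ i ∈ Finset.range j, W i ω) ^ l, fun ω => W j ω ^ r; P]| ≤ ε) :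
    ∀ j ≤ m, ∀ l ≤ N, |∫ ω, (∑ i ∈ Finset.range j, W i ω) ^ l ∂P|
      ≤ l.factorial / t ^ l * Real.exp (j * (t ^ 2 * w * Real.exp (t * β) / 2 + 2 ^ N * ε)) := by
  have hw : 0 ≤ w := (integral_nonneg fun ω => sq_nonneg _).trans (h2 0)
  set y := t ^ 2 * w * Real.exp (t * β) / 2 with hy
  have hy0 : 0 ≤ y := by positivity
  -- The restriction `t ≤ 1` keeps the prefactor at least 1, so that the additive covariance error
  -- can be absorbed into the multiplicative bound.
  have hfac : ∀ l : ℕ, 1 ≤ (l.factorial : ℝ) / t ^ l := by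
    intro l
    rw [one_le_div (by positivity)]
    exact (pow_le_one₀ ht.le ht1).trans (by exact_mod_cast Nat.factorial_pos l)
  intro j
  induction j with
  | zero =>
    intro _ l _
    rcases Nat.eq_zero_or_pos l with rfl | hl
    · simp
    · simp only [Finset.range_zero, Finset.sum_empty, zero_pow hl.ne', integral_zero, abs_zero]
      positivity
  | succ j ih =>
    intro hj l hl
    have ih := ih (by omega)
    set T : Ω → ℝ := fun ω => ∑ i ∈ Finset.range j, W i ω with hT
    have hTb : BddMeas T := BddMeas.sum _ fun i _ => hW i
    set g := Real.exp (j * (y + 2 ^ N * ε)) with hg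
    have hg1 : 1 ≤ g := Real.one_le_exp (by positivity)
    have expand : ∫ ω, (∑ i ∈ Finset.range (j + 1), W i ω) ^ l ∂P
        = ∑ r ∈ Finset.range (l + 1), (l.choose r : ℝ) * ∫ ω, T ω ^ (l - r) * W j ω ^ r ∂P := by
      have : ∀ ω, (∑ i ∈ Finset.range (j + 1), W i ω) ^ l
          = ∑ r ∈ Finset.range (l + 1), (l.choose r : ℝ) * (T ω ^ (l - r) * W j ω ^ r) := by
        intro ω
        rw [Finset.sum_range_succ, add_comm, add_pow]
        refine Finset.sum_congr rfl fun r _ => ?_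
        simp only [hT]
        ring
      simp_rw [this]
      rw [integral_finsetSum _ fun r _ =>
        ((((hTb.pow _).mul ((hW j).pow _)).const_mul _).integrable P)]
      simp_rw [integral_const_mul]
    -- After decorrelation and the induction hypothesis, the binomial coefficient turns `(l - r)!`
    -- into `l! / r!`, which leaves exactly the weights `t^r / r!` of `sum_moments_le`.
    have term : ∀ r ∈ Finset.range (l + 1),
        |(l.choose r : ℝ) * ∫ ω, T ω ^ (l - r) * W j ω ^ r ∂P|
        ≤ l.factorial / t ^ l * g * (t ^ r / r.factorial * |∫ ω, W j ω ^ r ∂P|)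
          + l.choose r * ε := by
      intro r hr
      have hr : r ≤ l := by simpa [Nat.lt_succ_iff] using hr
      have hc := hcov j (by omega) (l - r) r (by omega)
      rw [(hTb.pow _).covariance_eq P ((hW j).pow _)] at hc
      have hm := ih (l - r) (by omega)
      have h3 : |∫ ω, T ω ^ (l - r) * W j ω ^ r ∂P|
          ≤ (l - r).factorial / t ^ (l - r) * g * |∫ ω, W j ω ^ r ∂P| + ε := by
        calc |∫ ω, T ω ^ (l - r) * W j ω ^ r ∂P|
            ≤ |(∫ ω, T ω ^ (l - r) ∂P) * ∫ ω, W j ω ^ r ∂P| + ε := by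
              have := abs_add_le (∫ ω, T ω ^ (l - r) * W j ω ^ r ∂P
                - (∫ ω, T ω ^ (l - r) ∂P) * ∫ ω, W j ω ^ r ∂P)
                ((∫ ω, T ω ^ (l - r) ∂P) * ∫ ω, W j ω ^ r ∂P)
              rw [sub_add_cancel] at this
              linarith
          _ ≤ _ := by
              rw [abs_mul]
              gcongr
      rw [abs_mul, abs_of_nonneg (Nat.cast_nonneg _)]
      calc (l.choose r : ℝ) * |∫ ω, T ω ^ (l - r) * W j ω ^ r ∂P|
          ≤ l.choose r * ((l - r).factorial / t ^ (l - r) * g * |∫ ω, W j ω ^ r ∂P| + ε) := by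
            gcongr
        _ = _ := by
            have h4 : (l.factorial : ℝ) = l.choose r * r.factorial * (l - r).factorial := by
              exact_mod_cast (Nat.choose_mul_factorial_mul_factorial hr).symm
            have h5 : t ^ l = t ^ (l - r) * t ^ r := by rw [← pow_add]; congr 1; omega
            rw [h4, h5]
            have : (r.factorial : ℝ) ≠ 0 := by positivity
            field_simp
    rw [expand]
    calc |∑ r ∈ Finset.range (l + 1), (l.choose r : ℝ) * ∫ ω, T ω ^ (l - r) * W j ω ^ r ∂P|
        ≤ ∑ r ∈ Finset.range (l + 1),
          (l.factorial / t ^ l * g * (t ^ r / r.factorial * |∫ ω, W j ω ^ r ∂P|)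
            + l.choose r * ε) :=
          (Finset.abs_sum_le_sum_abs _ _).trans (Finset.sum_le_sum term)
      _ = l.factorial / t ^ l * g *
            ∑ r ∈ Finset.range (l + 1), t ^ r / r.factorial * |∫ ω, W j ω ^ r ∂P| + 2 ^ l * ε := by
          rw [Finset.sum_add_distrib, ← Finset.mul_sum, ← Finset.sum_mul, ← Nat.cast_sum,
            Nat.sum_range_choose]
          norm_cast
      _ ≤ l.factorial / t ^ l * g * (1 + y) + l.factorial / t ^ l * g * (2 ^ N * ε) := by
          gcongr ?_ + ?_
          · exact mul_le_mul_of_nonneg_left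
              (sum_moments_le P (hW j) ht.le (hβ j) (h1 j) (h2 j) _) (by positivity)
          · have : (2 : ℝ) ^ l ≤ 2 ^ N := pow_le_pow_right₀ (by norm_num) hl
            have h6 : 1 ≤ (l.factorial : ℝ) / t ^ l * g := one_le_mul_of_one_le_of_one_le (hfac l) hg1
            calc 2 ^ l * ε ≤ 1 * (2 ^ N * ε) := by rw [one_mul]; gcongr
              _ ≤ _ := by gcongr
      _ = l.factorial / t ^ l * (g * ((y + 2 ^ N * ε) + 1)) := by ring
      _ ≤ l.factorial / t ^ l * (g * Real.exp (y + 2 ^ N * ε)) := by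
          gcongr
          exact Real.add_one_le_exp _
      _ = _ := by
          rw [hg, ← Real.exp_add]
          push_cast
          ring_nf

variable {P}

/-- Covariances of powers of centred sums, from covariances of products. -/
theorem abs_covariance_pow_le {ξ : ℕ → Ω → ℝ} (hξ : ∀ i, BddMeas (ξ i)) {A γ μ : ℝ} {n : ℕ}
    (hA : 0 ≤ A) (hγ : 0 ≤ γ) (hμ : |μ| ≤ A) (I J : Finset ℕ) (hI : I.card ≤ n) (hJ : J.card ≤ n)
    (hcov : ∀ (u v : ℕ) (_ : 0 < u) (_ : 0 < v) (i : Fin u → ℕ) (j : Fin v → ℕ),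
      (∀ k, i k ∈ I) → (∀ k, j k ∈ J) →
      |cov[fun ω => ∏ k, ξ (i k) ω, fun ω => ∏ k, ξ (j k) ω; P]| ≤ γ * A ^ (u + v))
    (l r : ℕ) :
    |cov[fun ω => (∑ i ∈ I, (ξ i ω - μ)) ^ l, fun ω => (∑ i ∈ J, (ξ i ω - μ)) ^ r; P]|
      ≤ γ * (2 * n * A) ^ (l + r) := by
  -- The hypothesis concerns products of uncentred variables, so powers of the raw sums are expanded
  -- first; the centring is restored by the binomial formula `hbin`.
  have hpow : ∀ (I : Finset ℕ) (u : ℕ) (ω : Ω), (∑ i ∈ I, ξ i ω) ^ u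
      = ∑ x ∈ Fintype.piFinset (fun _ : Fin u => I), 1 * ∏ k, ξ (x k) ω := by
    intro I u ω
    simp_rw [one_mul]
    rw [← Finset.prod_univ_sum (fun _ : Fin u => I) (fun _ i => ξ i ω)]
    simp
  have hb : ∀ I : Finset ℕ, BddMeas (fun ω => ∑ i ∈ I, ξ i ω) := fun I => BddMeas.sum _ fun i _ => hξ i
  have step : ∀ u v : ℕ,
      |cov[fun ω => (∑ i ∈ I, ξ i ω) ^ u, fun ω => (∑ i ∈ J, ξ i ω) ^ v; P]|
        ≤ γ * (n * A) ^ (u + v) := by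
    intro u v
    rcases Nat.eq_zero_or_pos u with rfl | hu
    · simp only [pow_zero]
      rw [covariance_const_left]
      simp only [abs_zero]
      positivity
    rcases Nat.eq_zero_or_pos v with rfl | hv
    · simp only [pow_zero]
      rw [covariance_const_right]
      simp only [abs_zero]
      positivity
    have key := abs_covariance_sum_le P (Fintype.piFinset (fun _ : Fin u => I))
      (Fintype.piFinset (fun _ : Fin v => J)) (fun _ => (1 : ℝ)) (fun _ => (1 : ℝ))
      (fun x ω => ∏ k, ξ (x k) ω) (fun x ω => ∏ k, ξ (x k) ω)
      (fun _ _ => BddMeas.prod _ fun k _ => hξ _) (fun _ _ => BddMeas.prod _ fun k _ => hξ _)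
    rw [← funext (hpow I u), ← funext (hpow J v)] at key
    refine key.trans ?_
    calc _ ≤ ∑ x ∈ Fintype.piFinset (fun _ : Fin u => I), ∑ y ∈ Fintype.piFinset (fun _ : Fin v => J),
          γ * A ^ (u + v) := by
          refine Finset.sum_le_sum fun x hx => Finset.sum_le_sum fun y hy => ?_
          simp only [abs_one, one_mul]
          exact hcov u v hu hv x y (Fintype.mem_piFinset.1 hx) (Fintype.mem_piFinset.1 hy)
      _ = (I.card : ℝ) ^ u * ((J.card : ℝ) ^ v * (γ * A ^ (u + v))) := by
          simp [Fintype.card_piFinset]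
      _ ≤ (n : ℝ) ^ u * ((n : ℝ) ^ v * (γ * A ^ (u + v))) := by gcongr
      _ = _ := by rw [mul_pow, pow_add (n : ℝ)]; ring
  have hbin : ∀ (I : Finset ℕ) (l : ℕ) (ω : Ω), (∑ i ∈ I, (ξ i ω - μ)) ^ l
      = ∑ u ∈ Finset.range (l + 1), ((-(I.card * μ)) ^ (l - u) * l.choose u) * (∑ i ∈ I, ξ i ω) ^ u := by
    intro I l ω
    rw [Finset.sum_sub_distrib, Finset.sum_const, nsmul_eq_mul, sub_eq_add_neg, add_pow]
    exact Finset.sum_congr rfl fun _ _ => by ring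
  have key := abs_covariance_sum_le P (Finset.range (l + 1)) (Finset.range (r + 1))
    (fun u => (-(I.card * μ)) ^ (l - u) * l.choose u)
    (fun u => (-(J.card * μ)) ^ (r - u) * r.choose u)
    (fun u ω => (∑ i ∈ I, ξ i ω) ^ u) (fun u ω => (∑ i ∈ J, ξ i ω) ^ u)
    (fun _ _ => (hb I).pow _) (fun _ _ => (hb J).pow _)
  rw [← funext (hbin I l), ← funext (hbin J r)] at key
  refine key.trans ?_
  have hcoef : ∀ (I : Finset ℕ) (_ : I.card ≤ n) (l u : ℕ),
      |(-(I.card * μ)) ^ (l - u) * l.choose u| ≤ (n * A) ^ (l - u) * l.choose u := by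
    intro I hI l u
    rw [abs_mul, abs_pow, abs_neg, abs_mul, Nat.abs_cast, Nat.abs_cast]
    gcongr
  calc _ ≤ ∑ u ∈ Finset.range (l + 1), ∑ v ∈ Finset.range (r + 1),
        ((n * A) ^ (l - u) * l.choose u) * ((n * A) ^ (r - v) * r.choose v)
          * (γ * (n * A) ^ (u + v)) := by
        refine Finset.sum_le_sum fun u _ => Finset.sum_le_sum fun v _ => ?_
        gcongr
        · exact hcoef I hI l u
        · exact hcoef J hJ r v
        · exact step u v
    _ = ∑ u ∈ Finset.range (l + 1), ∑ v ∈ Finset.range (r + 1),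
        (l.choose u : ℝ) * (r.choose v) * (γ * (n * A) ^ (l + r)) := by
        refine Finset.sum_congr rfl fun u hu => Finset.sum_congr rfl fun v hv => ?_
        have h1 : l + r = (l - u) + (r - v) + (u + v) := by
          simp only [Finset.mem_range] at hu hv
          omega
        rw [h1, pow_add _ (l - u + (r - v)), pow_add _ (l - u) (r - v)]
        ring
    _ = γ * (2 * n * A) ^ (l + r) := by
        simp_rw [← Finset.sum_mul, ← Finset.mul_sum]
        rw [← Finset.sum_mul, ← Nat.cast_sum, ← Nat.cast_sum, Nat.sum_range_choose,
          Nat.sum_range_choose]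
        push_cast
        rw [mul_assoc 2, mul_pow 2, pow_add 2]
        ring

end Moments

/-! ### Block decomposition of a decorrelated sequence -/

/-- A bounded sequence whose products decorrelate at lag `p`. -/
structure IsDecorrelated {Ω : Type*} [MeasurableSpace Ω] (P : Measure Ω) (ξ : ℕ → Ω → ℝ) (p : ℕ)
    (D μ ν τ γ A : ℝ) : Prop where
  measurable : ∀ i, Measurable (ξ i)
  abs_le : ∀ i ω, |ξ i ω| ≤ D
  mean : ∀ i, ∫ ω, ξ i ω ∂P = μ
  second_moment : ∀ i, ∫ ω, ξ i ω ^ 2 ∂P ≤ ν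
  mixed_moment : ∀ i j, i ≠ j → ∫ ω, ξ i ω * ξ j ω ∂P ≤ τ
  cov_prod : ∀ (u v : ℕ) (_ : 0 < u) (_ : 0 < v) (i : Fin u → ℕ) (j : Fin v → ℕ),
    (∀ k l, i k + p ≤ j l) →
    |cov[fun ω => ∏ k, ξ (i k) ω, fun ω => ∏ k, ξ (j k) ω; P]| ≤ γ * A ^ (u + v)
  lag_pos : 1 ≤ p
  mixed_nonneg : 0 ≤ τ
  gamma_nonneg : 0 ≤ γ
  one_le : 1 ≤ A
  bound_le : D ≤ A

namespace IsDecorrelated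

variable {Ω : Type*} [MeasurableSpace Ω] {P : Measure Ω} [IsProbabilityMeasure P]
  {ξ : ℕ → Ω → ℝ} {p : ℕ} {D μ ν τ γ A : ℝ}

omit [IsProbabilityMeasure P] in
theorem bddMeas (h : IsDecorrelated P ξ p D μ ν τ γ A) (i : ℕ) : BddMeas (ξ i) :=
  ⟨h.measurable i, D, h.abs_le i⟩

theorem abs_mean_le (h : IsDecorrelated P ξ p D μ ν τ γ A) : |μ| ≤ D := by
  rw [← h.mean 0]
  exact abs_integral_le_of_abs_le (h.abs_le 0)

omit [IsProbabilityMeasure P] in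
theorem bddMeas_sum (h : IsDecorrelated P ξ p D μ ν τ γ A) (J : Finset ℕ) :
    BddMeas (fun ω => ∑ i ∈ J, (ξ i ω - μ)) :=
  BddMeas.sum _ fun i _ => (h.bddMeas i).sub (BddMeas.const μ)

omit [IsProbabilityMeasure P] in
theorem nu_nonneg (h : IsDecorrelated P ξ p D μ ν τ γ A) : 0 ≤ ν :=
  (integral_nonneg fun _ => sq_nonneg _).trans (h.second_moment 0)

theorem bound_nonneg (h : IsDecorrelated P ξ p D μ ν τ γ A) : 0 ≤ D :=
  (abs_nonneg _).trans h.abs_mean_le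

theorem integral_sum_eq_zero (h : IsDecorrelated P ξ p D μ ν τ γ A) (J : Finset ℕ) :
    ∫ ω, ∑ i ∈ J, (ξ i ω - μ) ∂P = 0 := by
  rw [integral_finsetSum _ fun i _ => ((h.bddMeas i).sub (BddMeas.const μ)).integrable P]
  refine Finset.sum_eq_zero fun i _ => ?_
  rw [integral_sub ((h.bddMeas i).integrable P) (integrable_const _), h.mean i]
  simp

/-- Centring only subtracts `μ²` from each product moment, so raw moments serve as bounds. Charging
`τ` on the diagonal as well keeps the sum simple. -/
theorem integral_sum_sq_le (h : IsDecorrelated P ξ p D μ ν τ γ A) {J : Finset ℕ} {c : ℕ}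
    (hJ : J.card ≤ c) : ∫ ω, (∑ i ∈ J, (ξ i ω - μ)) ^ 2 ∂P ≤ c * ν + (c : ℝ) ^ 2 * τ := by
  have hb := fun i => (h.bddMeas i).sub (BddMeas.const μ)
  have e : ∀ i j, ∫ ω, (ξ i ω - μ) * (ξ j ω - μ) ∂P = ∫ ω, ξ i ω * ξ j ω ∂P - μ ^ 2 := by
    intro i j
    have : ∀ ω, (ξ i ω - μ) * (ξ j ω - μ) = (ξ i ω * ξ j ω - μ * ξ i ω) - (μ * ξ j ω - μ ^ 2) := by
      intro ω; ring
    simp_rw [this]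
    have i1 := ((h.bddMeas i).mul (h.bddMeas j)).integrable P
    have i2 := ((h.bddMeas i).const_mul μ).integrable P
    have i3 := ((h.bddMeas j).const_mul μ).integrable P
    have i4 := (((h.bddMeas i).mul (h.bddMeas j)).sub ((h.bddMeas i).const_mul μ)).integrable P
    have i5 := (((h.bddMeas j).const_mul μ).sub (BddMeas.const (μ ^ 2))).integrable P
    rw [integral_sub i4 i5, integral_sub i1 i2,
      integral_sub i3 (integrable_const _), integral_const_mul, integral_const_mul, h.mean, h.mean]
    simp
    ring
  have e2 : ∀ ω, (∑ i ∈ J, (ξ i ω - μ)) ^ 2 = ∑ i ∈ J, ∑ j ∈ J, (ξ i ω - μ) * (ξ j ω - μ) := by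
    intro ω
    rw [sq, Finset.sum_mul_sum]
  simp_rw [e2]
  rw [integral_finsetSum _ fun i _ => (BddMeas.sum J fun j _ => (hb i).mul (hb j)).integrable P]
  calc ∑ i ∈ J, ∫ ω, ∑ j ∈ J, (ξ i ω - μ) * (ξ j ω - μ) ∂P
      = ∑ i ∈ J, ∑ j ∈ J, (∫ ω, ξ i ω * ξ j ω ∂P - μ ^ 2) := by
        refine Finset.sum_congr rfl fun i _ => ?_
        rw [integral_finsetSum _ fun j _ => ((hb i).mul (hb j)).integrable P]
        exact Finset.sum_congr rfl fun j _ => e i j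
    _ ≤ ∑ i ∈ J, ∑ j ∈ J, ((if i = j then ν else 0) + τ) := by
        refine Finset.sum_le_sum fun i _ => Finset.sum_le_sum fun j _ => ?_
        have := h.mixed_nonneg
        split_ifs with hij
        · subst hij
          have := h.second_moment i
          simp_rw [sq] at this
          nlinarith [sq_nonneg μ]
        · have := h.mixed_moment i j hij
          nlinarith [sq_nonneg μ]
    _ = J.card * ν + (J.card : ℝ) ^ 2 * τ := by
        simp_rw [Finset.sum_add_distrib]
        simp
        ring
    _ ≤ _ := by
        have := h.mixed_nonneg
        have := h.nu_nonneg
        gcongr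

/-- Indices below `n` lying in the `t`-th block of length `p`. -/
def block (n p t : ℕ) : Finset ℕ := (Finset.range n).filter fun i => i / p = t

theorem card_block_le (n t : ℕ) (hp : 1 ≤ p) : (block n p t).card ≤ p := by
  have : block n p t ⊆ Finset.Ico (p * t) (p * t + p) := by
    intro i hi
    simp only [block, Finset.mem_filter] at hi
    have h1 := Nat.div_add_mod i p
    have h2 := Nat.mod_lt i hp
    rw [hi.2] at h1
    simp only [Finset.mem_Ico]
    omega
  simpa using Finset.card_le_card this

/-- Union of the first `m` blocks of parity `e`. -/
def blocks (n p e m : ℕ) : Finset ℕ :=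
  (Finset.range n).filter fun i => i / p % 2 = e ∧ i / p < 2 * m + e

theorem sum_blocks (n e m : ℕ) (he : e < 2) (f : ℕ → ℝ) :
    ∑ j ∈ Finset.range m, ∑ i ∈ block n p (2 * j + e), f i = ∑ i ∈ blocks n p e m, f i := by
  induction m with
  | zero =>
    simp only [Finset.range_zero, Finset.sum_empty]
    symm
    refine Finset.sum_eq_zero fun i hi => ?_
    simp only [blocks, Finset.mem_filter] at hi
    generalize i / p = z at hi
    omega
  | succ m ih =>
    rw [Finset.sum_range_succ, ih, ← Finset.sum_union]
    · refine Finset.sum_congr ?_ fun _ _ => rfl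
      ext i
      simp only [blocks, block, Finset.mem_union, Finset.mem_filter, Finset.mem_range]
      generalize i / p = z
      omega
    · rw [Finset.disjoint_left]
      intro i hi hi'
      simp only [blocks, block, Finset.mem_filter] at hi hi'
      generalize i / p = z at hi hi'
      omega

/-- Blocks of the same parity are separated by a whole block of the other parity, of length `p`. -/
theorem lag_le_of_mem {n e m i j : ℕ} (hi : i ∈ blocks n p e m)
    (hj : j ∈ block n p (2 * m + e)) (hp : 1 ≤ p) : i + p ≤ j := by
  simp only [blocks, block, Finset.mem_filter] at hi hj
  have h1 := Nat.div_add_mod i p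
  have h2 := Nat.mod_lt i hp
  have h3 := Nat.div_add_mod j p
  have h4 : i / p + 2 ≤ j / p := by
    generalize i / p = z at *
    omega
  have h5 : p * (i / p + 2) ≤ p * (j / p) := Nat.mul_le_mul_left _ h4
  rw [mul_add] at h5
  omega

/-- The block sums of one parity take the role of `W` in `abs_integral_pow_sum_le`: each is bounded
by `2Dp`, has second moment at most `pν + p²τ`, and follows its predecessors at lag at least `p`. -/
theorem integral_pow_blocks_le (h : IsDecorrelated P ξ p D μ ν τ γ A) {n k e : ℕ} (hn : 1 ≤ n)
    (he : e < 2) {t : ℝ} (ht : 0 < t) (ht1 : t ≤ 1) (m : ℕ) :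
    ∫ ω, (∑ i ∈ blocks n p e m, (ξ i ω - μ)) ^ (2 * k) ∂P
      ≤ (2 * k).factorial / t ^ (2 * k) * Real.exp (m * (t ^ 2 * (p * ν + (p : ℝ) ^ 2 * τ)
          * Real.exp (t * (2 * D * p)) / 2 + 2 ^ (2 * k) * (γ * (2 * n * A) ^ (2 * k)))) := by
  have hA := h.one_le
  have hn' : (1 : ℝ) ≤ n := by exact_mod_cast hn
  have hγ := h.gamma_nonneg
  have key := abs_integral_pow_sum_le P (fun j ω => ∑ i ∈ block n p (2 * j + e), (ξ i ω - μ)) m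
    (2 * k) (β := 2 * D * p) (w := p * ν + (p : ℝ) ^ 2 * τ) (t := t)
    (ε := γ * (2 * n * A) ^ (2 * k)) ht ht1 (by positivity)
    (fun j => h.bddMeas_sum _) ?_ (fun j => h.integral_sum_eq_zero _)
    (fun j => h.integral_sum_sq_le (card_block_le n _ h.lag_pos)) ?_ m le_rfl (2 * k) le_rfl
  · refine (le_abs_self _).trans ?_
    simp_rw [sum_blocks n e m he (fun i => ξ i _ - μ)] at key
    exact key
  · intro j ω
    refine (Finset.abs_sum_le_sum_abs _ _).trans ?_
    calc ∑ i ∈ block n p (2 * j + e), |ξ i ω - μ| ≤ ∑ i ∈ block n p (2 * j + e), (2 * D) := by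
          refine Finset.sum_le_sum fun i _ => (abs_sub _ _).trans ?_
          linarith [h.abs_le i ω, h.abs_mean_le]
      _ = (block n p (2 * j + e)).card * (2 * D) := by simp
      _ ≤ p * (2 * D) := by
          have := h.bound_nonneg
          gcongr
          exact card_block_le n _ h.lag_pos
      _ = 2 * D * p := by ring
  · intro j _ l r hlr
    simp_rw [sum_blocks n e j he (fun i => ξ i _ - μ)]
    have hc : ∀ (q : ℕ → Prop) [DecidablePred q], ((Finset.range n).filter q).card ≤ n := fun q _ => by
      simpa using Finset.card_filter_le (Finset.range n) q
    refine (abs_covariance_pow_le h.bddMeas (zero_le_one.trans hA) hγ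
      (h.abs_mean_le.trans h.bound_le) _ _ (hc _) (hc _) ?_ l r).trans ?_
    · intro u v hu hv i' j' hi' hj'
      exact h.cov_prod u v hu hv i' j' fun a b => lag_le_of_mem (hi' a) (hj' b) h.lag_pos
    · gcongr
      nlinarith

/-- High moments of the centred sum. -/
theorem integral_pow_le (h : IsDecorrelated P ξ p D μ ν τ γ A) {n k : ℕ} (hn : 1 ≤ n) (hk : 1 ≤ k)
    {t : ℝ} (ht : 0 < t) (ht1 : t ≤ 1) :
    ∫ ω, (∑ i ∈ Finset.range n, (ξ i ω - μ)) ^ (2 * k) ∂P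
      ≤ 4 ^ k * ((2 * k).factorial / t ^ (2 * k) *
        Real.exp ((n / (2 * p) + 1) * (t ^ 2 * (p * ν + (p : ℝ) ^ 2 * τ)
          * Real.exp (t * (2 * D * p)) / 2 + 2 ^ (2 * k) * (γ * (2 * n * A) ^ (2 * k))))) := by
  -- The division is in `ℕ`; the additional block of each parity covers the incomplete end of the
  -- range.
  set m := n / (2 * p) + 1 with hm
  have hsplit : ∀ ω, ∑ i ∈ Finset.range n, (ξ i ω - μ)
      = ∑ i ∈ blocks n p 0 m, (ξ i ω - μ) + ∑ i ∈ blocks n p 1 m, (ξ i ω - μ) := by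
    intro ω
    rw [← Finset.sum_union]
    · refine Finset.sum_congr ?_ fun _ _ => rfl
      ext i
      simp only [blocks, Finset.mem_union, Finset.mem_filter, Finset.mem_range]
      have h1 : i < n → i / p < 2 * m := by
        intro hi
        have : i / p ≤ n / p := Nat.div_le_div_right hi.le
        rw [hm, mul_comm 2 p, ← Nat.div_div_eq_div_mul]
        omega
      generalize i / p = z at *
      omega
    · rw [Finset.disjoint_left]
      intro i hi hi'
      simp only [blocks, Finset.mem_filter] at hi hi'
      omega
  have hb := fun e => (h.bddMeas_sum (blocks n p e m)).pow (2 * k)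
  have hm' : (m : ℝ) ≤ n / (2 * p) + 1 := by
    rw [hm]
    push_cast
    gcongr
    exact_mod_cast Nat.cast_div_le (α := ℝ) (m := n) (n := 2 * p)
  have hγ := h.gamma_nonneg
  have hν := h.nu_nonneg
  have hτ := h.mixed_nonneg
  have hA := h.one_le
  set Z := (2 * k).factorial / t ^ (2 * k) * Real.exp ((n / (2 * p) + 1) *
    (t ^ 2 * (p * ν + (p : ℝ) ^ 2 * τ)
          * Real.exp (t * (2 * D * p)) / 2 + 2 ^ (2 * k) * (γ * (2 * n * A) ^ (2 * k)))) with hZ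
  have hpart : ∀ e < 2, ∫ ω, (∑ i ∈ blocks n p e m, (ξ i ω - μ)) ^ (2 * k) ∂P ≤ Z := by
    intro e he
    refine (h.integral_pow_blocks_le hn he ht ht1 m).trans ?_
    rw [hZ]
    gcongr
  calc ∫ ω, (∑ i ∈ Finset.range n, (ξ i ω - μ)) ^ (2 * k) ∂P
      ≤ ∫ ω, 2 ^ (2 * k - 1) * ((∑ i ∈ blocks n p 0 m, (ξ i ω - μ)) ^ (2 * k)
          + (∑ i ∈ blocks n p 1 m, (ξ i ω - μ)) ^ (2 * k)) ∂P := by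
        refine integral_mono (((h.bddMeas_sum _).pow _).integrable P)
          ((((hb 0).add (hb 1)).const_mul _).integrable P) fun ω => ?_
        simp only [hsplit ω]
        exact Even.add_pow_le (even_two_mul k)
    _ ≤ 2 ^ (2 * k - 1) * (Z + Z) := by
        rw [integral_const_mul, integral_add ((hb 0).integrable P) ((hb 1).integrable P)]
        gcongr
        · exact hpart 0 (by norm_num)
        · exact hpart 1 (by norm_num)
    _ = 4 ^ k * Z := by
        obtain ⟨k', rfl⟩ : ∃ k', k = k' + 1 := ⟨k - 1, by omega⟩
        have : 2 * (k' + 1) - 1 = 2 * k' + 1 := by omega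
        rw [this, pow_succ 2, pow_mul, pow_succ (4 : ℝ)]
        norm_num
        ring

end IsDecorrelated

/-! ### Taylor expansion in Hölder classes -/

section Holder

theorem holderIndex_lt {s : ℝ} (hs : 0 < s) : (holderIndex s : ℝ) < s :=
  Nat.sSup_mem (s := {k : ℕ | (k : ℝ) < s}) ⟨0, by simpa using hs⟩
    ⟨⌈s⌉₊, fun k hk => by
      have : (k : ℝ) < ⌈s⌉₊ := lt_of_lt_of_le hk (Nat.le_ceil s)
      exact_mod_cast this.le⟩

/-- Taylor's formula with a Hölder remainder. -/
theorem abs_sub_taylor_le {L α : ℝ} (hL : 0 ≤ L) (hα : 0 ≤ α) (m : ℕ) : ∀ f : ℝ → ℝ,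
    (∀ k < m, Differentiable ℝ (iteratedDeriv k f)) →
    (∀ x y, |iteratedDeriv m f x - iteratedDeriv m f y| ≤ L * |x - y| ^ α) → ∀ x z : ℝ,
    |f (x + z) - ∑ l ∈ Finset.range (m + 1), iteratedDeriv l f x * (z ^ l / l.factorial)|
      ≤ L * |z| ^ (m + α) := by
  induction m with
  | zero =>
    intro f _ hf x z
    simpa using hf (x + z) x
  | succ m ih =>
    intro f hd hf x z
    have hd' : ∀ k < m, Differentiable ℝ (iteratedDeriv k (deriv f)) := fun k hk => by
      rw [← iteratedDeriv_succ']
      exact hd (k + 1) (by omega)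
    have ih := ih (deriv f) hd' (by simpa only [← iteratedDeriv_succ'] using hf) x
    have hf0 : Differentiable ℝ f := by simpa using hd 0 (by omega)
    set r : ℝ → ℝ := fun z => f (x + z)
      - ∑ l ∈ Finset.range (m + 2), iteratedDeriv l f x * (z ^ l / l.factorial) with hr
    have hder : ∀ z, HasDerivAt r (deriv f (x + z)
        - ∑ l ∈ Finset.range (m + 1), iteratedDeriv l (deriv f) x * (z ^ l / l.factorial)) z := by
      intro z
      have h1 : HasDerivAt (fun z => f (x + z)) (deriv f (x + z)) z :=
        HasDerivAt.comp_const_add x z (hf0 (x + z)).hasDerivAt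
      have h2 : HasDerivAt
          (fun z => ∑ l ∈ Finset.range (m + 2), iteratedDeriv l f x * (z ^ l / l.factorial))
          (∑ l ∈ Finset.range (m + 2), iteratedDeriv l f x * (l * z ^ (l - 1) / l.factorial)) z :=
        HasDerivAt.fun_sum fun l _ => ((hasDerivAt_pow l z).div_const _).const_mul _
      refine (h1.fun_sub h2).congr_deriv ?_
      congr 1
      rw [Finset.sum_range_succ' _ (m + 1)]
      simp only [Nat.cast_zero, zero_mul, zero_div, mul_zero, add_zero]
      refine Finset.sum_congr rfl fun l _ => ?_
      rw [iteratedDeriv_succ', Nat.factorial_succ]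
      push_cast
      have : (l.factorial : ℝ) ≠ 0 := by positivity
      have : (l : ℝ) + 1 ≠ 0 := by positivity
      field_simp
    have hr0 : r 0 = 0 := by
      simp only [hr, add_zero]
      rw [Finset.sum_range_succ']
      simp
    -- The remainder vanishes at 0 and its derivative is the remainder of `deriv f` one order lower,
    -- so the mean value inequality on the ball of radius `|z|` contributes one factor `|z|`.
    have key := (convex_closedBall (0 : ℝ) |z|).norm_image_sub_le_of_norm_deriv_le (f := r)
      (C := L * |z| ^ ((m : ℝ) + α)) (x := 0) (y := z)
      (fun y _ => (hder y).differentiableAt) ?_ (by simp) (by simp)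
    · rw [hr0, sub_zero, sub_zero, Real.norm_eq_abs, Real.norm_eq_abs] at key
      refine key.trans (le_of_eq ?_)
      rcases eq_or_ne z 0 with rfl | hz
      · have : ((m + 1 : ℕ) : ℝ) + α ≠ 0 := by positivity
        rw [abs_zero, Real.zero_rpow this, mul_zero, mul_zero]
      · have : ((m + 1 : ℕ) : ℝ) + α = (m + α) + 1 := by push_cast; ring
        rw [this, Real.rpow_add_one (abs_ne_zero.2 hz), mul_assoc]
    · intro y hy
      rw [(hder y).deriv]
      refine (ih y).trans ?_
      have : |y| ≤ |z| := by simpa using hy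
      gcongr

/-- If `holderIndex s = 0` the differentiability clause is void, and continuity comes from the
Hölder bound, whose exponent is then `s > 0`. Continuity is what makes the density measurable and
the bias integrands integrable. -/
theorem IsHolderClass.continuous {V : Set ℝ} {s L B : ℝ} {f : ℝ → ℝ} (hs : 0 < s)
    (hf : IsHolderClass V s L B f) : Continuous f := by
  rcases Nat.eq_zero_or_pos (holderIndex s) with h | h
  · have hh := hf.holder
    rw [h] at hh
    simp only [iteratedDeriv_zero, Nat.cast_zero, sub_zero] at hh
    rw [continuous_iff_continuousAt]
    intro x
    rw [ContinuousAt, tendsto_iff_norm_sub_tendsto_zero]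
    have : Filter.Tendsto (fun y => L * |y - x| ^ s) (nhds x) (nhds 0) := by
      have hc : Continuous (fun y => L * |y - x| ^ s) := by
        refine continuous_const.mul (Continuous.rpow_const (by fun_prop) fun y => Or.inr hs.le)
      have := hc.tendsto x
      simpa [Real.zero_rpow hs.ne'] using this
    exact squeeze_zero (fun _ => norm_nonneg _) (fun y => hh y x) this
  · simpa using (hf.differentiable 0 h).continuous

end Holder

/-! ### Bumps and the product test functions built on them -/

/-- Bounded Lipschitz functions supported in `[-1, 1]`. -/
structure IsBump (D : ℝ) (G : ℝ → ℝ) : Prop where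
  support_subset : Function.support G ⊆ Set.Icc (-1) 1
  abs_le : ∀ x, |G x| ≤ D
  lipschitz : ∀ x y, |G x - G y| ≤ D * |x - y|
  one_le : 1 ≤ D

namespace IsBump

variable {D : ℝ} {G : ℝ → ℝ}

theorem continuous (hG : IsBump D G) : Continuous G := by
  refine (LipschitzWith.of_dist_le_mul (K := D.toNNReal) fun x y => ?_).continuous
  rw [Real.coe_toNNReal _ (zero_le_one.trans hG.one_le)]
  simpa [Real.dist_eq] using hG.lipschitz x y

theorem eq_zero (hG : IsBump D G) {x : ℝ} (hx : 1 < |x|) : G x = 0 := by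
  by_contra h
  have := hG.support_subset h
  rw [Set.mem_Icc, ← _root_.abs_le] at this
  linarith

/-- Allows the deviation bounds to be applied to `K²`, hence to the empirical variance `JHat`. -/
theorem sq (hG : IsBump D G) : IsBump (2 * D ^ 2) (fun x => G x ^ 2) where
  support_subset x hx := hG.support_subset fun h => hx (by simp [h])
  abs_le x := by
    have := hG.abs_le x
    have := hG.one_le
    rw [abs_pow]
    nlinarith [abs_nonneg (G x)]
  lipschitz x y := by
    have h1 := hG.lipschitz x y
    have h2 : |G x + G y| ≤ 2 * D := (abs_add_le _ _).trans (by linarith [hG.abs_le x, hG.abs_le y])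
    have : G x ^ 2 - G y ^ 2 = (G x + G y) * (G x - G y) := by ring
    rw [this, abs_mul]
    calc |G x + G y| * |G x - G y| ≤ (2 * D) * (D * |x - y|) := by
          gcongr
          linarith [hG.one_le]
      _ = _ := by ring
  one_le := by nlinarith [hG.one_le]

theorem eq_zero_of_notMem (hG : IsBump D G) {h x₀ y : ℝ} (hh : 0 < h)
    (hy : y ∉ Set.Icc (x₀ - h) (x₀ + h)) : G ((x₀ - y) / h) = 0 := by
  refine hG.eq_zero ?_
  rw [abs_div, abs_of_pos hh, one_lt_div hh]
  by_contra hc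
  rw [not_lt, _root_.abs_le] at hc
  exact hy ⟨by linarith, by linarith⟩

end IsBump

/-- The kernel vanishes at 2, which is within distance 3 of every point of `[-1, 1]`, so the
Lipschitz constant also bounds the supremum. -/
theorem IsKernel.exists_isBump {K : ℝ → ℝ} (hK : IsKernel K) : ∃ D, IsBump D K := by
  obtain ⟨C, hC⟩ := hK.lipschitz
  have hl : ∀ x y, |K x - K y| ≤ C * |x - y| := fun x y => by
    simpa [Real.dist_eq] using hC.dist_le_mul x y
  have h0 : ∀ x, x ∉ Set.Icc (-1 : ℝ) 1 → K x = 0 := fun x hx => by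
    by_contra h
    exact hx (hK.support_subset h)
  have hC0 : (0 : ℝ) ≤ C := C.2
  refine ⟨max 1 (3 * C), hK.support_subset, fun x => ?_, fun x y => (hl x y).trans ?_, le_max_left _ _⟩
  · by_cases hx : x ∈ Set.Icc (-1 : ℝ) 1
    · have h2 := hl x 2
      rw [h0 2 (by simp), sub_zero] at h2
      have h3 : |x - 2| ≤ 3 := by rw [abs_le]; constructor <;> linarith [hx.1, hx.2]
      refine le_trans (h2.trans ?_) (le_max_right _ _)
      rw [mul_comm]
      gcongr
    · rw [h0 x hx]
      simp
  · gcongr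
    exact le_trans (by linarith) (le_max_right _ _)

theorem abs_integral_le_of_support {F : ℝ → ℝ} {x₀ h C : ℝ} (hh : 0 < h)
    (h0 : ∀ y, y ∉ Set.Icc (x₀ - h) (x₀ + h) → F y = 0)
    (hC : ∀ y ∈ Set.Icc (x₀ - h) (x₀ + h), |F y| ≤ C) : |∫ y, F y| ≤ C * (2 * h) := by
  rw [← setIntegral_eq_integral_of_forall_compl_eq_zero h0]
  have := norm_setIntegral_le_of_norm_le_const (μ := volume) (s := Set.Icc (x₀ - h) (x₀ + h))
    (f := F) (C := C) (by simp) hC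
  rw [Real.norm_eq_abs] at this
  refine this.trans (le_of_eq ?_)
  rw [Measure.real, Real.volume_Icc, ENNReal.toReal_ofReal (by linarith)]
  ring

/-- Factors are exchanged one at a time. The exponent `s.card` is one more than necessary, which is
harmless for `D ≥ 1`. -/
theorem abs_prod_sub_prod_le {ι : Type*} (s : Finset ι) (x y : ι → ℝ) {D : ℝ} (hD : 1 ≤ D)
    (hx : ∀ i, |x i| ≤ D) (hy : ∀ i, |y i| ≤ D) :
    |∏ i ∈ s, x i - ∏ i ∈ s, y i| ≤ D ^ s.card * ∑ i ∈ s, |x i - y i| := by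
  classical
  induction s using Finset.induction_on with
  | empty => simp
  | insert a s ha ih =>
    rw [Finset.prod_insert ha, Finset.prod_insert ha, Finset.sum_insert ha, Finset.card_insert_of_notMem ha]
    have hp : |∏ i ∈ s, y i| ≤ D ^ s.card := by
      rw [Finset.abs_prod]
      exact (Finset.prod_le_prod (fun _ _ => abs_nonneg _) fun i _ => hy i).trans (by simp)
    have hD0 : 0 ≤ D := zero_le_one.trans hD
    calc |x a * ∏ i ∈ s, x i - y a * ∏ i ∈ s, y i|
        = |x a * (∏ i ∈ s, x i - ∏ i ∈ s, y i) + (x a - y a) * ∏ i ∈ s, y i| := by ring_nf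
      _ ≤ |x a| * |∏ i ∈ s, x i - ∏ i ∈ s, y i| + |x a - y a| * |∏ i ∈ s, y i| := by
          rw [← abs_mul, ← abs_mul]
          exact abs_add_le _ _
      _ ≤ D * (D ^ s.card * ∑ i ∈ s, |x i - y i|) + |x a - y a| * D ^ s.card := by
          gcongr
          exact hx a
      _ ≤ D * (D ^ s.card * ∑ i ∈ s, |x i - y i|) + |x a - y a| * D ^ (s.card + 1) := by
          gcongr ?_ + _ * ?_
          · exact le_rfl
          · exact pow_le_pow_right₀ hD (Nat.le_succ _)
      _ = _ := by rw [pow_succ]; ring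

section TestFunctions

variable {D : ℝ} {G : ℝ → ℝ} {x₀ h : ℝ} {V : Set ℝ}

theorem supNorm_le {u : ℕ} {g : (Fin u → ℝ) → ℝ} {C : ℝ} (h : ∀ x, |g x| ≤ C) : supNorm g ≤ C :=
  ciSup_le h

theorem supNorm_nonneg {u : ℕ} (g : (Fin u → ℝ) → ℝ) : 0 ≤ supNorm g :=
  Real.iSup_nonneg fun _ => abs_nonneg _

theorem lipQuotient_nonneg {u : ℕ} (g : (Fin u → ℝ) → ℝ) (x) : 0 ≤ lipQuotient g x :=
  div_nonneg (abs_nonneg _) (Finset.sum_nonneg fun _ _ => abs_nonneg _)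

theorem lipConst_nonneg {u : ℕ} (g : (Fin u → ℝ) → ℝ) : 0 ≤ lipConst g :=
  Real.iSup_nonneg (lipQuotient_nonneg g)

theorem eq_zero_of_supNorm_eq_zero {u : ℕ} {g : (Fin u → ℝ) → ℝ}
    (hg : BddAbove (Set.range fun x => |g x|)) (h : supNorm g = 0) : g = 0 := by
  funext x
  have : |g x| ≤ supNorm g := le_ciSup hg x
  rw [h] at this
  exact abs_eq_zero.1 (le_antisymm this (abs_nonneg _))

/-- The product test function built on a bump. -/
noncomputable def prodBump (G : ℝ → ℝ) (x₀ h : ℝ) (u : ℕ) (x : Fin u → ℝ) : ℝ := ∏ k, G ((x₀ - x k) / h)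

theorem abs_prodBump_le (hG : IsBump D G) (u : ℕ) (x : Fin u → ℝ) :
    |prodBump G x₀ h u x| ≤ D ^ u := by
  rw [prodBump, Finset.abs_prod]
  calc ∏ k : Fin u, |G ((x₀ - x k) / h)| ≤ ∏ _k : Fin u, D :=
        Finset.prod_le_prod (fun _ _ => abs_nonneg _) fun _ _ => hG.abs_le _
    _ = D ^ u := by simp

theorem lipQuotient_prodBump_le (hG : IsBump D G) (hh : 0 < h) (u : ℕ)
    (z : (Fin u → ℝ) × (Fin u → ℝ)) : lipQuotient (prodBump G x₀ h u) z ≤ D ^ (u + 1) / h := by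
  have hD := hG.one_le
  have hD0 : 0 ≤ D := zero_le_one.trans hD
  refine div_le_of_le_mul₀ (Finset.sum_nonneg fun _ _ => abs_nonneg _) (by positivity) ?_
  refine (abs_prod_sub_prod_le Finset.univ _ _ hD (fun _ => hG.abs_le _) fun _ => hG.abs_le _).trans ?_
  rw [Finset.card_univ, Fintype.card_fin, pow_succ, mul_div_assoc, mul_assoc]
  gcongr
  rw [Finset.mul_sum]
  refine Finset.sum_le_sum fun k _ => (hG.lipschitz _ _).trans (le_of_eq ?_)
  rw [← sub_div, abs_div, abs_of_pos hh]
  have : x₀ - z.1 k - (x₀ - z.2 k) = -(z.1 k - z.2 k) := by ring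
  rw [this, abs_neg]
  ring

theorem prodBump_mem_testClass (hG : IsBump D G) (hh : 0 < h)
    (hV : Set.Icc (x₀ - h) (x₀ + h) ⊆ V) (u : ℕ) : prodBump G x₀ h u ∈ testClass V u := by
  refine ⟨fun x hx k _ => ?_, ⟨D ^ u, ?_⟩, ⟨D ^ (u + 1) / h, ?_⟩⟩
  · by_contra hk
    refine hx (Finset.prod_eq_zero (Finset.mem_univ k) ?_)
    exact hG.eq_zero_of_notMem hh fun hc => hk (hV hc)
  · rintro _ ⟨x, rfl⟩
    exact abs_prodBump_le hG u x
  · rintro _ ⟨x, rfl⟩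
    exact lipQuotient_prodBump_le hG hh u x

/-- With `R = D²/h ≥ 1`, both the supremum norm and the Lipschitz constant of a product of `w ≥ 1`
bumps are at most `R^w`. The polynomial weights are absorbed by `u + v + uv ≤ (u + 1)(v + 1) ≤ 2^u
2^v`. An exponential bound in `u + v` is the form that the expansion of moments requires. -/
theorem Psi_prodBump_le (hG : IsBump D G) (hh : 0 < h) (hh1 : h ≤ 1) {u v : ℕ} (hu : 0 < u)
    (hv : 0 < v) :
    Psi (prodBump G x₀ h u) (prodBump G x₀ h v) ≤ 4 * (2 * D ^ 2 / h) ^ (u + v) := by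
  have hD := hG.one_le
  have hD0 : 0 ≤ D := zero_le_one.trans hD
  set R := D ^ 2 / h with hR
  have hR1 : 1 ≤ R := by
    rw [hR, one_le_div hh]
    nlinarith
  have hDR : D ≤ R := by
    rw [hR, le_div_iff₀ hh]
    nlinarith
  have hs : ∀ w : ℕ, supNorm (prodBump G x₀ h w) ≤ R ^ w := fun w =>
    (supNorm_le (abs_prodBump_le hG w)).trans (by gcongr)
  have hl : ∀ w : ℕ, 0 < w → lipConst (prodBump G x₀ h w) ≤ R ^ w := fun w hw => by
    refine (ciSup_le (lipQuotient_prodBump_le hG hh w)).trans ?_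
    obtain ⟨w, rfl⟩ : ∃ w', w = w' + 1 := ⟨w - 1, by omega⟩
    have : D ^ (w + 1 + 1) / h = D ^ w * R := by rw [hR]; ring
    rw [this, pow_succ]
    gcongr
  have s0 := fun w => supNorm_nonneg (prodBump G x₀ h w)
  have l0 := fun w => lipConst_nonneg (prodBump G x₀ h w)
  have hR0 : 0 ≤ R := by linarith
  have e : (2 * D ^ 2 / h) ^ (u + v) = 2 ^ u * 2 ^ v * (R ^ u * R ^ v) := by
    rw [mul_div_assoc, mul_pow, pow_add, pow_add]
  have tu : (u : ℝ) + 1 ≤ 2 ^ u := by exact_mod_cast Nat.lt_two_pow_self (n := u)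
  have tv : (v : ℝ) + 1 ≤ 2 ^ v := by exact_mod_cast Nat.lt_two_pow_self (n := v)
  rw [e]
  have hRR : 0 ≤ R ^ u * R ^ v := by positivity
  have h22 : ((u : ℝ) + 1) * (v + 1) ≤ 2 ^ u * 2 ^ v := by gcongr
  have u0 : (0 : ℝ) ≤ u := Nat.cast_nonneg _
  have v0 : (0 : ℝ) ≤ v := Nat.cast_nonneg _
  refine max_le ?_ ?_
  · calc Psi₁ (prodBump G x₀ h u) (prodBump G x₀ h v) ≤ 4 * R ^ u * R ^ v := by
          unfold Psi₁
          gcongr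
          · exact s0 v
          · exact hs u
          · exact hs v
      _ ≤ 4 * (1 * (R ^ u * R ^ v)) := by rw [one_mul, mul_assoc]
      _ ≤ _ := by
          gcongr
          nlinarith
  · calc Psi₂ (prodBump G x₀ h u) (prodBump G x₀ h v)
        ≤ u * R ^ v * R ^ u + v * R ^ u * R ^ v + u * v * R ^ u * R ^ v := by
          unfold Psi₂
          gcongr
          · exact l0 u
          · exact hs v
          · exact hl u hu
          · exact l0 v
          · exact hs u
          · exact hl v hv
          · exact l0 v
          · exact hl u hu
          · exact hl v hv
      _ = (u + v + u * v) * (R ^ u * R ^ v) := by ring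
      _ ≤ (2 ^ u * 2 ^ v) * (R ^ u * R ^ v) := by
          gcongr
          linarith
      _ ≤ 4 * (2 ^ u * 2 ^ v * (R ^ u * R ^ v)) := by
          have : 0 ≤ (2 : ℝ) ^ u * 2 ^ v * (R ^ u * R ^ v) := by positivity
          linarith

end TestFunctions

/-! ### From the dependence coefficients to decorrelation -/

/-- The assumptions on the process: density `f`, dependence coefficients and local bound. -/
structure IsWeaklyDependent {Ω : Type*} [MeasurableSpace Ω] (V : Set ℝ) (a b c M B : ℝ)
    (P : Measure Ω) (X : ℤ → Ω → ℝ) (f : ℝ → ℝ) : Prop where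
  density : HasMarginalDensity P X f
  rho_le : ∀ r : ℕ, 1 ≤ r → rho V P X r ≤ ENNReal.ofReal (c * Real.exp (-a * (r : ℝ) ^ b))
  mu_le : mu V P X ≤ ENNReal.ofReal M
  le_on_window : ∀ x ∈ V, f x ≤ B
  continuous : Continuous f
  c_pos : 0 < c
  M_pos : 0 < M
  B_pos : 0 < B

/-- The integral of `G((x₀ - ·) / h)` against the density `f`. -/
noncomputable def smoothed (G : ℝ → ℝ) (x₀ h : ℝ) (f : ℝ → ℝ) : ℝ := ∫ y, G ((x₀ - y) / h) * f y

section Smoothed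

variable {D B h x₀ : ℝ} {G f : ℝ → ℝ} {V : Set ℝ}

theorem abs_smoothed_le (hG : IsBump D G) (hh : 0 < h) (hV : Set.Icc (x₀ - h) (x₀ + h) ⊆ V)
    (hf0 : ∀ x, 0 ≤ f x) (hfB : ∀ x ∈ V, f x ≤ B) :
    |smoothed G x₀ h f| ≤ D * B * (2 * h) := by
  refine abs_integral_le_of_support (x₀ := x₀) hh (fun y hy => ?_) fun y hy => ?_
  · rw [hG.eq_zero_of_notMem hh hy, zero_mul]
  · rw [abs_mul, abs_of_nonneg (hf0 y)]
    exact mul_le_mul (hG.abs_le _) (hfB y (hV hy)) (hf0 y) (zero_le_one.trans hG.one_le)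

end Smoothed

namespace IsWeaklyDependent

variable {Ω : Type*} [MeasurableSpace Ω] {V : Set ℝ} {a b c M B : ℝ} {P : Measure Ω}
  [IsProbabilityMeasure P] {X : ℤ → Ω → ℝ} {f : ℝ → ℝ} {D h x₀ : ℝ} {G : ℝ → ℝ}

omit [IsProbabilityMeasure P] in
theorem integral_comp (hX : IsWeaklyDependent V a b c M B P X f) (i : ℤ) {F : ℝ → ℝ}
    (hF : Measurable F) : ∫ ω, F (X i ω) ∂P = ∫ y, F y * f y := by
  have h1 := integral_map (μ := P) (hX.density.measurable i).aemeasurable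
    (f := F) hF.aestronglyMeasurable
  rw [← h1, hX.density.map_eq i,
    integral_withDensity_eq_integral_toReal_smul
      (hX.continuous.measurable.ennreal_ofReal) (Filter.Eventually.of_forall fun _ => ENNReal.ofReal_lt_top)]
  refine integral_congr_ae (Filter.Eventually.of_forall fun y => ?_)
  simp only [smul_eq_mul]
  rw [ENNReal.toReal_ofReal (hX.density.nonneg y), mul_comm]

theorem abs_covariance_prodBump_le (hX : IsWeaklyDependent V a b c M B P X f) (hG : IsBump D G)
    (hh : 0 < h) (hh1 : h ≤ 1) (hV : Set.Icc (x₀ - h) (x₀ + h) ⊆ V) {p : ℕ} (hp : 1 ≤ p)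
    {u v : ℕ} (hu : 0 < u) (hv : 0 < v) (i : Fin u → ℤ) (j : Fin v → ℤ)
    (hij : ∀ k l, (p : ℤ) ≤ j l - i k) :
    |cov[fun ω => ∏ k, G ((x₀ - X (i k) ω) / h), fun ω => ∏ k, G ((x₀ - X (j k) ω) / h); P]|
      ≤ 4 * c * Real.exp (-a * (p : ℝ) ^ b) * (2 * D ^ 2 / h) ^ (u + v) := by
  have hc := hX.c_pos
  have hgu := prodBump_mem_testClass hG hh hV u
  have hgv := prodBump_mem_testClass hG hh hV v
  have hle : ENNReal.ofReal
      (|cov[fun ω => prodBump G x₀ h u fun k => X (i k) ω,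
        fun ω => prodBump G x₀ h v fun l => X (j l) ω; P]|
        / Psi (prodBump G x₀ h u) (prodBump G x₀ h v))
      ≤ ENNReal.ofReal (c * Real.exp (-a * (p : ℝ) ^ b)) := by
    refine le_trans ?_ (hX.rho_le p hp)
    refine le_iSup_of_le u (le_iSup_of_le v (le_iSup_of_le hu (le_iSup_of_le hv ?_)))
    refine le_iSup_of_le i (le_iSup_of_le j (le_iSup_of_le hij ?_))
    exact le_iSup_of_le _ (le_iSup_of_le hgu (le_iSup_of_le _ (le_iSup_of_le hgv le_rfl)))
  rw [ENNReal.ofReal_le_ofReal_iff (by positivity)] at hle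
  change |cov[fun ω => prodBump G x₀ h u fun k => X (i k) ω,
        fun ω => prodBump G x₀ h v fun l => X (j l) ω; P]| ≤ _
  have hD := hG.one_le
  have hPsi := Psi_prodBump_le (x₀ := x₀) hG hh hh1 hu hv
  have hPsi0 : 0 ≤ Psi (prodBump G x₀ h u) (prodBump G x₀ h v) := by
    refine le_trans ?_ (le_max_left _ _)
    have := supNorm_nonneg (prodBump G x₀ h u)
    have := supNorm_nonneg (prodBump G x₀ h v)
    unfold Psi₁
    positivity
  -- When `Psi` is 0 the quotient in `hle` is 0 by convention and says nothing; but then one of the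
  -- test functions is identically 0, and so is the covariance.
  rcases hPsi0.eq_or_lt with h0 | h0
  · have h1 : Psi₁ (prodBump G x₀ h u) (prodBump G x₀ h v) ≤ 0 := by
      rw [h0]
      exact le_max_left _ _
    have hsu := supNorm_nonneg (prodBump G x₀ h u)
    have hsv := supNorm_nonneg (prodBump G x₀ h v)
    have h2 : supNorm (prodBump G x₀ h u) * supNorm (prodBump G x₀ h v) = 0 := by
      unfold Psi₁ at h1
      exact le_antisymm (by linarith) (mul_nonneg hsu hsv)
    have hz : cov[fun ω => prodBump G x₀ h u fun k => X (i k) ω,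
        fun ω => prodBump G x₀ h v fun l => X (j l) ω; P] = 0 := by
      rcases mul_eq_zero.1 h2 with h3 | h3
      · rw [eq_zero_of_supNorm_eq_zero hgu.2.1 h3]
        simp only [Pi.zero_apply]
        rw [covariance_const_left]
      · rw [eq_zero_of_supNorm_eq_zero hgv.2.1 h3]
        simp only [Pi.zero_apply]
        rw [covariance_const_right]
    rw [hz, abs_zero]
    positivity
  · rw [div_le_iff₀ h0] at hle
    calc _ ≤ _ := hle
      _ ≤ c * Real.exp (-a * (p : ℝ) ^ b) * (4 * (2 * D ^ 2 / h) ^ (u + v)) := by gcongr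
      _ = _ := by ring

-- The `L¹` norm of the rescaled bump is at most `2hD`, so joint moments are of order `h²`, against
-- order `h` for second moments. This gap is why correlations inside blocks are negligible for small
-- `h`.
omit [IsProbabilityMeasure P] in
theorem integral_bump_mul_le (hX : IsWeaklyDependent V a b c M B P X f) (hG : IsBump D G)
    (hh : 0 < h) (hV : Set.Icc (x₀ - h) (x₀ + h) ⊆ V) {i j : ℤ} (hij : i ≠ j) :
    ∫ ω, G ((x₀ - X i ω) / h) * G ((x₀ - X j ω) / h) ∂P ≤ M * (D * (2 * h)) ^ 2 := by
  have hM := hX.M_pos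
  have hD := hG.one_le
  set g : (Fin 1 → ℝ) → ℝ := prodBump G x₀ h 1 with hg
  have hgt : ∀ t, g (fun _ => t) = G ((x₀ - t) / h) := fun t => by simp [hg, prodBump]
  by_cases h0 : g = 0
  · have : ∀ t, G ((x₀ - t) / h) = 0 := fun t => by rw [← hgt, h0]; rfl
    simp only [this, mul_zero, integral_zero]
    positivity
  · have hmem : g ∈ testClass V 1 \ {0} := ⟨prodBump_mem_testClass hG hh hV 1, h0⟩
    have hle : ENNReal.ofReal
        (|∫ ω, (g fun _ => X i ω) * (g fun _ => X j ω) ∂P| / (norm₁ g * norm₁ g))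
        ≤ ENNReal.ofReal M := by
      refine le_trans ?_ hX.mu_le
      refine le_iSup_of_le g (le_iSup_of_le hmem (le_iSup_of_le g (le_iSup_of_le hmem ?_)))
      exact le_iSup_of_le i (le_iSup_of_le j (le_iSup_of_le hij le_rfl))
    rw [ENNReal.ofReal_le_ofReal_iff hM.le] at hle
    have hn : norm₁ g = ∫ t, |G ((x₀ - t) / h)| := by
      unfold norm₁
      simp_rw [hgt]
    have hcont : Continuous fun t => |G ((x₀ - t) / h)| := by
      have := hG.continuous
      fun_prop
    have hn1 : norm₁ g ≤ D * (2 * h) := by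
      rw [hn]
      refine (le_abs_self _).trans (abs_integral_le_of_support (x₀ := x₀) hh (fun y hy => ?_) fun y _ => ?_)
      · rw [hG.eq_zero_of_notMem hh hy, abs_zero]
      · rw [abs_abs]
        exact hG.abs_le _
    -- `mu` divides by this norm; a continuous nonnegative function that is nonzero somewhere has
    -- positive integral.
    have hn0 : 0 < norm₁ g := by
      rw [hn]
      have hcs : HasCompactSupport fun t => |G ((x₀ - t) / h)| := by
        refine HasCompactSupport.intro (isCompact_Icc (a := x₀ - h) (b := x₀ + h)) fun y hy => ?_
        rw [hG.eq_zero_of_notMem hh hy, abs_zero]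
      obtain ⟨x, hx⟩ := Function.ne_iff.1 h0
      refine hcont.integral_pos_of_hasCompactSupport_nonneg_nonzero (x := x 0) hcs
        (fun _ => abs_nonneg _) ?_
      have hx' : x = fun _ => x 0 := by
        funext k
        rw [Subsingleton.elim k 0]
      rw [hx', hgt] at hx
      exact abs_ne_zero.2 hx
    rw [div_le_iff₀ (by positivity)] at hle
    simp_rw [hgt] at hle
    calc _ ≤ _ := le_abs_self _
      _ ≤ M * (norm₁ g * norm₁ g) := hle
      _ ≤ M * ((D * (2 * h)) * (D * (2 * h))) := by gcongr
      _ = _ := by ring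

theorem isDecorrelated (hX : IsWeaklyDependent V a b c M B P X f) (hG : IsBump D G)
    (hh : 0 < h) (hh1 : h ≤ 1) (hV : Set.Icc (x₀ - h) (x₀ + h) ⊆ V) {p : ℕ} (hp : 1 ≤ p) :
    IsDecorrelated P (fun (i : ℕ) ω => G ((x₀ - X (i + 1) ω) / h)) p D (smoothed G x₀ h f)
      (smoothed (fun x => G x ^ 2) x₀ h f) (M * (D * (2 * h)) ^ 2)
      (4 * c * Real.exp (-a * (p : ℝ) ^ b)) (2 * D ^ 2 / h) := by
  have hD := hG.one_le
  have hc := hX.c_pos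
  have hM := hX.M_pos
  have hGm := hG.continuous.measurable
  have hm : Measurable fun y => G ((x₀ - y) / h) := by fun_prop
  have hm2 : Measurable fun y => G ((x₀ - y) / h) ^ 2 := by fun_prop
  have hDD : D ≤ 2 * D ^ 2 / h := by
    rw [le_div_iff₀ hh]
    nlinarith
  exact
    { measurable := fun i => hm.comp (hX.density.measurable _)
      abs_le := fun i ω => hG.abs_le _
      mean := fun i => hX.integral_comp _ hm
      second_moment := fun i => (hX.integral_comp _ hm2).le
      mixed_moment := fun i j hij => hX.integral_bump_mul_le hG hh hV (by exact_mod_cast fun h => hij (by omega))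
      cov_prod := fun u v hu hv i j hij =>
        hX.abs_covariance_prodBump_le hG hh hh1 hV hp hu hv (fun k => (i k : ℤ) + 1) (fun k => (j k : ℤ) + 1)
          fun k l => by have := hij k l; omega
      lag_pos := hp
      mixed_nonneg := by positivity
      gamma_nonneg := by positivity
      one_le := hD.trans hDD
      bound_le := hDD }

end IsWeaklyDependent

/-! ### Bias of the kernel estimator -/

section Bias

theorem smoothed_eq {K f : ℝ → ℝ} {x₀ h : ℝ} (hh : 0 < h) :
    smoothed K x₀ h f = h * ∫ u, K u * f (x₀ - h * u) := by
  unfold smoothed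
  have h1 := integral_sub_left_eq_self (fun z => K (z / h) * f (x₀ - z)) volume x₀
  simp only [sub_sub_cancel] at h1
  rw [h1]
  have h2 := Measure.integral_comp_div (fun u => K u * f (x₀ - h * u)) h
  rw [abs_of_pos hh, smul_eq_mul] at h2
  rw [← h2]
  refine integral_congr_ae (Filter.Eventually.of_forall fun z => ?_)
  simp only
  rw [mul_div_cancel₀ _ hh.ne']

/-- The order of `K` annihilates the Taylor terms of degree 1 up to `holderIndex s`, and `∫ K = 1`
reproduces `f x₀`. Only the Hölder remainder survives, and the factor 2 is the length of the
support. -/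
theorem abs_smoothed_sub_le {K f : ℝ → ℝ} {D x₀ h s L B : ℝ} {V : Set ℝ} {m : ℕ} (hB : IsBump D K)
    (hK : IsKernel K) (hm : HasOrder K m) (hsm : holderIndex s ≤ m) (hs : 0 < s) (hL : 0 < L)
    (hf : IsHolderClass V s L B f) (hh : 0 < h) :
    |h⁻¹ * smoothed K x₀ h f - f x₀| ≤ 2 * D * L * h ^ s := by
  set r := holderIndex s with hr
  have hrs := holderIndex_lt hs
  have hD := hB.one_le
  have hcs : ∀ F : ℝ → ℝ, Continuous F → Integrable (fun u => K u * F u) := fun F hF => by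
    refine (hB.continuous.mul hF).integrable_of_hasCompactSupport ?_
    refine HasCompactSupport.intro (isCompact_Icc (a := (-1 : ℝ)) (b := 1)) fun y hy => ?_
    have : K y = 0 := by
      by_contra h
      exact hy (hB.support_subset h)
    rw [Pi.mul_apply, this, zero_mul]
  have hfc := hf.continuous hs
  set T : ℝ → ℝ := fun u => ∑ l ∈ Finset.range (r + 1),
    iteratedDeriv l f x₀ * ((-(h * u)) ^ l / l.factorial) with hT
  have hTc : Continuous T := by
    rw [hT]
    fun_prop
  have hTint : ∫ u, K u * T u = f x₀ := by
    have e : ∀ u, K u * T u = ∑ l ∈ Finset.range (r + 1),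
        (iteratedDeriv l f x₀ * (-h) ^ l / l.factorial) * (K u * u ^ l) := by
      intro u
      simp only [hT, Finset.mul_sum]
      refine Finset.sum_congr rfl fun l _ => ?_
      rw [show -(h * u) = (-h) * u by ring, mul_pow]
      ring
    simp_rw [e]
    rw [integral_finsetSum _ fun l _ => (hcs (fun u => u ^ l) (by fun_prop)).const_mul _]
    simp_rw [integral_const_mul]
    rw [Finset.sum_range_succ', Finset.sum_eq_zero]
    · simp [hK.integral_eq_one]
    · intro l hl
      rw [Finset.mem_range] at hl
      rw [hm (l + 1) (by omega) (by omega), mul_zero]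
  have e : h⁻¹ * smoothed K x₀ h f - f x₀ = ∫ u, K u * (f (x₀ - h * u) - T u) := by
    rw [smoothed_eq hh, inv_mul_cancel_left₀ hh.ne']
    simp_rw [mul_sub]
    rw [integral_sub (hcs _ (by fun_prop)) (hcs _ hTc), hTint]
  rw [e]
  refine (abs_integral_le_of_support (x₀ := 0) (C := D * L * h ^ s) one_pos (fun y hy => ?_)
    fun y hy => ?_).trans (le_of_eq (by ring))
  · have : K y = 0 := by
      by_contra h
      exact hy (by simpa using hB.support_subset h)
    rw [this, zero_mul]
  · have hy1 : |y| ≤ 1 := by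
      rw [abs_le]
      simpa using hy
    have ht := abs_sub_taylor_le hL.le (sub_nonneg.2 hrs.le) r f hf.differentiable hf.holder x₀ (-(h * y))
    rw [add_sub_cancel, ← sub_eq_add_neg] at ht
    rw [abs_mul, mul_assoc]
    refine mul_le_mul (hB.abs_le y) (ht.trans ?_) (abs_nonneg _) (by linarith)
    rw [abs_neg, abs_mul, abs_of_pos hh]
    gcongr
    nlinarith

end Bias

/-! ### The bandwidth grid -/

section Grid

variable {q : ℝ} {n : ℕ} {h : ℝ}

theorem pos_of_mem_bandwidths (hh : h ∈ bandwidths q n) : 0 < h := by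
  obtain ⟨⟨k, rfl⟩, _⟩ := hh
  positivity

theorem le_one_of_mem_bandwidths (hh : h ∈ bandwidths q n) : h ≤ 1 := by
  obtain ⟨⟨k, rfl⟩, _⟩ := hh
  exact inv_le_one_of_one_le₀ (one_le_pow₀ (by norm_num))

theorem exp_le_of_mem_bandwidths (hn : 1 ≤ n) (hh : h ∈ bandwidths q n) :
    Real.exp (Real.sqrt (Real.log n)) ≤ n * h := by
  have := hh.2.1
  have hn' : (0 : ℝ) < n := by exact_mod_cast hn
  rwa [hLow, inv_mul_le_iff₀ hn'] at this

theorem one_le_of_mem_bandwidths (hn : 1 ≤ n) (hh : h ∈ bandwidths q n) : 1 ≤ n * h :=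
  (Real.one_le_exp (Real.sqrt_nonneg _)).trans (exp_le_of_mem_bandwidths hn hh)

/-- Since `n h ≥ 1`, only exponents with `2^k ≤ n` occur. The grid therefore has `O(log n)` points,
and a maximum over it may be replaced by a sum at logarithmic cost. -/
theorem bandwidths_subset (hn : 1 ≤ n) : bandwidths q n ⊆
    ((Finset.range (Nat.log 2 n + 1)).image fun k : ℕ => ((2 : ℝ) ^ k)⁻¹ : Finset ℝ) := by
  intro h hh
  have h1 := one_le_of_mem_bandwidths hn hh
  obtain ⟨⟨k, rfl⟩, _⟩ := hh
  simp only [Finset.coe_image, Set.mem_image, Finset.mem_coe, Finset.mem_range]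
  refine ⟨k, ?_, rfl⟩
  have h2 : (2 : ℝ) ^ k ≤ n := by
    rwa [← div_eq_mul_inv, one_le_div (by positivity)] at h1
  have h3 : 2 ^ k ≤ n := by exact_mod_cast h2
  exact Nat.lt_succ_of_le (Nat.le_log_of_pow_le (by norm_num) h3)

theorem finite_bandwidths (q : ℝ) (hn : 1 ≤ n) : (bandwidths q n).Finite :=
  (Finset.finite_toSet _).subset (bandwidths_subset hn)

theorem card_bandwidths_le (hn : 1 ≤ n) :
    ((finite_bandwidths q hn).toFinset.card : ℝ) ≤ 2 * Real.log n + 1 := by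
  have h1 : (finite_bandwidths q hn).toFinset.card ≤ Nat.log 2 n + 1 := by
    refine (Finset.card_le_card (t := (Finset.range (Nat.log 2 n + 1)).image
      fun k : ℕ => ((2 : ℝ) ^ k)⁻¹) ?_).trans (Finset.card_image_le.trans (by simp))
    intro x hx
    exact_mod_cast bandwidths_subset hn ((Set.Finite.mem_toFinset _).1 hx)
  have h2 : (Nat.log 2 n : ℝ) ≤ 2 * Real.log n := by
    have h3 : ((2 : ℝ) ^ Nat.log 2 n) ≤ n := by exact_mod_cast Nat.pow_log_le_self 2 (by omega)
    have h4 := Real.log_le_log (by positivity) h3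
    rw [Real.log_pow] at h4
    nlinarith [Real.log_two_gt_d9, Nat.cast_nonneg (α := ℝ) (Nat.log 2 n)]
  calc ((finite_bandwidths q hn).toFinset.card : ℝ) ≤ ((Nat.log 2 n + 1 : ℕ) : ℝ) := by
        exact_mod_cast h1
    _ ≤ _ := by push_cast; linarith

theorem Icc_subset_nbhd (x₀ : ℝ) (hh : h ∈ bandwidths q n) :
    Set.Icc (x₀ - h) (x₀ + h) ⊆ nbhd q n x₀ := by
  have h1 := hh.2.2
  have h2 : hHigh q n = (1 / Real.log n) ^ (1 / q) := by
    rw [hHigh, one_div (Real.log n), Real.inv_rpow (Real.log_natCast_nonneg n), neg_div, Real.rpow_neg (Real.log_natCast_nonneg n)]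
  rw [h2] at h1
  exact Set.Icc_subset_Icc (by linarith) (by linarith)

theorem abs_log_le (hn : 1 ≤ n) (hh : h ∈ bandwidths q n) : |Real.log h| ≤ Real.log n := by
  have h0 := pos_of_mem_bandwidths hh
  have hn' : (0 : ℝ) < n := by exact_mod_cast hn
  rw [abs_of_nonpos (Real.log_nonpos h0.le (le_one_of_mem_bandwidths hh))]
  have := Real.log_nonneg (one_le_of_mem_bandwidths hn hh)
  rw [Real.log_mul hn'.ne' h0.ne'] at this
  linarith

end Grid

/-! ### Pathwise oracle inequality -/

section Oracle

variable {K : ℝ → ℝ} {q x₀ : ℝ} {n : ℕ}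

theorem MHat_nonneg (h : ℝ) (x : Fin n → ℝ) : 0 ≤ MHat K q x₀ h x := Real.sqrt_nonneg _

theorem abs_sub_le_biasProxy (hn : 1 ≤ n) (h : ℝ) {η : ℝ} (hη : η ∈ bandwidths q n)
    (x : Fin n → ℝ) :
    |kernelEstimator K x₀ (max h η) x - kernelEstimator K x₀ η x|
      ≤ biasProxy K q x₀ h x + MHat₂ K q x₀ h η x := by
  have : Finite (bandwidths q n) := finite_bandwidths q hn
  have h1 := le_ciSup (f := fun η : bandwidths q n =>
    max 0 (|kernelEstimator K x₀ (max h η) x - kernelEstimator K x₀ η x| - MHat₂ K q x₀ h η x))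
    (Set.finite_range _).bddAbove ⟨η, hη⟩
  have h2 := (le_max_right _ _).trans h1
  change |kernelEstimator K x₀ (max h η) x - kernelEstimator K x₀ η x| - MHat₂ K q x₀ h η x
    ≤ biasProxy K q x₀ h x at h2
  linarith

/-- The oracle inequality for the selected bandwidth, along a given sample. -/
theorem abs_adaptiveEstimator_sub_le (hn : 1 ≤ n) {hhat : (Fin n → ℝ) → ℝ}
    (hsel : IsSelectionRule K q x₀ hhat) (x : Fin n → ℝ) (e : ℝ → ℝ) {y β ζ h : ℝ}
    (hh : h ∈ bandwidths q n) (hζ : 0 ≤ ζ) (hβ : ∀ η ∈ bandwidths q n, η ≤ h → |e η - y| ≤ β)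
    (hdev : ∀ η ∈ bandwidths q n, |kernelEstimator K x₀ η x - e η| ≤ MHat K q x₀ η x + ζ) :
    |adaptiveEstimator K x₀ hhat x - y| ≤ 13 * ζ + 7 * MHat K q x₀ h x + 13 * β := by
  have hβ0 : 0 ≤ β := (abs_nonneg _).trans (hβ h hh le_rfl)
  set g := hhat x with hg
  have hgm : g ∈ bandwidths q n := hsel.mem x
  -- For `η ≥ h` the two estimators compared coincide. For `η ≤ h` both biases are at most `β`, and
  -- the subtracted penalties absorb the deviations up to `2ζ`.
  have hA : biasProxy K q x₀ h x ≤ 2 * ζ + 2 * β := by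
    have : Nonempty (bandwidths q n) := ⟨⟨h, hh⟩⟩
    refine ciSup_le fun η => max_le (by positivity) ?_
    obtain ⟨η, hη⟩ := η
    simp only [MHat₂]
    have m1 := MHat_nonneg (K := K) (q := q) (x₀ := x₀) η x
    have m2 := MHat_nonneg (K := K) (q := q) (x₀ := x₀) (max h η) x
    rcases le_total h η with hle | hle
    · rw [max_eq_right hle] at m2 ⊢
      rw [sub_self, abs_zero]
      linarith
    · rw [max_eq_left hle] at m2 ⊢
      have a1 := abs_le.1 (hdev h hh)
      have a2 := abs_le.1 (hdev η hη)
      have a3 := abs_le.1 (hβ h hh le_rfl)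
      have a4 := abs_le.1 (hβ η hη hle)
      have : |kernelEstimator K x₀ h x - kernelEstimator K x₀ η x|
          ≤ MHat K q x₀ h x + MHat K q x₀ η x + 2 * ζ + 2 * β := by
        rw [abs_le]
        constructor <;> linarith [a1.1, a1.2, a2.1, a2.2, a3.1, a3.2, a4.1, a4.2]
      linarith
  have b1 := abs_sub_le_biasProxy (K := K) (x₀ := x₀) hn h hgm x
  have b2 := abs_sub_le_biasProxy (K := K) (x₀ := x₀) hn g hh x
  rw [max_comm g h] at b2
  simp only [MHat₂] at b1 b2
  rw [max_comm g h] at b2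
  have hmin := hsel.minimizes x h hh
  rw [← hg] at hmin
  -- No monotonicity of the random penalty in the bandwidth is available, so the sum of both values
  -- is used.
  have hmax : MHat K q x₀ (max h g) x ≤ MHat K q x₀ h x + MHat K q x₀ g x := by
    have m1 := MHat_nonneg (K := K) (q := q) (x₀ := x₀) h x
    have m2 := MHat_nonneg (K := K) (q := q) (x₀ := x₀) g x
    rcases le_total h g with hle | hle
    · rw [max_eq_right hle]; linarith
    · rw [max_eq_left hle]; linarith
  have c1 := abs_le.1 (hdev h hh)
  have c2 := abs_le.1 (hβ h hh le_rfl)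
  have d1 := abs_le.1 b1
  have d2 := abs_le.1 b2
  -- Passing from `g` to `max h g`, to `h` and to `y` costs `A(h) + A(g) + 3 MHat g + 4 MHat h + ζ +
  -- β`. By minimality `A(g) + 3 MHat g ≤ 3 A(h) + 3 MHat h`, and `hA` then gives `9ζ + 7 MHat h +
  -- 9β`, within the stated bound.
  change |kernelEstimator K x₀ g x - y| ≤ _
  have hAg : 0 ≤ biasProxy K q x₀ g x := Real.iSup_nonneg fun _ => le_max_left _ _
  have m2 := MHat_nonneg (K := K) (q := q) (x₀ := x₀) g x
  have hA0 : 0 ≤ biasProxy K q x₀ h x := Real.iSup_nonneg fun _ => le_max_left _ _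
  rw [abs_le]
  constructor <;> linarith [c1.1, c1.2, c2.1, c2.2, d1.1, d1.2, d2.1, d2.2]

/-- Uses only `h⁻¹ ≤ n`; this serves on the exceptional event and for small sample sizes. -/
theorem abs_kernelEstimator_le {D : ℝ} (hK : IsBump D K) (hn : 1 ≤ n) {h : ℝ}
    (hh : h ∈ bandwidths q n) (x : Fin n → ℝ) : |kernelEstimator K x₀ h x| ≤ D * n := by
  have h0 := pos_of_mem_bandwidths hh
  have h1 := one_le_of_mem_bandwidths hn hh
  have hD := hK.one_le
  have hn' : (0 : ℝ) < n := by exact_mod_cast hn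
  have hinv : h⁻¹ ≤ n := by
    rw [inv_le_iff_one_le_mul₀ h0]
    exact h1
  rw [kernelEstimator, abs_mul, abs_of_pos (by positivity), one_div, inv_mul_le_iff₀ hn']
  calc |∑ i, scaled K h (x₀ - x i)| ≤ ∑ i : Fin n, |scaled K h (x₀ - x i)| :=
        Finset.abs_sum_le_sum_abs _ _
    _ ≤ ∑ _i : Fin n, D * n := by
        refine Finset.sum_le_sum fun i _ => ?_
        rw [scaled, abs_mul, abs_of_pos (by positivity), mul_comm]
        exact mul_le_mul (hK.abs_le _) hinv (by positivity) (by linarith)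
    _ = _ := by simp

end Oracle

/-! ### Estimators expressed through centred sums -/

section Sums

/-- The centred sum of the bump `G` over the first `n` observations. -/
noncomputable def centredSum {Ω : Type*} (G : ℝ → ℝ) (x₀ h : ℝ) (f : ℝ → ℝ) (X : ℤ → Ω → ℝ) (n : ℕ)
    (ω : Ω) : ℝ :=
  ∑ i ∈ Finset.range n, (G ((x₀ - X ((i : ℤ) + 1) ω) / h) - smoothed G x₀ h f)

variable {Ω : Type*} {K : ℝ → ℝ} {x₀ h : ℝ} {f : ℝ → ℝ} {X : ℤ → Ω → ℝ} {n : ℕ} {ω : Ω}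

theorem centredSum_eq (G : ℝ → ℝ) :
    centredSum G x₀ h f X n ω
      = ∑ i : Fin n, G ((x₀ - observations X n ω i) / h) - n * smoothed G x₀ h f := by
  rw [centredSum, Finset.sum_sub_distrib, Finset.sum_const, Finset.card_range, nsmul_eq_mul,
    Finset.sum_range (fun i => G ((x₀ - X ((i : ℤ) + 1) ω) / h))]
  rfl

theorem kernelEstimator_sub_eq (hn : 1 ≤ n) (hh : 0 < h) :
    kernelEstimator K x₀ h (observations X n ω) - h⁻¹ * smoothed K x₀ h f
      = centredSum K x₀ h f X n ω / (n * h) := by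
  have hn' : (n : ℝ) ≠ 0 := by positivity
  rw [centredSum_eq, kernelEstimator]
  simp only [scaled, ← Finset.mul_sum]
  simp only [← div_eq_inv_mul]
  field_simp

theorem JHat_sub_eq (hn : 1 ≤ n) (hh : 0 < h) :
    JHat K x₀ h (observations X n ω) - smoothed (fun x => K x ^ 2) x₀ h f / (n * h ^ 2)
      = centredSum (fun x => K x ^ 2) x₀ h f X n ω / (n * h) ^ 2 := by
  have hn' : (n : ℝ) ≠ 0 := by positivity
  rw [centredSum_eq, JHat]
  simp only [scaled, mul_pow, ← Finset.mul_sum]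
  simp only [← div_eq_inv_mul]
  field_simp

end Sums

/-! ### Crude and sharp moment bounds -/

/-- The exact exponential base is needed in `integral_pow_le_sharp`, where a loss of a factor `C^k`
would spoil the tail exponent. The induction step is `(1 + 1/n)^(n+1) ≥ e`. -/
theorem factorial_le_stirling {n : ℕ} (hn : 1 ≤ n) :
    (n.factorial : ℝ) ≤ Real.exp 1 * n * (n / Real.exp 1) ^ n := by
  induction n, hn using Nat.le_induction with
  | base =>
    have : Real.exp 1 * (1 : ℕ) * ((1 : ℕ) / Real.exp 1) ^ 1 = 1 := by
      have := Real.exp_pos 1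
      push_cast
      field_simp
    rw [this]
    simp
  | succ n hn ih =>
    have hn0 : (0 : ℝ) < n := by exact_mod_cast hn
    have he := Real.exp_pos 1
    have key : (n : ℝ) ^ (n + 1) * Real.exp 1 ≤ (n + 1) ^ (n + 1) := by
      have h1 : Real.exp (1 / (n + 1)) ≤ (n + 1) / n := by
        have h2 := Real.one_sub_inv_le_log_of_pos (x := (n + 1 : ℝ) / n) (by positivity)
        have h3 : 1 / (n + 1 : ℝ) = 1 - ((n + 1 : ℝ) / n)⁻¹ := by field_simp; ring
        rw [h3]
        exact (Real.exp_le_exp.2 h2).trans (Real.exp_log (by positivity)).le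
      have h4 : Real.exp 1 = Real.exp (1 / (n + 1)) ^ (n + 1) := by
        rw [← Real.exp_nat_mul]
        congr 1
        push_cast
        field_simp
      calc (n : ℝ) ^ (n + 1) * Real.exp 1
          ≤ (n : ℝ) ^ (n + 1) * ((n + 1) / n) ^ (n + 1) := by
            rw [h4]
            gcongr
        _ = _ := by rw [← mul_pow, mul_div_cancel₀ _ hn0.ne']
    rw [Nat.factorial_succ]
    push_cast
    calc ((n : ℝ) + 1) * n.factorial ≤ (n + 1) * (Real.exp 1 * n * (n / Real.exp 1) ^ n) := by gcongr
      _ = (n + 1) * ((n : ℝ) ^ (n + 1) * Real.exp 1) / Real.exp 1 ^ n := by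
          rw [div_pow]
          ring
      _ ≤ (n + 1) * ((n + 1) ^ (n + 1)) / Real.exp 1 ^ n := by gcongr
      _ = _ := by
          rw [div_pow, pow_succ (Real.exp 1)]
          field_simp

namespace IsDecorrelated

variable {Ω : Type*} [MeasurableSpace Ω] {P : Measure Ω} [IsProbabilityMeasure P]
  {ξ : ℕ → Ω → ℝ} {p : ℕ} {D μ ν τ γ A : ℝ}

-- A family has at most `n/(2p) + 1 ≤ n` blocks, so the accumulated covariance error costs at most a
-- factor `e`.
omit [IsProbabilityMeasure P] in
theorem blocks_error_le (h : IsDecorrelated P ξ p D μ ν τ γ A) {n k : ℕ} (hpn : 2 * p ≤ n)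
    (herr : n * (γ * (4 * n * A) ^ (2 * k)) ≤ 1) :
    ((n : ℝ) / (2 * p) + 1) * (2 ^ (2 * k) * (γ * (2 * n * A) ^ (2 * k))) ≤ 1 := by
  have hp : (1 : ℝ) ≤ p := by exact_mod_cast h.lag_pos
  have hpn' : 2 * (p : ℝ) ≤ n := by exact_mod_cast hpn
  have hγ := h.gamma_nonneg
  have hA := h.one_le
  refine le_trans ?_ herr
  have e : (2 : ℝ) ^ (2 * k) * (γ * (2 * n * A) ^ (2 * k)) = γ * (4 * n * A) ^ (2 * k) := by
    rw [show 4 * (n : ℝ) * A = 2 * (2 * n * A) by ring, mul_pow 2 (2 * n * A)]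
    ring
  rw [e]
  gcongr
  rw [div_add_one (by positivity), div_le_iff₀ (by positivity)]
  nlinarith

/-- Moments with a variance proxy of order `n p h`. -/
theorem integral_pow_le_crude (h : IsDecorrelated P ξ p D μ ν τ γ A) {n k : ℕ} (hk : 1 ≤ k)
    (hpn : 2 * p ≤ n) (herr : n * (γ * (4 * n * A) ^ (2 * k)) ≤ 1) {b C : ℝ} (hb : 0 < b)
    (hD : 1 ≤ D) (hvar : p * ν + (p : ℝ) ^ 2 * τ ≤ C * (p : ℝ) ^ 2 * b)
    (hnb : 4 * D ^ 2 * p ≤ n * b) :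
    ∫ ω, (∑ i ∈ Finset.range n, (ξ i ω - μ)) ^ (2 * k) ∂P
      ≤ Real.exp (2 * C + 1) * (16 * k ^ 2 * (n * p * b)) ^ k := by
  have hp : (1 : ℝ) ≤ p := by exact_mod_cast h.lag_pos
  have hpn' : 2 * (p : ℝ) ≤ n := by exact_mod_cast hpn
  have hn : (1 : ℝ) ≤ n := by linarith
  have hn1 : 1 ≤ n := by exact_mod_cast hn
  have hν := h.nu_nonneg
  have hτ := h.mixed_nonneg
  -- The choice `t = v^{-1/2}` makes the quadratic term of the exponent at most `2C`, while `hnb`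
  -- keeps `t` times the block bound `2Dp` below 1.
  set v := n * p * b with hv
  have hv1 : (2 * D * p) ^ 2 ≤ v := by
    rw [hv]
    calc (2 * D * p) ^ 2 = (4 * D ^ 2 * p) * p := by ring
      _ ≤ n * b * p := by gcongr
      _ = _ := by ring
  have hv0 : 0 < v := by positivity
  have hsv : 2 * D * p ≤ Real.sqrt v := Real.le_sqrt_of_sq_le hv1
  have hsv0 : 0 < Real.sqrt v := Real.sqrt_pos.2 hv0
  have hsv1 : 1 ≤ Real.sqrt v := le_trans (by nlinarith) hsv
  have hC : 0 ≤ C := by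
    have h1 : 0 ≤ p * ν + (p : ℝ) ^ 2 * τ := by positivity
    by_contra hc
    have : C * ((p : ℝ) ^ 2 * b) < 0 := mul_neg_of_neg_of_pos (not_le.1 hc) (by positivity)
    linarith
  have hx : (Real.sqrt v)⁻¹ * (2 * D * p) ≤ 1 := by
    rw [inv_mul_le_iff₀ hsv0, mul_one]
    exact hsv
  have hmain := h.integral_pow_le hn1 hk (t := (Real.sqrt v)⁻¹) (by positivity)
    (inv_le_one_of_one_le₀ hsv1)
  refine hmain.trans ?_
  have ht2 : (Real.sqrt v)⁻¹ ^ 2 = v⁻¹ := by rw [inv_pow, Real.sq_sqrt hv0.le]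
  have hexp : Real.exp ((Real.sqrt v)⁻¹ * (2 * D * p)) ≤ 4 := by
    refine (Real.exp_le_exp.2 hx).trans ?_
    linarith [Real.exp_one_lt_d9]
  have hnp : (n : ℝ) / (2 * p) + 1 ≤ n / p := by
    rw [div_add_one (by positivity), div_le_div_iff₀ (by positivity) (by positivity)]
    nlinarith
  have hE : ((n : ℝ) / (2 * p) + 1) * ((Real.sqrt v)⁻¹ ^ 2 * (p * ν + (p : ℝ) ^ 2 * τ)
          * Real.exp ((Real.sqrt v)⁻¹ * (2 * D * p)) / 2 + 2 ^ (2 * k) * (γ * (2 * n * A) ^ (2 * k)))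
      ≤ 2 * C + 1 := by
    rw [mul_add]
    refine add_le_add ?_ (h.blocks_error_le hpn herr)
    rw [ht2]
    calc ((n : ℝ) / (2 * p) + 1) * (v⁻¹ * (p * ν + (p : ℝ) ^ 2 * τ)
          * Real.exp ((Real.sqrt v)⁻¹ * (2 * D * p)) / 2)
        ≤ (n / p) * (v⁻¹ * (C * (p : ℝ) ^ 2 * b) * 4 / 2) := by gcongr
      _ = 2 * C := by
          rw [hv]
          field_simp
          ring
  have ht : (Real.sqrt v)⁻¹ ^ (2 * k) = (v ^ k)⁻¹ := by rw [pow_mul, ht2, inv_pow]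
  rw [ht, div_inv_eq_mul]
  have hf : ((2 * k).factorial : ℝ) ≤ (4 * k ^ 2) ^ k := by
    have h1 : (2 * k).factorial ≤ (2 * k) ^ (2 * k) := Nat.factorial_le_pow _
    have h2 : ((2 * k).factorial : ℝ) ≤ (2 * k : ℝ) ^ (2 * k) := by exact_mod_cast h1
    refine h2.trans (le_of_eq ?_)
    rw [pow_mul]
    congr 1
    ring
  calc _ ≤ 4 ^ k * ((4 * k ^ 2) ^ k * v ^ k * Real.exp (2 * C + 1)) := by gcongr
    _ = Real.exp (2 * C + 1) * (16 * k ^ 2 * v) ^ k := by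
        have : (16 * (k : ℝ) ^ 2 * v) ^ k = 4 ^ k * (4 * (k : ℝ) ^ 2) ^ k * v ^ k := by
          rw [← mul_pow, ← mul_pow]
          congr 1
          ring
        rw [this]
        clear_value v
        generalize (4 * (k : ℝ) ^ 2) ^ k = x
        ring

/-- Moments with a variance proxy that is sharp up to the splitting into two families of blocks. -/
theorem integral_pow_le_sharp (h : IsDecorrelated P ξ p D μ ν τ γ A) {n k : ℕ} (hk : 1 ≤ k)
    (hpn : 2 * p ≤ n) (herr : n * (γ * (4 * n * A) ^ (2 * k)) ≤ 1) {T : ℝ} (hD : 1 ≤ D)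
    (hvar : ((n : ℝ) / (2 * p) + 1) * (p * ν + (p : ℝ) ^ 2 * τ) ≤ T / 2)
    (hT : 64 * D ^ 2 * (p : ℝ) ^ 2 * (k : ℝ) ^ 3 ≤ T) :
    ∫ ω, (∑ i ∈ Finset.range n, (ξ i ω - μ)) ^ (2 * k) ∂P
      ≤ 2 * Real.exp 3 * k * (4 * k * T / Real.exp 1) ^ k := by
  have hp : (1 : ℝ) ≤ p := by exact_mod_cast h.lag_pos
  have hk1 : (1 : ℝ) ≤ k := by exact_mod_cast hk
  have hpn' : 2 * (p : ℝ) ≤ n := by exact_mod_cast hpn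
  have hn : (1 : ℝ) ≤ n := by linarith
  have hn1 : 1 ≤ n := by exact_mod_cast hn
  have hT0 : 0 < T := lt_of_lt_of_le (by positivity) hT
  -- This is the minimiser of `t^(-2k) exp(t² T / 4)`, `T / 2` being the variance bound of one
  -- parity.
  set t := Real.sqrt (4 * k / T) with ht
  have ht0 : 0 < t := Real.sqrt_pos.2 (by positivity)
  have ht2 : t ^ 2 = 4 * k / T := Real.sq_sqrt (by positivity)
  -- The cube of `k` in `hT` serves here: the factor `exp(2Dpt)` must be within `O(1/k)` of 1,
  -- because it multiplies an exponent of size `k`.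
  have hx : t * (2 * D * p) * (2 * k) ≤ 1 := by
    have h1 : t ≤ 1 / (4 * D * p * k) := by
      rw [ht]
      refine Real.sqrt_le_iff.2 ⟨by positivity, ?_⟩
      rw [div_pow, one_pow, div_le_div_iff₀ hT0 (by positivity)]
      nlinarith
    calc t * (2 * D * p) * (2 * k) ≤ 1 / (4 * D * p * k) * (2 * D * p) * (2 * k) := by gcongr
      _ = 1 := by field_simp; norm_num
  have ht1 : t ≤ 1 := by
    have : 1 ≤ (2 * D * p) * (2 * k) := by
      have := one_le_mul_of_one_le_of_one_le hD hp
      nlinarith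
    nlinarith
  have hx0 : 0 ≤ t * (2 * D * p) := by positivity
  have hx1 : t * (2 * D * p) ≤ 1 := by nlinarith
  have hexp : k * Real.exp (t * (2 * D * p)) ≤ k + 1 := by
    have h1 : Real.exp (t * (2 * D * p)) ≤ 1 + 2 * (t * (2 * D * p)) := by
      have := Real.abs_exp_sub_one_le (x := t * (2 * D * p)) (by rwa [abs_of_nonneg hx0])
      rw [abs_of_nonneg hx0] at this
      linarith [(_root_.abs_le.1 this).2]
    calc k * Real.exp (t * (2 * D * p)) ≤ k * (1 + 2 * (t * (2 * D * p))) := by gcongr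
      _ ≤ k + 1 := by linarith
  have hE : ((n : ℝ) / (2 * p) + 1) * (t ^ 2 * (p * ν + (p : ℝ) ^ 2 * τ)
          * Real.exp (t * (2 * D * p)) / 2 + 2 ^ (2 * k) * (γ * (2 * n * A) ^ (2 * k)))
      ≤ k + 2 := by
    rw [mul_add]
    have h1 : ((n : ℝ) / (2 * p) + 1) * (t ^ 2 * (p * ν + (p : ℝ) ^ 2 * τ)
          * Real.exp (t * (2 * D * p)) / 2) ≤ k + 1 := by
      calc ((n : ℝ) / (2 * p) + 1) * (t ^ 2 * (p * ν + (p : ℝ) ^ 2 * τ)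
          * Real.exp (t * (2 * D * p)) / 2)
          = (((n : ℝ) / (2 * p) + 1) * (p * ν + (p : ℝ) ^ 2 * τ))
            * (t ^ 2 * Real.exp (t * (2 * D * p)) / 2) := by ring
        _ ≤ (T / 2) * (t ^ 2 * Real.exp (t * (2 * D * p)) / 2) := by gcongr
        _ = k * Real.exp (t * (2 * D * p)) := by rw [ht2]; field_simp; ring
        _ ≤ _ := hexp
    linarith [h.blocks_error_le hpn herr]
  refine (h.integral_pow_le hn1 hk ht0 ht1).trans ?_
  have htk : t ^ (2 * k) = (4 * k / T) ^ k := by rw [pow_mul, ht2]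
  rw [htk]
  have hf := factorial_le_stirling (n := 2 * k) (by omega)
  push_cast at hf
  calc _ ≤ 4 ^ k * (Real.exp 1 * (2 * k) * (2 * k / Real.exp 1) ^ (2 * k) / (4 * k / T) ^ k
        * Real.exp (k + 2)) := by gcongr
    _ = 2 * Real.exp 3 * k * (4 * k * T / Real.exp 1) ^ k := by
        have e3 : Real.exp 3 = Real.exp 1 * Real.exp 2 := by rw [← Real.exp_add]; norm_num
        have ek : Real.exp (k + 2) = Real.exp 1 ^ k * Real.exp 2 := by
          rw [Real.exp_add, ← Real.exp_nat_mul, mul_one]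
        have e0 := (Real.exp_pos 1).ne'
        rw [e3, ek, pow_mul]
        have : 4 * (k : ℝ) * T / Real.exp 1
            = 4 * (2 * k / Real.exp 1) ^ 2 / (4 * k / T) * Real.exp 1 := by
          field_simp
          ring
        have h5 : (4 * (k : ℝ) * T / Real.exp 1) ^ k
            = 4 ^ k * ((2 * k / Real.exp 1) ^ 2) ^ k / (4 * k / T) ^ k * Real.exp 1 ^ k := by
          rw [this, ← mul_pow, ← div_pow, ← mul_pow]
        rw [h5]
        generalize ((2 * (k : ℝ) / Real.exp 1) ^ 2) ^ k = x
        generalize (4 * (k : ℝ) / T) ^ k = y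
        ring

end IsDecorrelated

/-! ### Truncated moments and Markov bounds -/

section Truncation

theorem rpow_le_of_lt {s t q : ℝ} {k : ℕ} (ht : 0 < t) (hts : t ≤ |s|) (hkq : q ≤ 2 * k) :
    |s| ^ q ≤ t ^ q * (s ^ (2 * k) / t ^ (2 * k)) := by
  have hs : 0 < |s| := ht.trans_le hts
  have h1 : 1 ≤ |s| / t := (one_le_div ht).2 hts
  have h2 : (|s| / t) ^ q ≤ (|s| / t) ^ ((2 * k : ℕ) : ℝ) :=
    Real.rpow_le_rpow_of_exponent_le h1 (by push_cast; exact hkq)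
  rw [Real.rpow_natCast, div_pow, Real.div_rpow hs.le ht.le, div_le_iff₀ (by positivity)] at h2
  have h3 : |s| ^ (2 * k) = s ^ (2 * k) := (even_two_mul k).pow_abs s
  rw [h3] at h2
  linarith

variable {Ω : Type*} [MeasurableSpace Ω] {P : Measure Ω} [IsProbabilityMeasure P]

/-- `|S|^q` on the event `t < |S|`. -/
noncomputable def tailPow (S : Ω → ℝ) (t q : ℝ) (ω : Ω) : ℝ := if t < |S ω| then |S ω| ^ q else 0

omit [MeasurableSpace Ω] in
theorem tailPow_nonneg (S : Ω → ℝ) (t q : ℝ) (ω : Ω) : 0 ≤ tailPow S t q ω := by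
  unfold tailPow
  split_ifs <;> positivity

theorem bddMeas_tailPow {S : Ω → ℝ} (hS : BddMeas S) (t : ℝ) {q : ℝ} (hq : 0 < q) :
    BddMeas (tailPow S t q) := by
  obtain ⟨hm, C, hC⟩ := hS
  refine ⟨Measurable.ite (measurableSet_lt measurable_const hm.abs)
    (hm.abs.pow_const q) measurable_const, C ^ q, fun ω => ?_⟩
  rw [abs_of_nonneg (tailPow_nonneg S t q ω)]
  have := (abs_nonneg _).trans (hC ω)
  unfold tailPow
  split_ifs
  · exact Real.rpow_le_rpow (abs_nonneg _) (hC ω) hq.le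
  · positivity

theorem integral_tailPow_le {S : Ω → ℝ} (hS : BddMeas S) {t q : ℝ} {k : ℕ} (ht : 0 < t)
    (hq : 0 < q) (hkq : q ≤ 2 * k) :
    ∫ ω, tailPow S t q ω ∂P ≤ t ^ q * ((∫ ω, S ω ^ (2 * k) ∂P) / t ^ (2 * k)) := by
  rw [← integral_div, ← integral_const_mul]
  refine integral_mono ((bddMeas_tailPow hS t hq).integrable P) ?_ fun ω => ?_
  · exact (((hS.pow (2 * k)).integrable P).div_const _).const_mul _
  · have h0 : 0 ≤ S ω ^ (2 * k) := (even_two_mul k).pow_nonneg _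
    simp only [tailPow]
    split_ifs with hlt
    · exact rpow_le_of_lt ht hlt.le hkq
    · positivity

/-- The scale `t` is unrelated to the truncation level `r`: values below `t` contribute at most
`t^q`, larger ones are handled as in Markov's inequality. -/
theorem integral_tailPow_le_of_any {S : Ω → ℝ} (hS : BddMeas S) {r t q : ℝ} {k : ℕ} (ht : 0 < t)
    (hq : 0 < q) (hkq : q ≤ 2 * k) :
    ∫ ω, tailPow S r q ω ∂P ≤ t ^ q * (1 + (∫ ω, S ω ^ (2 * k) ∂P) / t ^ (2 * k)) := by
  have e : t ^ q * (1 + (∫ ω, S ω ^ (2 * k) ∂P) / t ^ (2 * k))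
      = ∫ ω, (t ^ q + t ^ q * (S ω ^ (2 * k) / t ^ (2 * k))) ∂P := by
    rw [integral_add (integrable_const _) ((((hS.pow (2 * k)).integrable P).div_const _).const_mul _),
      integral_const_mul, integral_div]
    simp
    ring
  rw [e]
  refine integral_mono ((bddMeas_tailPow hS r hq).integrable P) ?_ fun ω => ?_
  · exact (integrable_const _).add ((((hS.pow (2 * k)).integrable P).div_const _).const_mul _)
  · have h0 : 0 ≤ S ω ^ (2 * k) := (even_two_mul k).pow_nonneg _
    have h1 : |S ω| ^ q ≤ t ^ q + t ^ q * (S ω ^ (2 * k) / t ^ (2 * k)) := by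
      rcases le_total |S ω| t with hle | hle
      · have := Real.rpow_le_rpow (abs_nonneg _) hle hq.le
        have : 0 ≤ t ^ q * (S ω ^ (2 * k) / t ^ (2 * k)) := by positivity
        linarith
      · have := rpow_le_of_lt ht hle hkq
        have : 0 ≤ t ^ q := by positivity
        linarith
    simp only [tailPow]
    split_ifs with hlt
    · exact h1
    · positivity

theorem measureReal_lt_abs_le {S : Ω → ℝ} (hS : BddMeas S) {t : ℝ} {k : ℕ} (ht : 0 < t) :
    P.real {ω | t < |S ω|} ≤ (∫ ω, S ω ^ (2 * k) ∂P) / t ^ (2 * k) := by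
  have hms : MeasurableSet {ω | t < |S ω|} := measurableSet_lt measurable_const hS.1.abs
  rw [← integral_indicator_one hms, ← integral_div]
  refine integral_mono ((integrable_const _).indicator hms) (((hS.pow (2 * k)).integrable P).div_const _)
    fun ω => ?_
  have h0 : 0 ≤ S ω ^ (2 * k) := (even_two_mul k).pow_nonneg _
  by_cases hω : t < |S ω|
  · rw [Set.indicator_of_mem (by exact hω), Pi.one_apply, one_le_div (by positivity),
      ← (even_two_mul k).pow_abs (S ω)]
    exact pow_le_pow_left₀ ht.le hω.le _
  · rw [Set.indicator_of_notMem (by exact hω)]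
    positivity

end Truncation

/-! ### Growth comparisons and the choice of block length -/

open Filter in
theorem tendsto_log_nat : Tendsto (fun n : ℕ => Real.log n) atTop atTop :=
  Real.tendsto_log_atTop.comp tendsto_natCast_atTop_atTop

/-- On the grid `n h ≥ exp(√(log n))`, so powers of `log n` are negligible against `n h`. -/
theorem eventually_log_pow_le_exp_sqrt (C : ℝ) (j : ℕ) :
    ∀ᶠ n : ℕ in Filter.atTop, C * Real.log n ^ j ≤ Real.exp (Real.sqrt (Real.log n)) := by
  have h1 : (fun x : ℝ => C * x ^ (2 * j)) =o[Filter.atTop] Real.exp :=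
    (Real.isLittleO_pow_exp_atTop (n := 2 * j)).const_mul_left C
  have h2 := h1.bound (c := 1) one_pos
  have h3 : Filter.Tendsto (fun n : ℕ => Real.sqrt (Real.log n)) Filter.atTop Filter.atTop :=
    Real.tendsto_sqrt_atTop.comp tendsto_log_nat
  filter_upwards [h3.eventually h2] with n hn
  rw [one_mul, Real.norm_eq_abs, Real.norm_eq_abs, abs_of_pos (Real.exp_pos _), pow_mul,
    Real.sq_sqrt (Real.log_natCast_nonneg n)] at hn
  exact (le_abs_self _).trans hn

theorem eventually_exp_sqrt_le_rpow {ε : ℝ} (hε : 0 < ε) :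
    ∀ᶠ n : ℕ in Filter.atTop, Real.exp (Real.sqrt (Real.log n)) ≤ (n : ℝ) ^ ε := by
  filter_upwards [tendsto_log_nat.eventually_ge_atTop ((1 / ε) ^ 2), Filter.eventually_ge_atTop 1]
    with n hn hn1
  have hn0 : (0 : ℝ) < n := by exact_mod_cast hn1
  rw [Real.rpow_def_of_pos hn0]
  refine Real.exp_le_exp.2 ?_
  have h0 := Real.log_natCast_nonneg n
  have h1 : 1 / ε ≤ Real.sqrt (Real.log n) := Real.le_sqrt_of_sq_le hn
  rw [div_le_iff₀ hε] at h1
  have h2 := Real.sq_sqrt h0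
  nlinarith [Real.sqrt_nonneg (Real.log n)]

/-- The block length. -/
noncomputable def lag (Q n : ℕ) : ℕ := ⌈Real.log n ^ Q⌉₊

theorem lag_le {Q n : ℕ} (h : 1 ≤ Real.log n) : (lag Q n : ℝ) ≤ 2 * Real.log n ^ Q := by
  have := (Nat.ceil_lt_add_one (a := Real.log n ^ Q) (by positivity)).le
  have h2 := one_le_pow₀ (n := Q) h
  unfold lag
  linarith

theorem one_le_lag {Q n : ℕ} (h : 1 ≤ Real.log n) : 1 ≤ lag Q n :=
  Nat.one_le_ceil_iff.2 (by positivity)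

theorem eventually_one_le_log : ∀ᶠ n : ℕ in Filter.atTop, 1 ≤ Real.log n :=
  tendsto_log_nat.eventually_ge_atTop 1

theorem eventually_lag_pow_le (Q : ℕ) {C : ℝ} (hC : 0 ≤ C) (i j : ℕ) :
    ∀ᶠ n : ℕ in Filter.atTop,
      C * (lag Q n : ℝ) ^ i * Real.log n ^ j ≤ Real.exp (Real.sqrt (Real.log n)) := by
  filter_upwards [eventually_log_pow_le_exp_sqrt (C * 2 ^ i) (Q * i + j), eventually_one_le_log]
    with n hn h1
  refine le_trans ?_ hn
  calc C * (lag Q n : ℝ) ^ i * Real.log n ^ j ≤ C * (2 * Real.log n ^ Q) ^ i * Real.log n ^ j := by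
        gcongr
        exact lag_le h1
    _ = _ := by rw [mul_pow, ← pow_mul, pow_add]; ring

theorem eventually_lag_pow_le_rpow (Q : ℕ) {C : ℝ} (hC : 0 ≤ C) (i j : ℕ) {ε : ℝ} (hε : 0 < ε) :
    ∀ᶠ n : ℕ in Filter.atTop, C * (lag Q n : ℝ) ^ i * Real.log n ^ j ≤ (n : ℝ) ^ ε := by
  filter_upwards [eventually_lag_pow_le Q hC i j, eventually_exp_sqrt_le_rpow hε] with n h1 h2
  exact h1.trans h2

/-- For `k = O(log n)` the power is `exp(O((log n)^2))`, while `lag Q n ^ b ≥ (log n)^3` because `Q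
b ≥ 3`. -/
theorem eventually_decorrelation {a b c C D : ℝ} (ha : 0 < a) (hb : 0 < b) (hc : 0 < c) (hC : 0 ≤ C)
    (hD : 1 ≤ D) {Q : ℕ} (hQ : 3 ≤ Q * b) :
    ∀ᶠ n : ℕ in Filter.atTop, ∀ k : ℕ, (k : ℝ) ≤ C * Real.log n → ∀ A : ℝ, 0 ≤ A → A ≤ D * n →
      n * ((4 * c * Real.exp (-a * (lag Q n : ℝ) ^ b)) * (4 * n * A) ^ (2 * k)) ≤ 1 := by
  set Z := 1 + |Real.log (4 * c)| + 2 * C * (Real.log (4 * D) + 2) with hZ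
  filter_upwards [eventually_one_le_log, tendsto_log_nat.eventually_ge_atTop (Z / a),
    Filter.eventually_ge_atTop 1] with n h1 h2 hn k hk A hA0 hA
  set l := Real.log n with hl
  have hn0 : (1 : ℝ) ≤ n := by exact_mod_cast hn
  have hnl : (n : ℝ) = Real.exp l := (Real.exp_log (by linarith)).symm
  have h4D : 0 ≤ Real.log (4 * D) := Real.log_nonneg (by linarith)
  have e1 : (4 * n * A) ^ (2 * k) ≤ Real.exp (2 * C * l * (Real.log (4 * D) + 2 * l)) := by
    have h3 : 4 * n * A ≤ Real.exp (Real.log (4 * D) + 2 * l) := by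
      rw [Real.exp_add, Real.exp_log (by positivity), two_mul, Real.exp_add, ← hnl]
      calc 4 * n * A ≤ 4 * n * (D * n) := by gcongr
        _ = _ := by ring
    calc (4 * n * A) ^ (2 * k) ≤ Real.exp (Real.log (4 * D) + 2 * l) ^ (2 * k) := by gcongr
      _ = Real.exp (2 * k * (Real.log (4 * D) + 2 * l)) := by
          rw [← Real.exp_nat_mul]
          push_cast
          rfl
      _ ≤ _ := by
          refine Real.exp_le_exp.2 ?_
          have : 0 ≤ Real.log (4 * D) + 2 * l := by linarith
          nlinarith
  have e2 : l ^ 3 ≤ (lag Q n : ℝ) ^ b := by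
    calc l ^ 3 = l ^ ((3 : ℕ) : ℝ) := (Real.rpow_natCast _ _).symm
      _ ≤ l ^ (Q * b) := Real.rpow_le_rpow_of_exponent_le h1 (by exact_mod_cast hQ)
      _ = (l ^ Q) ^ b := by rw [Real.rpow_mul (by linarith), Real.rpow_natCast]
      _ ≤ _ := Real.rpow_le_rpow (by positivity) (Nat.le_ceil _) hb.le
  have e3 : 4 * c = Real.exp (Real.log (4 * c)) := (Real.exp_log (by positivity)).symm
  calc n * ((4 * c * Real.exp (-a * (lag Q n : ℝ) ^ b)) * (4 * n * A) ^ (2 * k))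
      ≤ Real.exp l * ((Real.exp (Real.log (4 * c)) * Real.exp (-a * l ^ 3))
          * Real.exp (2 * C * l * (Real.log (4 * D) + 2 * l))) := by
        rw [← hnl, ← e3]
        have : Real.exp (-a * (lag Q n : ℝ) ^ b) ≤ Real.exp (-a * l ^ 3) :=
          Real.exp_le_exp.2 (by nlinarith)
        gcongr
    _ = Real.exp (l + (Real.log (4 * c) + -a * l ^ 3 + 2 * C * l * (Real.log (4 * D) + 2 * l))) := by
        rw [← Real.exp_add, ← Real.exp_add, ← Real.exp_add]
    _ ≤ Real.exp 0 := by
        refine Real.exp_le_exp.2 ?_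
        rw [div_le_iff₀ ha] at h2
        have hll : l ≤ l ^ 2 := by nlinarith
        have h5 : Z * l ^ 2 ≤ a * l ^ 3 := by nlinarith [sq_nonneg l]
        have h6 : Real.log (4 * c) ≤ |Real.log (4 * c)| * l ^ 2 :=
          (le_abs_self _).trans (le_mul_of_one_le_right (abs_nonneg _) (by nlinarith))
        have h7 : 2 * C * l * (Real.log (4 * D) + 2 * l) ≤ 2 * C * (Real.log (4 * D) + 2) * l ^ 2 := by
          have : l * Real.log (4 * D) ≤ l ^ 2 * Real.log (4 * D) := by gcongr
          nlinarith
        rw [hZ] at h5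
        nlinarith
    _ = 1 := Real.exp_zero

theorem delta_sq {n : ℕ} (h : 1 ≤ Real.log n) : delta n ^ 2 = (Real.log n)⁻¹ := by
  have h0 : 0 ≤ Real.log n := by linarith
  unfold delta
  rw [← Real.rpow_natCast, ← Real.rpow_mul h0, ← Real.rpow_neg_one]
  norm_num

theorem delta_pos {n : ℕ} (h : 1 ≤ Real.log n) : 0 < delta n := Real.rpow_pos_of_pos (by linarith) _

theorem delta_le_one {n : ℕ} (h : 1 ≤ Real.log n) : delta n ≤ 1 :=
  Real.rpow_le_one_of_one_le_of_nonpos h (by norm_num)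

theorem inv_log_le_delta {n : ℕ} (h : 1 ≤ Real.log n) : (Real.log n)⁻¹ ≤ delta n := by
  rw [← delta_sq h, sq]
  exact mul_le_of_le_one_left (delta_pos h).le (delta_le_one h)

/-! ### Moments and deviations of the centred kernel sums -/

variable {a b c M B D q : ℝ} {G : ℝ → ℝ}

section Facts

variable {Ω : Type*} [MeasurableSpace Ω] {P : Measure Ω} [IsProbabilityMeasure P] {X : ℤ → Ω → ℝ}
  {f : ℝ → ℝ} {n : ℕ} {x₀ h : ℝ}

theorem smoothed_sq_nonneg (hf : ∀ x, 0 ≤ f x) : 0 ≤ smoothed (fun x => G x ^ 2) x₀ h f :=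
  integral_nonneg fun y => mul_nonneg (sq_nonneg _) (hf y)

omit [IsProbabilityMeasure P] in
theorem smoothed_sq_le {V : Set ℝ} (hG : IsBump D G) (hX : IsWeaklyDependent V a b c M B P X f)
    (hh : 0 < h) (hV : Set.Icc (x₀ - h) (x₀ + h) ⊆ V) :
    smoothed (fun x => G x ^ 2) x₀ h f ≤ 4 * D ^ 2 * B * h := by
  have := (le_abs_self _).trans (abs_smoothed_le hG.sq hh hV hX.density.nonneg hX.le_on_window)
  linarith

omit [IsProbabilityMeasure P] in
theorem bddMeas_centredSum {V : Set ℝ} (hG : IsBump D G)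
    (hX : IsWeaklyDependent V a b c M B P X f) : BddMeas (centredSum G x₀ h f X n) := by
  have hGm := hG.continuous.measurable
  have hm : Measurable fun y => G ((x₀ - y) / h) := by fun_prop
  exact BddMeas.sum _ fun i _ => BddMeas.sub
    ⟨hm.comp (hX.density.measurable _), D, fun ω => hG.abs_le _⟩ (BddMeas.const _)

end Facts

theorem two_mul_sq_div_le {h : ℝ} {n : ℕ} (hh : 0 < h) (hnh : 1 ≤ n * h) :
    2 * D ^ 2 / h ≤ 2 * D ^ 2 * n := by
  rw [div_le_iff₀ hh, mul_assoc]
  exact le_mul_of_one_le_right (by positivity) hnh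

/-- Moments of order up to a multiple of `log n` of the centred sums. -/
theorem eventually_moments_le (ha : 0 < a) (hb : 0 < b) (hc : 0 < c) (hM : 0 < M)
    (hG : IsBump D G) {Q : ℕ} (hQ : 3 ≤ Q * b) {C : ℝ} (hC : 0 ≤ C) :
    ∀ᶠ n : ℕ in Filter.atTop, ∀ (Ω : Type u) [MeasurableSpace Ω] (P : Measure Ω)
      [IsProbabilityMeasure P] (X : ℤ → Ω → ℝ) (f : ℝ → ℝ) (x₀ h : ℝ),
      IsWeaklyDependent (nbhd q n x₀) a b c M B P X f → h ∈ bandwidths q n →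
      ∀ k : ℕ, 1 ≤ k → (k : ℝ) ≤ C * Real.log n →
      ∫ ω, centredSum G x₀ h f X n ω ^ (2 * k) ∂P
        ≤ Real.exp (2 * (4 * D ^ 2 * B + 4 * M * D ^ 2) + 1)
          * (16 * k ^ 2 * (n * lag Q n * h)) ^ k := by
  have hD := hG.one_le
  filter_upwards [eventually_one_le_log, Filter.eventually_ge_atTop 1,
    eventually_decorrelation (a := a) (b := b) (c := c) (C := C) (D := 2 * D ^ 2) ha hb hc hC
      (by nlinarith) hQ,
    eventually_lag_pow_le Q (C := 4 * D ^ 2) (by positivity) 1 0,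
    eventually_lag_pow_le_rpow Q (C := 2) (by positivity) 1 0 one_pos]
    with n hl hn herr h4 h2 Ω _ P _ X f x₀ h hX hh k hk hkC
  have hh0 := pos_of_mem_bandwidths hh
  have hh1 := le_one_of_mem_bandwidths hh
  have hV := Icc_subset_nbhd x₀ hh
  have hE := exp_le_of_mem_bandwidths hn hh
  have hnh := one_le_of_mem_bandwidths hn hh
  have hp := one_le_lag (Q := Q) hl
  have hp' : (1 : ℝ) ≤ lag Q n := by exact_mod_cast hp
  have hdec := hX.isDecorrelated hG hh0 hh1 hV hp
  simp only [pow_one, pow_zero, mul_one, Real.rpow_one] at h4 h2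
  have hpn : 2 * lag Q n ≤ n := by exact_mod_cast h2
  refine hdec.integral_pow_le_crude hk hpn
    (herr k hkC _ (by positivity) (two_mul_sq_div_le hh0 hnh)) hh0 hD ?_ (h4.trans hE)
  -- Bounding `p` by `p²` and `h²` by `h` loses a power of `log n`, but requires no relation between
  -- the block length and `h`.
  have h5 := smoothed_sq_le hG hX hh0 hV
  calc (lag Q n : ℝ) * smoothed (fun x => G x ^ 2) x₀ h f + (lag Q n : ℝ) ^ 2 * (M * (D * (2 * h)) ^ 2)
      ≤ (lag Q n : ℝ) ^ 2 * (4 * D ^ 2 * B * h) + (lag Q n : ℝ) ^ 2 * (4 * M * D ^ 2 * h) := by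
        refine add_le_add (mul_le_mul (by nlinarith) h5
          (smoothed_sq_nonneg hX.density.nonneg) (by positivity)) ?_
        refine mul_le_mul_of_nonneg_left ?_ (by positivity)
        have : h ^ 2 ≤ h := by nlinarith
        calc M * (D * (2 * h)) ^ 2 = 4 * M * D ^ 2 * h ^ 2 := by ring
          _ ≤ _ := by gcongr
    _ = _ := by ring

/-- Deviations of the centred sums above `n h δ_n / 2`. -/
theorem eventually_measure_deviation_le (ha : 0 < a) (hb : 0 < b) (hc : 0 < c) (hM : 0 < M)
    (hB : 0 < B) (hG : IsBump D G) {C : ℝ} (hC : 0 ≤ C) :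
    ∀ᶠ n : ℕ in Filter.atTop, ∀ (Ω : Type u) [MeasurableSpace Ω] (P : Measure Ω)
      [IsProbabilityMeasure P] (X : ℤ → Ω → ℝ) (f : ℝ → ℝ) (x₀ h : ℝ),
      IsWeaklyDependent (nbhd q n x₀) a b c M B P X f → h ∈ bandwidths q n →
      P.real {ω | n * h * delta n / 2 < |centredSum G x₀ h f X n ω|} ≤ (n : ℝ) ^ (-C) := by
  have hD := hG.one_le
  obtain ⟨Q, hQ⟩ : ∃ Q : ℕ, 3 / b ≤ Q := exists_nat_ge _
  rw [div_le_iff₀ hb] at hQ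
  set C0 := 2 * (4 * D ^ 2 * B + 4 * M * D ^ 2) + 1 with hC0
  have hC01 : 1 ≤ C0 := by
    have : 0 ≤ 4 * D ^ 2 * B + 4 * M * D ^ 2 := by positivity
    linarith
  filter_upwards [eventually_one_le_log, Filter.eventually_ge_atTop 1,
    eventually_moments_le.{u} (q := q) ha hb hc hM hG hQ (C := 2 * (C + C0)) (by positivity),
    eventually_lag_pow_le Q (C := 64 * Real.exp 1 * (2 * (C + C0)) ^ 2) (by positivity) 1 3]
    with n hl hn hmom hlag Ω _ P _ X f x₀ h hX hh
  have hh0 := pos_of_mem_bandwidths hh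
  have hE := exp_le_of_mem_bandwidths hn hh
  have hnh := one_le_of_mem_bandwidths hn hh
  have hn0 : (0 : ℝ) < n := by exact_mod_cast hn
  have hδ := delta_pos hl
  -- Each of the `k` factors in Markov's inequality gains `e⁻¹`; the part `C log n` of `k` yields
  -- the probability, and the part `C0 log n` pays for the prefactor `exp C0`.
  set k := ⌈(C + C0) * Real.log n⌉₊ with hk
  have hx1 : 1 ≤ (C + C0) * Real.log n := one_le_mul_of_one_le_of_one_le (by linarith) hl
  have hk1 : 1 ≤ k := Nat.one_le_ceil_iff.2 (by linarith)
  have hkl : (C + C0) * Real.log n ≤ k := Nat.le_ceil _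
  have hku : (k : ℝ) ≤ 2 * (C + C0) * Real.log n := by
    have := (Nat.ceil_lt_add_one (a := (C + C0) * Real.log n) (by linarith)).le
    linarith
  refine (measureReal_lt_abs_le (bddMeas_centredSum hG hX) (k := k) (by positivity)).trans ?_
  have ht : (n * h * delta n / 2) ^ (2 * k) = ((n * h) ^ 2 / (4 * Real.log n)) ^ k := by
    rw [pow_mul, div_pow, mul_pow, delta_sq hl]
    congr 1
    field_simp
    norm_num
  rw [ht, div_le_iff₀ (by positivity)]
  refine (hmom Ω P X f x₀ h hX hh k hk1 hku).trans ?_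
  have hbase : 16 * (k : ℝ) ^ 2 * (n * lag Q n * h)
      ≤ Real.exp (-1) * ((n * h) ^ 2 / (4 * Real.log n)) := by
    have h1 : 64 * Real.exp 1 * (k : ℝ) ^ 2 * lag Q n * Real.log n ≤ n * h := by
      refine le_trans ?_ (hlag.trans hE)
      calc 64 * Real.exp 1 * (k : ℝ) ^ 2 * lag Q n * Real.log n
          ≤ 64 * Real.exp 1 * (2 * (C + C0) * Real.log n) ^ 2 * lag Q n * Real.log n := by gcongr
        _ = _ := by ring
    rw [Real.exp_neg, ← div_eq_inv_mul, div_div, le_div_iff₀ (by positivity)]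
    calc 16 * (k : ℝ) ^ 2 * (n * lag Q n * h) * (4 * Real.log n * Real.exp 1)
        = (64 * Real.exp 1 * (k : ℝ) ^ 2 * lag Q n * Real.log n) * (n * h) := by ring
      _ ≤ (n * h) * (n * h) := by gcongr
      _ = _ := by ring
  calc Real.exp C0 * (16 * k ^ 2 * (n * lag Q n * h)) ^ k
      ≤ Real.exp C0 * (Real.exp (-1) * ((n * h) ^ 2 / (4 * Real.log n))) ^ k := by gcongr
    _ = Real.exp (C0 - k) * ((n * h) ^ 2 / (4 * Real.log n)) ^ k := by
        rw [mul_pow, ← Real.exp_nat_mul, ← mul_assoc, ← Real.exp_add]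
        congr 3
        ring
    _ ≤ (n : ℝ) ^ (-C) * ((n * h) ^ 2 / (4 * Real.log n)) ^ k := by
        gcongr
        rw [Real.rpow_def_of_pos hn0]
        refine Real.exp_le_exp.2 ?_
        nlinarith

/-- The variance proxy of the centred sum, including half of the correction `n h δ_n`. -/
noncomputable def varProxy (G : ℝ → ℝ) (x₀ h : ℝ) (f : ℝ → ℝ) (n : ℕ) : ℝ :=
  n * smoothed (fun x => G x ^ 2) x₀ h f + n * h * delta n / 2

/-- The crude moments put the centred sum at scale `√(n h)` up to powers of `log n`, whatever the
truncation level. As `h ≥ n^{-ε/2}`, the normalised sum is then below `n^{-(1-ε)/2}` in `L^q`. -/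
theorem eventually_tail_large_bandwidth (ha : 0 < a) (hb : 0 < b) (hc : 0 < c) (hM : 0 < M)
    (hq : 0 < q) (hG : IsBump D G) {ε : ℝ} (hε : 0 < ε) :
    ∀ᶠ n : ℕ in Filter.atTop, ∀ (Ω : Type u) [MeasurableSpace Ω] (P : Measure Ω)
      [IsProbabilityMeasure P] (X : ℤ → Ω → ℝ) (f : ℝ → ℝ) (x₀ h : ℝ),
      IsWeaklyDependent (nbhd q n x₀) a b c M B P X f → h ∈ bandwidths q n →
      (n : ℝ) ^ (-(ε / 2)) ≤ h → ∀ t,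
      ∫ ω, tailPow (centredSum G x₀ h f X n) t q ω ∂P
        ≤ ((n * h) ^ 2 * (n : ℝ) ^ (-(1 - ε))) ^ (q / 2) := by
  have hD := hG.one_le
  obtain ⟨Q, hQ⟩ : ∃ Q : ℕ, 3 / b ≤ Q := exists_nat_ge _
  rw [div_le_iff₀ hb] at hQ
  set C0 := Real.exp (2 * (4 * D ^ 2 * B + 4 * M * D ^ 2) + 1) with hC0
  have hC01 : 0 < C0 := Real.exp_pos _
  filter_upwards [eventually_one_le_log, Filter.eventually_ge_atTop 1,
    eventually_moments_le.{u} (q := q) ha hb hc hM hG hQ (C := 2 * (q + 1)) (by positivity),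
    eventually_lag_pow_le_rpow Q (C := (1 + C0) ^ (2 / q) * 16 * (2 * (q + 1)) ^ 2) (by positivity) 1 2
      (half_pos hε)]
    with n hl hn hmom hlag Ω _ P _ X f x₀ h hX hh hhε t
  have hh0 := pos_of_mem_bandwidths hh
  have hn0 : (0 : ℝ) < n := by exact_mod_cast hn
  have hp : 1 ≤ lag Q n := one_le_lag hl
  set k := ⌈(q + 1) * Real.log n⌉₊ with hk
  have hx1 : q + 1 ≤ (q + 1) * Real.log n := le_mul_of_one_le_right (by positivity) hl
  have hk1 : 1 ≤ k := Nat.one_le_ceil_iff.2 (by linarith)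
  have hkl : (q + 1) * Real.log n ≤ k := Nat.le_ceil _
  have hku : (k : ℝ) ≤ 2 * (q + 1) * Real.log n := by
    have := (Nat.ceil_lt_add_one (a := (q + 1) * Real.log n) (by linarith)).le
    linarith
  set v := 16 * (k : ℝ) ^ 2 * (n * lag Q n * h) with hv
  have hv0 : 0 < v := by positivity
  have hb' := integral_tailPow_le_of_any (P := P) (bddMeas_centredSum (n := n) (x₀ := x₀) (h := h) hG hX)
    (r := t) (t := Real.sqrt v) (q := q) (k := k) (Real.sqrt_pos.2 hv0) hq (by linarith)
  refine hb'.trans ?_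
  have hm := hmom Ω P X f x₀ h hX hh k hk1 hku
  have hs : Real.sqrt v ^ (2 * k) = v ^ k := by rw [pow_mul, Real.sq_sqrt hv0.le]
  have hsq : Real.sqrt v ^ q = v ^ (q / 2) := by
    rw [Real.sqrt_eq_rpow, ← Real.rpow_mul hv0.le]
    congr 1
    ring
  rw [hs, hsq]
  have h1 : 1 + (∫ ω, centredSum G x₀ h f X n ω ^ (2 * k) ∂P) / v ^ k ≤ 1 + C0 := by
    gcongr
    rw [div_le_iff₀ (by positivity)]
    exact hm
  calc v ^ (q / 2) * (1 + (∫ ω, centredSum G x₀ h f X n ω ^ (2 * k) ∂P) / v ^ k)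
      ≤ v ^ (q / 2) * (1 + C0) := by gcongr
    _ = (v * (1 + C0) ^ (2 / q)) ^ (q / 2) := by
        rw [Real.mul_rpow hv0.le (by positivity), ← Real.rpow_mul (by positivity)]
        have : 2 / q * (q / 2) = 1 := by field_simp
        rw [this, Real.rpow_one]
    _ ≤ _ := by
        refine Real.rpow_le_rpow (by positivity) ?_ (by positivity)
        have e1 : (n : ℝ) ^ (-(1 - ε)) = (n : ℝ) ^ (-1 : ℝ) * (n : ℝ) ^ ε := by
          rw [← Real.rpow_add hn0]
          congr 1
          ring
        have e2 : (n : ℝ) ^ ε * (n : ℝ) ^ (-(ε / 2)) = (n : ℝ) ^ (ε / 2) := by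
          rw [← Real.rpow_add hn0]
          congr 1
          ring
        rw [e1, Real.rpow_neg_one]
        have h2 : (1 + C0) ^ (2 / q) * 16 * (k : ℝ) ^ 2 * lag Q n ≤ (n : ℝ) ^ ε * h := by
          calc (1 + C0) ^ (2 / q) * 16 * (k : ℝ) ^ 2 * lag Q n
              ≤ (1 + C0) ^ (2 / q) * 16 * (2 * (q + 1) * Real.log n) ^ 2 * lag Q n := by gcongr
            _ = (1 + C0) ^ (2 / q) * 16 * (2 * (q + 1)) ^ 2 * (lag Q n : ℝ) ^ 1 * Real.log n ^ 2 := by ring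
            _ ≤ (n : ℝ) ^ (ε / 2) := hlag
            _ ≤ (n : ℝ) ^ ε * h := by
                rw [← e2]
                gcongr
        calc v * (1 + C0) ^ (2 / q)
            = ((1 + C0) ^ (2 / q) * 16 * (k : ℝ) ^ 2 * lag Q n) * (n * h) := by rw [hv]; ring
          _ ≤ ((n : ℝ) ^ ε * h) * (n * h) := by gcongr
          _ = _ := by field_simp

/-- `k ≈ qL/2` is the optimal order in Markov's inequality. Rounding up is harmless: `2k ≤ qL
exp(2/(qL))`, and `k ≤ qL` turns the excess into the constant `e²`. -/
theorem moment_ratio_le {q L T I : ℝ} {k : ℕ} (hL : 2 ≤ q * L) (hk : q * L / 2 ≤ k)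
    (hk' : k ≤ q * L / 2 + 1) (hT : 0 < T)
    (hI : I ≤ 2 * Real.exp 3 * k * (4 * k * T / Real.exp 1) ^ k) :
    I / (2 * q * L * T) ^ k ≤ 2 * Real.exp 5 * k * Real.exp (-(q * L / 2)) := by
  have hqL : 0 < q * L := by linarith
  have hw : 0 < 2 * q * L * T := by
    rw [mul_assoc 2]
    positivity
  rw [div_le_iff₀ (by positivity)]
  refine hI.trans ?_
  have h1 : 4 * k * T / Real.exp 1 ≤ Real.exp (2 / (q * L) - 1) * (2 * q * L * T) := by
    have h2 : 2 * (k : ℝ) ≤ q * L * Real.exp (2 / (q * L)) := by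
      have h3 := Real.add_one_le_exp (2 / (q * L))
      calc 2 * (k : ℝ) ≤ q * L * (2 / (q * L) + 1) := by
            rw [mul_add, mul_div_cancel₀ _ hqL.ne']
            linarith
        _ ≤ _ := by gcongr
    rw [Real.exp_sub, div_mul_eq_mul_div]
    refine div_le_div_of_nonneg_right ?_ (Real.exp_pos _).le
    nlinarith
  have h4 : (Real.exp (2 / (q * L) - 1)) ^ k ≤ Real.exp 2 * Real.exp (-(q * L / 2)) := by
    rw [← Real.exp_nat_mul, ← Real.exp_add]
    refine Real.exp_le_exp.2 ?_
    have h5 : (k : ℝ) * (2 / (q * L)) ≤ 2 := by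
      rw [mul_div_assoc', div_le_iff₀ hqL]
      linarith
    rw [mul_sub]
    linarith
  have e5 : Real.exp 5 = Real.exp 3 * Real.exp 2 := by rw [← Real.exp_add]; norm_num
  calc 2 * Real.exp 3 * k * (4 * k * T / Real.exp 1) ^ k
      ≤ 2 * Real.exp 3 * k * (Real.exp (2 / (q * L) - 1) * (2 * q * L * T)) ^ k := by gcongr
    _ = 2 * Real.exp 3 * k * (Real.exp (2 / (q * L) - 1) ^ k * (2 * q * L * T) ^ k) := by
        rw [mul_pow]
    _ ≤ 2 * Real.exp 3 * k * ((Real.exp 2 * Real.exp (-(q * L / 2))) * (2 * q * L * T) ^ k) := by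
        gcongr
    _ = _ := by rw [e5]; ring

-- Here `|log h|` is comparable to `log n` and correlations inside blocks are negligible, so the
-- sharp moments apply. They supply the factor `exp(-q|log h|/2) = h^{q/2}` that brings the
-- normalised tail down to `n^{-q/2}`, up to small powers of `n`.
set_option maxHeartbeats 1600000 in
theorem eventually_tail_small_bandwidth (ha : 0 < a) (hb : 0 < b) (hc : 0 < c) (hM : 0 < M)
    (hB : 0 < B) (hq : 0 < q) (hG : IsBump D G) {ε : ℝ} (hε : 0 < ε) :
    ∀ᶠ n : ℕ in Filter.atTop, ∀ (Ω : Type u) [MeasurableSpace Ω] (P : Measure Ω)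
      [IsProbabilityMeasure P] (X : ℤ → Ω → ℝ) (f : ℝ → ℝ) (x₀ h : ℝ),
      IsWeaklyDependent (nbhd q n x₀) a b c M B P X f → h ∈ bandwidths q n →
      h ≤ (n : ℝ) ^ (-(ε / 2)) →
      ∫ ω, tailPow (centredSum G x₀ h f X n)
          (Real.sqrt (2 * q * |Real.log h| * varProxy G x₀ h f n)) q ω ∂P
        ≤ ((n * h) ^ 2 * (n : ℝ) ^ (-(1 - ε))) ^ (q / 2) := by
  have hD := hG.one_le
  obtain ⟨Q, hQ⟩ : ∃ Q : ℕ, 3 / b ≤ Q := exists_nat_ge _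
  rw [div_le_iff₀ hb] at hQ
  set C0 := 4 * D ^ 2 * B + 1 with hC0
  have hC01 : 0 < C0 := by positivity
  filter_upwards [eventually_one_le_log, Filter.eventually_ge_atTop 1,
    eventually_decorrelation (a := a) (b := b) (c := c) (C := q) (D := 2 * D ^ 2) ha hb hc hq.le
      (by nlinarith) hQ,
    eventually_lag_pow_le_rpow Q (C := 2) (by positivity) 1 0 one_pos,
    eventually_lag_pow_le_rpow Q (C := 32 * D ^ 2 * B) (by positivity) 1 1 one_pos,
    eventually_lag_pow_le_rpow Q (C := 32 * M * D ^ 2) (by positivity) 1 1 (half_pos hε),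
    eventually_lag_pow_le Q (C := 128 * D ^ 2 * q ^ 3) (by positivity) 2 4,
    eventually_lag_pow_le_rpow Q (C := 2 * Real.exp 5 * q) (by positivity) 0 1
      (ε := ε / 2 * (q / 2)) (by positivity),
    eventually_lag_pow_le_rpow Q (C := 2 * q * C0) (by positivity) 0 1 (half_pos hε),
    tendsto_log_nat.eventually_ge_atTop (2 / (q * (ε / 2))),
    tendsto_log_nat.eventually_ge_atTop (1 / (ε / 2))]
    with n hl hn herr h2 hν1 hτ1 hk3 hpoly1 hpoly2 hlog hlog1 Ω _ P _ X f x₀ h hX hh hhε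
  have hh0 := pos_of_mem_bandwidths hh
  have hh1 := le_one_of_mem_bandwidths hh
  have hV := Icc_subset_nbhd x₀ hh
  have hE := exp_le_of_mem_bandwidths hn hh
  have hnh := one_le_of_mem_bandwidths hn hh
  have hn0 : (0 : ℝ) < n := by exact_mod_cast hn
  have hp := one_le_lag (Q := Q) hl
  have hp' : (1 : ℝ) ≤ lag Q n := by exact_mod_cast hp
  have hdec := hX.isDecorrelated hG hh0 hh1 hV hp
  have hLle := abs_log_le hn hh
  have hδ := inv_log_le_delta hl
  have hδ1 := delta_le_one hl
  have hδ0 := delta_pos hl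
  have hl0 : 0 < Real.log n := by linarith
  simp only [pow_one, pow_zero, mul_one, Real.rpow_one] at h2 hν1 hτ1 hpoly1 hpoly2
  have hpn : 2 * lag Q n ≤ n := by exact_mod_cast h2
  set L := |Real.log h| with hL
  have hLh : Real.log h = -L := by
    rw [hL, abs_of_nonpos (Real.log_nonpos hh0.le hh1), neg_neg]
  have hLε : ε / 2 * Real.log n ≤ L := by
    have h3 := Real.log_le_log hh0 hhε
    rw [Real.log_rpow hn0, hLh] at h3
    linarith
  have hL1 : 1 ≤ L := by
    rw [div_le_iff₀ (by positivity)] at hlog1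
    linarith
  have hL2 : 2 ≤ q * L := by
    rw [div_le_iff₀ (by positivity)] at hlog
    nlinarith
  set k := ⌈q * L / 2⌉₊ with hk
  have hkl : q * L / 2 ≤ k := Nat.le_ceil _
  have hku : (k : ℝ) ≤ q * L / 2 + 1 := (Nat.ceil_lt_add_one (a := q * L / 2) (by linarith)).le
  have hkq : (k : ℝ) ≤ q * L := by linarith
  have hkl2 : (k : ℝ) ≤ q * Real.log n := hkq.trans (by gcongr)
  have hk1 : 1 ≤ k := Nat.one_le_ceil_iff.2 (by linarith)
  have hk1' : (1 : ℝ) ≤ k := by exact_mod_cast hk1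
  set ν := smoothed (fun x => G x ^ 2) x₀ h f with hν
  have hν0 : 0 ≤ ν := smoothed_sq_nonneg hX.density.nonneg
  have hνle : ν ≤ 4 * D ^ 2 * B * h := smoothed_sq_le hG hX hh0 hV
  set T := varProxy G x₀ h f n with hTdef
  have hTe : T = n * ν + n * h * delta n / 2 := rfl
  have hdl : 1 ≤ delta n * Real.log n := by
    rwa [inv_eq_one_div, div_le_iff₀ hl0] at hδ
  have hT64 : 64 * D ^ 2 * (lag Q n : ℝ) ^ 2 * (k : ℝ) ^ 3 ≤ T := by
    have h3 : 128 * D ^ 2 * (lag Q n : ℝ) ^ 2 * (k : ℝ) ^ 3 * Real.log n ≤ n * h := by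
      refine le_trans ?_ (hk3.trans hE)
      calc 128 * D ^ 2 * (lag Q n : ℝ) ^ 2 * (k : ℝ) ^ 3 * Real.log n
          ≤ 128 * D ^ 2 * (lag Q n : ℝ) ^ 2 * (q * Real.log n) ^ 3 * Real.log n := by gcongr
        _ = _ := by ring
    have h4 : 128 * D ^ 2 * (lag Q n : ℝ) ^ 2 * (k : ℝ) ^ 3 ≤ n * h * delta n := by
      calc 128 * D ^ 2 * (lag Q n : ℝ) ^ 2 * (k : ℝ) ^ 3
          ≤ 128 * D ^ 2 * (lag Q n : ℝ) ^ 2 * (k : ℝ) ^ 3 * (delta n * Real.log n) :=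
            le_mul_of_one_le_right (by positivity) hdl
        _ = (128 * D ^ 2 * (lag Q n : ℝ) ^ 2 * (k : ℝ) ^ 3 * Real.log n) * delta n := by ring
        _ ≤ _ := by gcongr
    rw [hTe]
    nlinarith
  have hT0 : 0 < T := by
    rw [hTe]
    positivity
  -- `T / 2` equals `nν/2 + n h δ/4`. The main term is matched exactly, and the two error terms take
  -- `n h δ/8` each; the second needs `lag · h` small against `δ`, which is where `h ≤ n^{-ε/2}`
  -- enters.
  have hvar : ((n : ℝ) / (2 * lag Q n) + 1) * (lag Q n * ν + (lag Q n : ℝ) ^ 2 * (M * (D * (2 * h)) ^ 2))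
      ≤ T / 2 := by
    have e1 : ((n : ℝ) / (2 * lag Q n) + 1) * (lag Q n * ν + (lag Q n : ℝ) ^ 2 * (M * (D * (2 * h)) ^ 2))
        = n * ν / 2 + lag Q n * ν
          + ((n : ℝ) / 2 + lag Q n) * (lag Q n * (4 * M * D ^ 2 * h ^ 2)) := by
      field_simp
      ring
    have b1 : lag Q n * ν ≤ n * h * delta n / 8 := by
      have h5 : 32 * D ^ 2 * B * lag Q n ≤ n * delta n := by
        calc 32 * D ^ 2 * B * lag Q n ≤ 32 * D ^ 2 * B * lag Q n * (delta n * Real.log n) :=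
              le_mul_of_one_le_right (by positivity) hdl
          _ = (32 * D ^ 2 * B * lag Q n * Real.log n) * delta n := by ring
          _ ≤ n * delta n := by gcongr
      calc lag Q n * ν ≤ lag Q n * (4 * D ^ 2 * B * h) := by gcongr
        _ = (32 * D ^ 2 * B * lag Q n) * h / 8 := by ring
        _ ≤ n * delta n * h / 8 := by gcongr
        _ = _ := by ring
    have b2 : ((n : ℝ) / 2 + lag Q n) * (lag Q n * (4 * M * D ^ 2 * h ^ 2)) ≤ n * h * delta n / 8 := by
      have h5 : 32 * M * D ^ 2 * lag Q n * h ≤ delta n := by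
        have h6 : (n : ℝ) ^ (ε / 2) * h ≤ 1 := by
          calc (n : ℝ) ^ (ε / 2) * h ≤ (n : ℝ) ^ (ε / 2) * (n : ℝ) ^ (-(ε / 2)) := by gcongr
            _ = 1 := by rw [← Real.rpow_add hn0]; simp
        calc 32 * M * D ^ 2 * lag Q n * h
            ≤ 32 * M * D ^ 2 * lag Q n * h * (delta n * Real.log n) :=
              le_mul_of_one_le_right (by positivity) hdl
          _ = (32 * M * D ^ 2 * lag Q n * Real.log n) * h * delta n := by ring
          _ ≤ (n : ℝ) ^ (ε / 2) * h * delta n := by gcongr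
          _ ≤ 1 * delta n := by gcongr
          _ = delta n := one_mul _
      calc ((n : ℝ) / 2 + lag Q n) * (lag Q n * (4 * M * D ^ 2 * h ^ 2))
          ≤ n * (lag Q n * (4 * M * D ^ 2 * h ^ 2)) := by
            gcongr
            linarith
        _ = n * h * (32 * M * D ^ 2 * lag Q n * h) / 8 := by ring
        _ ≤ _ := by gcongr
    rw [e1, hTe]
    linarith
  have hmom := hdec.integral_pow_le_sharp hk1 hpn
    (herr k hkl2 _ (by positivity) (two_mul_sq_div_le hh0 hnh)) hD hvar hT64
  set w := 2 * q * L * T with hw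
  have hL0 : 0 < L := by linarith
  have hw0 : 0 < w := by positivity
  have hq2k : q ≤ 2 * k := by
    have : q ≤ q * L := le_mul_of_one_le_right hq.le hL1
    linarith
  refine (integral_tailPow_le (bddMeas_centredSum hG hX) (k := k) (Real.sqrt_pos.2 hw0) hq hq2k).trans ?_
  have hs : Real.sqrt w ^ (2 * k) = w ^ k := by rw [pow_mul, Real.sq_sqrt hw0.le]
  have hsq : Real.sqrt w ^ q = w ^ (q / 2) := by
    rw [Real.sqrt_eq_rpow, ← Real.rpow_mul hw0.le]
    congr 1
    ring
  rw [hs, hsq]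
  have hratio := moment_ratio_le hL2 hkl hku hT0 hmom
  have hhq : Real.exp (-(q * L / 2)) = h ^ (q / 2) := by
    rw [Real.rpow_def_of_pos hh0, hLh]
    congr 1
    ring
  rw [hhq] at hratio
  have hTle : T ≤ C0 * (n * h) := by
    rw [hTe]
    have t1 : n * ν ≤ n * (4 * D ^ 2 * B * h) := by gcongr
    have t2 : n * h * delta n ≤ n * h * 1 := by gcongr
    rw [hC0]
    nlinarith
  calc w ^ (q / 2) * ((∫ ω, centredSum G x₀ h f X n ω ^ (2 * k) ∂P) / w ^ k)
      ≤ w ^ (q / 2) * (2 * Real.exp 5 * k * h ^ (q / 2)) := by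
        refine mul_le_mul_of_nonneg_left hratio (by positivity)
    _ = (w * h) ^ (q / 2) * (2 * Real.exp 5 * k) := by
        rw [Real.mul_rpow hw0.le hh0.le]
        ring
    _ ≤ ((n : ℝ) ^ (ε / 2) * (n * h * h)) ^ (q / 2) * (n : ℝ) ^ (ε / 2 * (q / 2)) := by
        have u1 : w * h ≤ (n : ℝ) ^ (ε / 2) * (n * h * h) := by
          calc w * h ≤ 2 * q * Real.log n * (C0 * (n * h)) * h := by
                rw [hw]
                gcongr
            _ = (2 * q * C0 * Real.log n) * (n * h * h) := by ring
            _ ≤ _ := by gcongr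
        have u2 : 2 * Real.exp 5 * k ≤ (n : ℝ) ^ (ε / 2 * (q / 2)) := by
          refine le_trans ?_ hpoly1
          calc 2 * Real.exp 5 * k ≤ 2 * Real.exp 5 * (q * Real.log n) := by gcongr
            _ = _ := by ring
        gcongr
    _ = ((n * h) ^ 2 * (n : ℝ) ^ (-(1 - ε))) ^ (q / 2) := by
        rw [Real.rpow_mul hn0.le, ← Real.mul_rpow (by positivity) (by positivity)]
        congr 1
        have e1 : (n : ℝ) ^ (-(1 - ε)) = (n : ℝ)⁻¹ * ((n : ℝ) ^ (ε / 2) * (n : ℝ) ^ (ε / 2)) := by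
          rw [← Real.rpow_neg_one, ← Real.rpow_add hn0, ← Real.rpow_add hn0]
          congr 1
          ring
        rw [e1]
        field_simp

/-! ### Risk bounds and the oracle bandwidth -/

theorem risk_le {Ω : Type*} [MeasurableSpace Ω] {P : Measure Ω} {Z Ψ : Ω → ℝ} {q y R : ℝ}
    (hq : 0 < q) (hR : 0 ≤ R) (hΨ : Integrable Ψ P) (hle : ∀ ω, |Z ω - y| ^ q ≤ Ψ ω)
    (hint : ∫ ω, Ψ ω ∂P ≤ R ^ q) : risk q P Z y ≤ ENNReal.ofReal R := by
  have h0 : ∀ ω, 0 ≤ Ψ ω := fun ω => (Real.rpow_nonneg (abs_nonneg _) q).trans (hle ω)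
  have h1 : ∫⁻ ω, ENNReal.ofReal (|Z ω - y| ^ q) ∂P ≤ ENNReal.ofReal (R ^ q) := by
    calc ∫⁻ ω, ENNReal.ofReal (|Z ω - y| ^ q) ∂P ≤ ∫⁻ ω, ENNReal.ofReal (Ψ ω) ∂P :=
          lintegral_mono fun ω => ENNReal.ofReal_le_ofReal (hle ω)
      _ = ENNReal.ofReal (∫ ω, Ψ ω ∂P) :=
          (ofReal_integral_eq_lintegral_ofReal hΨ (Filter.Eventually.of_forall h0)).symm
      _ ≤ _ := ENNReal.ofReal_le_ofReal hint
  calc risk q P Z y ≤ ENNReal.ofReal (R ^ q) ^ (1 / q) := ENNReal.rpow_le_rpow h1 (by positivity)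
    _ = ENNReal.ofReal R := by
        rw [ENNReal.ofReal_rpow_of_nonneg (by positivity) (by positivity), ← Real.rpow_mul hR,
          mul_one_div_cancel hq.ne', Real.rpow_one]

theorem add_three_rpow_le {x y z q : ℝ} (hx : 0 ≤ x) (hy : 0 ≤ y) (hz : 0 ≤ z) (hq : 0 < q) :
    (x + y + z) ^ q ≤ (3 * x) ^ q + (3 * y) ^ q + (3 * z) ^ q := by
  have px : 0 ≤ (3 * x) ^ q := by positivity
  have py : 0 ≤ (3 * y) ^ q := by positivity
  have pz : 0 ≤ (3 * z) ^ q := by positivity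
  rcases le_total x y with h1 | h1
  · rcases le_total y z with h2 | h2
    · have := Real.rpow_le_rpow (by positivity) (show x + y + z ≤ 3 * z by linarith) hq.le
      linarith
    · have := Real.rpow_le_rpow (by positivity) (show x + y + z ≤ 3 * y by linarith) hq.le
      linarith
  · rcases le_total x z with h2 | h2
    · have := Real.rpow_le_rpow (by positivity) (show x + y + z ≤ 3 * z by linarith) hq.le
      linarith
    · have := Real.rpow_le_rpow (by positivity) (show x + y + z ≤ 3 * x by linarith) hq.le
      linarith

theorem self_mem_nbhd (q : ℝ) (n : ℕ) (x₀ : ℝ) : x₀ ∈ nbhd q n x₀ := by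
  have : 0 ≤ (1 / Real.log n) ^ (1 / q) :=
    Real.rpow_nonneg (div_nonneg zero_le_one (Real.log_natCast_nonneg n)) _
  exact ⟨by linarith, by linarith⟩

/-- A bandwidth of the grid within a factor `2` of the oracle bandwidth. -/
theorem eventually_exists_bandwidth {s : ℝ} (q : ℝ) (hs : 0 < s) :
    ∀ᶠ n : ℕ in Filter.atTop, ∃ h ∈ bandwidths q n,
      h ≤ (Real.log n / n) ^ (1 / (2 * s + 1)) ∧ (Real.log n / n) ^ (1 / (2 * s + 1)) ≤ 2 * h := by
  obtain ⟨N, hN⟩ := exists_nat_ge (1 / (2 * s + 1) + 1 / q)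
  have hα : 0 < 1 / (2 * s + 1) := by positivity
  have hα2 : 0 < 1 - 1 / (2 * s + 1) := by
    rw [sub_pos, div_lt_one (by positivity)]
    linarith
  filter_upwards [eventually_one_le_log, Filter.eventually_ge_atTop 1,
    eventually_lag_pow_le_rpow 0 (C := 1) zero_le_one 0 N hα,
    eventually_exp_sqrt_le_rpow (half_pos hα2),
    eventually_lag_pow_le_rpow 0 (C := 2) zero_le_two 0 0 (half_pos hα2)] with n hl hn hlN hE h2
  simp only [pow_zero, mul_one, one_mul] at hlN h2
  set α := 1 / (2 * s + 1) with hαd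
  have hn0 : (0 : ℝ) < n := by exact_mod_cast hn
  have hl0 : 0 < Real.log n := by linarith
  set h₀ := (Real.log n / n) ^ α with hh₀
  have hpos : 0 < h₀ := by positivity
  have hhigh : h₀ ≤ hHigh q n := by
    rw [hh₀, hHigh, Real.div_rpow hl0.le hn0.le, div_le_iff₀ (by positivity), neg_div]
    have h5 : Real.log n ^ α * Real.log n ^ (1 / q) ≤ (n : ℝ) ^ α := by
      rw [← Real.rpow_add hl0]
      refine le_trans ?_ hlN
      rw [← Real.rpow_natCast]
      exact Real.rpow_le_rpow_of_exponent_le hl hN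
    rw [Real.rpow_neg hl0.le, ← div_eq_inv_mul, le_div_iff₀ (by positivity)]
    exact h5
  have hle1 : h₀ ≤ 1 := by
    refine Real.rpow_le_one (by positivity) ?_ hα.le
    rw [div_le_one hn0]
    exact Real.log_le_self hn0.le
  -- The factor 2 leaves room for rounding `h₀` down to a power of `1/2`.
  have hlow : 2 * hLow n ≤ h₀ := by
    have h6 : (n : ℝ) ^ (-α) ≤ h₀ := by
      rw [hh₀, Real.div_rpow hl0.le hn0.le, Real.rpow_neg hn0.le, ← one_div]
      gcongr
      exact Real.one_le_rpow hl hα.le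
    refine le_trans ?_ h6
    calc 2 * hLow n ≤ (n : ℝ) ^ ((1 - α) / 2) * ((n : ℝ)⁻¹ * (n : ℝ) ^ ((1 - α) / 2)) := by
          unfold hLow
          gcongr
      _ = (n : ℝ) ^ (-α) := by
          rw [← Real.rpow_neg_one, ← Real.rpow_add hn0, ← Real.rpow_add hn0]
          congr 1
          ring
  obtain ⟨k, hk1, hk2⟩ := exists_nat_pow_near_of_lt_one hpos hle1 (y := (1 / 2 : ℝ)) (by norm_num) (by norm_num)
  have e : ((2 : ℝ) ^ (k + 1))⁻¹ = (1 / 2) ^ (k + 1) := by rw [one_div, inv_pow]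
  refine ⟨((2 : ℝ) ^ (k + 1))⁻¹, ⟨⟨k + 1, rfl⟩, ?_⟩, ?_, ?_⟩
  · rw [e]
    constructor
    · rw [pow_succ]
      linarith
    · exact hk1.le.trans hhigh
  · rw [e]
    exact hk1.le
  · rw [e, pow_succ]
    linarith

/-! ### Comparison of the random penalty with its deterministic counterparts -/

section Pathwise

variable {Ω : Type*} {K : ℝ → ℝ} {q x₀ D B : ℝ} {f : ℝ → ℝ} {X : ℤ → Ω → ℝ} {n : ℕ}

/-- The penalty contains the full correction `n h δ` after rescaling: one half compensates the
fluctuation of `JHat`, the other half is the one kept in `varProxy`. -/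
theorem sqrt_varProxy_le_MHat (hn : 1 ≤ n) (hq : 0 < q) {h : ℝ} (hh : 0 < h) {ω : Ω}
    (hgood : |centredSum (fun x => K x ^ 2) x₀ h f X n ω| ≤ n * h * delta n / 2) :
    Real.sqrt (2 * q * |Real.log h| * varProxy K x₀ h f n)
      ≤ n * h * MHat K q x₀ h (observations X n ω) := by
  have hn0 : (0 : ℝ) < n := by exact_mod_cast hn
  have hJ := JHat_sub_eq (K := K) (x₀ := x₀) (f := f) (X := X) (ω := ω) hn hh
  have h1 : n * h * MHat K q x₀ h (observations X n ω) = Real.sqrt ((n * h) ^ 2 *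
      (2 * q * |Real.log h| * (JHat K x₀ h (observations X n ω) + delta n / (n * h)))) := by
    rw [Real.sqrt_mul (by positivity), Real.sqrt_sq (by positivity), MHat]
  rw [h1]
  refine Real.sqrt_le_sqrt ?_
  have h2 : (n * h) ^ 2 * (JHat K x₀ h (observations X n ω) + delta n / (n * h))
      = centredSum (fun x => K x ^ 2) x₀ h f X n ω + n * smoothed (fun x => K x ^ 2) x₀ h f
        + n * h * delta n := by
    have : JHat K x₀ h (observations X n ω) = centredSum (fun x => K x ^ 2) x₀ h f X n ω / (n * h) ^ 2
        + smoothed (fun x => K x ^ 2) x₀ h f / (n * h ^ 2) := by linarith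
    rw [this]
    field_simp
  calc 2 * q * |Real.log h| * varProxy K x₀ h f n
      ≤ 2 * q * |Real.log h| * ((n * h) ^ 2 * (JHat K x₀ h (observations X n ω) + delta n / (n * h))) := by
        gcongr
        rw [h2, varProxy]
        linarith [neg_le_of_abs_le hgood]
    _ = _ := by ring

theorem MHat_le (hn : 1 ≤ n) (hl : 1 ≤ Real.log n) (hq : 0 < q) (hB : 0 < B) {h : ℝ}
    (hh : h ∈ bandwidths q n) {ω : Ω}
    (hν : smoothed (fun x => K x ^ 2) x₀ h f ≤ 4 * D ^ 2 * B * h)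
    (hgood : |centredSum (fun x => K x ^ 2) x₀ h f X n ω| ≤ n * h * delta n / 2) :
    MHat K q x₀ h (observations X n ω)
      ≤ Real.sqrt (2 * q * (4 * D ^ 2 * B + 2) * (Real.log n / (n * h))) := by
  have hh0 := pos_of_mem_bandwidths hh
  have hn0 : (0 : ℝ) < n := by exact_mod_cast hn
  have hJ := JHat_sub_eq (K := K) (x₀ := x₀) (f := f) (X := X) (ω := ω) hn hh0
  have hδ := delta_le_one hl
  have hL := abs_log_le hn hh
  refine Real.sqrt_le_sqrt ?_
  have h1 : JHat K x₀ h (observations X n ω) + delta n / (n * h) ≤ (4 * D ^ 2 * B + 2) / (n * h) := by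
    have h2 : JHat K x₀ h (observations X n ω) = centredSum (fun x => K x ^ 2) x₀ h f X n ω / (n * h) ^ 2
        + smoothed (fun x => K x ^ 2) x₀ h f / (n * h ^ 2) := by linarith
    have h3 : centredSum (fun x => K x ^ 2) x₀ h f X n ω / (n * h) ^ 2 ≤ 1 / (n * h) := by
      rw [div_le_div_iff₀ (by positivity) (by positivity)]
      have : centredSum (fun x => K x ^ 2) x₀ h f X n ω ≤ n * h := by
        refine (le_of_abs_le hgood).trans ?_
        have : n * h * delta n ≤ n * h * 1 := by gcongr
        have : 0 < n * h := by positivity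
        linarith
      nlinarith [mul_pos hn0 hh0]
    have h4 : smoothed (fun x => K x ^ 2) x₀ h f / (n * h ^ 2) ≤ 4 * D ^ 2 * B / (n * h) := by
      rw [div_le_div_iff₀ (by positivity) (by positivity)]
      calc smoothed (fun x => K x ^ 2) x₀ h f * (n * h) ≤ (4 * D ^ 2 * B * h) * (n * h) := by gcongr
        _ = _ := by ring
    have h5 : delta n / (n * h) ≤ 1 / (n * h) := by gcongr
    rw [h2]
    calc _ ≤ 1 / (n * h) + 4 * D ^ 2 * B / (n * h) + 1 / (n * h) := by gcongr
      _ = _ := by ring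
  calc 2 * q * |Real.log h| * (JHat K x₀ h (observations X n ω) + delta n / (n * h))
      ≤ 2 * q * |Real.log h| * ((4 * D ^ 2 * B + 2) / (n * h)) := by gcongr
    _ ≤ 2 * q * Real.log n * ((4 * D ^ 2 * B + 2) / (n * h)) := by gcongr
    _ = _ := by ring

/-- Error of the adaptive estimator on the event where all empirical variances are accurate. -/
theorem abs_adaptiveEstimator_sub_rpow_le (hn : 1 ≤ n) (hq : 0 < q) {hhat : (Fin n → ℝ) → ℝ}
    (hsel : IsSelectionRule K q x₀ hhat) {y β R h : ℝ} {ω : Ω} (hh : h ∈ bandwidths q n)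
    (hβ : ∀ η ∈ bandwidths q n, η ≤ h → |η⁻¹ * smoothed K x₀ η f - y| ≤ β)
    (hR : MHat K q x₀ h (observations X n ω) ≤ R)
    (hgood : ∀ η ∈ bandwidths q n,
      |centredSum (fun x => K x ^ 2) x₀ η f X n ω| ≤ n * η * delta n / 2) :
    |adaptiveEstimator K x₀ hhat (observations X n ω) - y| ^ q
      ≤ 39 ^ q * (∑ η ∈ (finite_bandwidths q hn).toFinset,
        tailPow (centredSum K x₀ η f X n) (Real.sqrt (2 * q * |Real.log η| * varProxy K x₀ η f n)) q ω
          / (n * η) ^ q) + (21 * R) ^ q + (39 * β) ^ q := by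
  have hn0 : (0 : ℝ) < n := by exact_mod_cast hn
  set t : ℝ → ℝ := fun η => Real.sqrt (2 * q * |Real.log η| * varProxy K x₀ η f n) with ht
  -- The maximum of `z` over the grid plays the role of `ζ` in the oracle inequality; its `q`-th
  -- power is finally bounded by the sum over the grid.
  set z : ℝ → ℝ := fun η => if t η < |centredSum K x₀ η f X n ω|
    then |centredSum K x₀ η f X n ω| / (n * η) else 0 with hz
  have hz0 : ∀ η ∈ bandwidths q n, 0 ≤ z η := fun η hη => by
    have := pos_of_mem_bandwidths hη
    simp only [hz]
    split_ifs <;> positivity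
  have hzq : ∀ η ∈ bandwidths q n, z η ^ q
      = tailPow (centredSum K x₀ η f X n) (t η) q ω / (n * η) ^ q := fun η hη => by
    have := pos_of_mem_bandwidths hη
    simp only [hz, tailPow]
    split_ifs
    · rw [Real.div_rpow (abs_nonneg _) (by positivity)]
    · rw [Real.zero_rpow hq.ne', zero_div]
  obtain ⟨η₀, hη₀, hmax⟩ := (finite_bandwidths q hn).toFinset.exists_max_image z
    ⟨h, (Set.Finite.mem_toFinset _).2 hh⟩
  have hη₀' : η₀ ∈ bandwidths q n := (Set.Finite.mem_toFinset _).1 hη₀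
  have hdev : ∀ η ∈ bandwidths q n,
      |kernelEstimator K x₀ η (observations X n ω) - η⁻¹ * smoothed K x₀ η f|
        ≤ MHat K q x₀ η (observations X n ω) + z η₀ := by
    intro η hη
    have hη0 := pos_of_mem_bandwidths hη
    have hm := MHat_nonneg (K := K) (q := q) (x₀ := x₀) η (observations X n ω)
    rw [kernelEstimator_sub_eq hn hη0, abs_div, abs_of_pos (show 0 < n * η by positivity)]
    have hzle := hmax η ((Set.Finite.mem_toFinset _).2 hη)
    rcases lt_or_ge (t η) |centredSum K x₀ η f X n ω| with hlt | hle
    · have : z η = |centredSum K x₀ η f X n ω| / (n * η) := if_pos hlt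
      linarith
    · have h1 := sqrt_varProxy_le_MHat hn hq hη0 (hgood η hη)
      have h2 : |centredSum K x₀ η f X n ω| / (n * η) ≤ MHat K q x₀ η (observations X n ω) := by
        rw [div_le_iff₀' (by positivity)]
        exact hle.trans h1
      linarith [hz0 η₀ hη₀']
  have hβ0 : 0 ≤ β := (abs_nonneg _).trans (hβ h hh le_rfl)
  have hR0 : 0 ≤ R := (MHat_nonneg _ _).trans hR
  have key := abs_adaptiveEstimator_sub_le hn hsel (observations X n ω)
    (fun η => η⁻¹ * smoothed K x₀ η f) hh (hz0 η₀ hη₀') hβ hdev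
  have key2 := Real.rpow_le_rpow (abs_nonneg _) (key.trans (show _ ≤ 13 * z η₀ + 7 * R + 13 * β by linarith)) hq.le
  refine key2.trans ((add_three_rpow_le (by linarith [hz0 η₀ hη₀']) (by positivity) (by positivity) hq).trans ?_)
  have e1 : (3 * (13 * z η₀)) ^ q = 39 ^ q * z η₀ ^ q := by
    rw [← Real.mul_rpow (by norm_num) (hz0 η₀ hη₀')]
    ring_nf
  have e2 : (3 * (7 * R)) = 21 * R := by ring
  have e3 : (3 * (13 * β)) = 39 * β := by ring
  rw [e1, e2, e3, hzq η₀ hη₀']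
  gcongr
  refine Finset.single_le_sum (f := fun η => tailPow (centredSum K x₀ η f X n) (t η) q ω / (n * η) ^ q)
    (fun η hη => ?_) hη₀
  have := pos_of_mem_bandwidths ((Set.Finite.mem_toFinset _).1 hη)
  have := tailPow_nonneg (centredSum K x₀ η f X n) (t η) q ω
  positivity

end Pathwise

/-! ### The adaptive rate -/

variable {a b c M B D q s L : ℝ} {K : ℝ → ℝ}

/-- The truncated moments of the stochastic error, integrated against its majorant. -/
theorem eventually_tail_le (ha : 0 < a) (hb : 0 < b) (hc : 0 < c) (hM : 0 < M)
    (hB : 0 < B) (hq : 0 < q) (hK : IsBump D K) {ε : ℝ} (hε : 0 < ε) :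
    ∀ᶠ n : ℕ in Filter.atTop, ∀ (Ω : Type u) [MeasurableSpace Ω] (P : Measure Ω)
      [IsProbabilityMeasure P] (X : ℤ → Ω → ℝ) (f : ℝ → ℝ) (x₀ h : ℝ),
      IsWeaklyDependent (nbhd q n x₀) a b c M B P X f → h ∈ bandwidths q n →
      ∫ ω, tailPow (centredSum K x₀ h f X n)
          (Real.sqrt (2 * q * |Real.log h| * varProxy K x₀ h f n)) q ω / (n * h) ^ q ∂P
        ≤ (n : ℝ) ^ (-(1 - ε) * (q / 2)) := by
  filter_upwards [eventually_tail_large_bandwidth.{u} ha hb hc hM hq hK hε,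
    eventually_tail_small_bandwidth.{u} ha hb hc hM hB hq hK hε, Filter.eventually_ge_atTop 1]
    with n h1 h2 hn Ω _ P _ X f x₀ h hX hh
  have hh0 := pos_of_mem_bandwidths hh
  have hn0 : (0 : ℝ) < n := by exact_mod_cast hn
  rw [integral_div, div_le_iff₀ (by positivity)]
  have e : ((n * h) ^ 2 * (n : ℝ) ^ (-(1 - ε))) ^ (q / 2)
      = (n : ℝ) ^ (-(1 - ε) * (q / 2)) * (n * h) ^ q := by
    rw [Real.mul_rpow (by positivity) (by positivity), ← Real.rpow_mul hn0.le, ← Real.rpow_natCast,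
      ← Real.rpow_mul (by positivity)]
    have : ((2 : ℕ) : ℝ) * (q / 2) = q := by push_cast; ring
    rw [this, mul_comm]
  rw [← e]
  rcases le_total h ((n : ℝ) ^ (-(ε / 2))) with hle | hle
  · exact h2 Ω P X f x₀ h hX hh hle
  · exact h1 Ω P X f x₀ h hX hh hle _

/-- The adaptive estimator attains the adaptive rate for all large sample sizes. -/
theorem eventually_risk_le (ha : 0 < a) (hb : 0 < b) (hc : 0 < c) (hM : 0 < M)
    (hB : 0 < B) (hq : 0 < q) (hs : 0 < s) (hL : 0 < L) (hK : IsKernel K) (hKD : IsBump D K) :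
    ∃ W : ℝ, 0 < W ∧ ∀ᶠ n : ℕ in Filter.atTop, ∀ m : ℕ, HasOrder K m → holderIndex s ≤ m →
      ∀ (x₀ : ℝ) (hhat : (Fin n → ℝ) → ℝ), IsSelectionRule K q x₀ hhat →
      ∀ (Ω : Type u) [MeasurableSpace Ω] (P : Measure Ω) [IsProbabilityMeasure P]
        (X : ℤ → Ω → ℝ) (f : ℝ → ℝ), IsWeaklyDependent (nbhd q n x₀) a b c M B P X f →
        IsHolderClass (nbhd q n x₀) s L B f →
        risk q P (fun ω => adaptiveEstimator K x₀ hhat (observations X n ω)) (f x₀)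
          ≤ ENNReal.ofReal (W * (Real.log n / n) ^ (s / (2 * s + 1))) := by
  have hD := hKD.one_le
  set κ := s / (2 * s + 1) with hκ
  have hκ0 : 0 < κ := by positivity
  set C₁ := Real.sqrt (2 * q * (4 * D ^ 2 * B + 2) * 2) with hC₁
  set C₂ := 2 * D * L with hC₂
  have hC₂0 : 0 < C₂ := by positivity
  -- The 2 accounts for the stochastic excess and the exceptional event, each at most `r ^ q`; the
  -- other terms are penalty and bias.
  set W₀ := 2 + (21 * C₁) ^ q + (39 * C₂) ^ q with hW₀
  have hW₀0 : 0 < W₀ := by positivity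
  refine ⟨W₀ ^ (1 / q), by positivity, ?_⟩
  -- Chosen so that `1/2 - ε = κ`: the tail exponent `(1 - ε) q / 2`, reduced by `ε q / 2` for the
  -- logarithms, is exactly `κ q`.
  set ε := 1 / (2 * (2 * s + 1)) with hε
  have hε0 : 0 < ε := by positivity
  filter_upwards [eventually_one_le_log, Filter.eventually_ge_atTop 1,
    eventually_tail_le.{u} ha hb hc hM hB hq hKD hε0,
    eventually_measure_deviation_le.{u} (q := q) ha hb hc hM hB hKD.sq (C := q + κ * q + 1)
      (by positivity),
    eventually_exists_bandwidth q hs,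
    eventually_lag_pow_le_rpow 0 (C := 39 ^ q * 3) (by positivity) 0 1 (ε := ε / 2 * q)
      (by positivity),
    eventually_lag_pow_le_rpow 0 (C := (D + B) ^ q * 3) (by positivity) 0 1 one_pos]
    with n hl hn htail hdevi hband hpoly1 hpoly2 m hm hsm x₀ hhat hsel Ω _ P _ X f hX hf
  simp only [pow_zero, pow_one, mul_one, Real.rpow_one] at hpoly1 hpoly2
  obtain ⟨h, hh, hle, hge⟩ := hband
  have hn0 : (0 : ℝ) < n := by exact_mod_cast hn
  have hl0 : 0 < Real.log n := by linarith
  have hh0 := pos_of_mem_bandwidths hh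
  set r := (Real.log n / n) ^ κ with hr
  have hr0 : 0 < r := by positivity
  have hrq : (n : ℝ) ^ (-(κ * q)) ≤ r ^ q := by
    rw [hr, ← Real.rpow_mul (by positivity), Real.div_rpow hl0.le hn0.le, Real.rpow_neg hn0.le,
      ← one_div]
    gcongr
    exact Real.one_le_rpow hl (by positivity)
  set 𝓗 := (finite_bandwidths q hn).toFinset with h𝓗
  have hmem : ∀ {η}, η ∈ 𝓗 → η ∈ bandwidths q n := fun hη => (Set.Finite.mem_toFinset _).1 hη
  have hcard : (𝓗.card : ℝ) ≤ 3 * Real.log n := (card_bandwidths_le hn).trans (by linarith)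
  set T : ℝ → Ω → ℝ := fun η ω => tailPow (centredSum K x₀ η f X n)
    (Real.sqrt (2 * q * |Real.log η| * varProxy K x₀ η f n)) q ω / (n * η) ^ q with hT
  set E : ℝ → Set Ω := fun η =>
    {ω | n * η * delta n / 2 < |centredSum (fun x => K x ^ 2) x₀ η f X n ω|} with hE
  have hEm : ∀ η, MeasurableSet (E η) := fun η =>
    measurableSet_lt measurable_const (bddMeas_centredSum hKD.sq hX).1.abs
  have hTb : ∀ η, Integrable (T η) P := fun η =>
    ((bddMeas_tailPow (bddMeas_centredSum hKD hX) _ hq).integrable P).div_const _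
  have hT0 : ∀ η ∈ 𝓗, ∀ ω, 0 ≤ T η ω := fun η hη ω => by
    have := pos_of_mem_bandwidths (hmem hη)
    exact div_nonneg (tailPow_nonneg _ _ _ _) (by positivity)
  set Ψ : Ω → ℝ := fun ω => 39 ^ q * (∑ η ∈ 𝓗, T η ω) + ((21 * (C₁ * r)) ^ q + (39 * (C₂ * r)) ^ q)
    + (D * n + B) ^ q * ∑ η ∈ 𝓗, (E η).indicator 1 ω with hΨ
  have hi1 : Integrable (fun ω => 39 ^ q * (∑ η ∈ 𝓗, T η ω)) P :=
    (integrable_finsetSum _ fun η _ => hTb η).const_mul _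
  have hEi : ∀ η, Integrable (fun ω => (E η).indicator (1 : Ω → ℝ) ω) P := fun η =>
    (integrable_const (1 : ℝ)).indicator (hEm η)
  have hi2 : Integrable (fun ω => (D * n + B) ^ q * ∑ η ∈ 𝓗, (E η).indicator (1 : Ω → ℝ) ω) P :=
    (integrable_finsetSum _ fun η _ => hEi η).const_mul _
  have hi3 : Integrable (fun ω => 39 ^ q * (∑ η ∈ 𝓗, T η ω)
      + ((21 * (C₁ * r)) ^ q + (39 * (C₂ * r)) ^ q)) P := hi1.add (integrable_const _)
  have hfx : |f x₀| ≤ B := by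
    rw [abs_of_nonneg (hX.density.nonneg x₀)]
    exact hX.le_on_window x₀ (self_mem_nbhd q n x₀)
  have hrs : r = ((Real.log n / n) ^ (1 / (2 * s + 1))) ^ s := by
    rw [hr, ← Real.rpow_mul (by positivity)]
    congr 1
    rw [hκ]
    ring
  refine risk_le (Ψ := Ψ) hq (by positivity) (hi3.add hi2) (fun ω => ?_) ?_
  · by_cases hgood : ∀ η ∈ bandwidths q n, ω ∉ E η
    · have hgood' : ∀ η ∈ bandwidths q n,
          |centredSum (fun x => K x ^ 2) x₀ η f X n ω| ≤ n * η * delta n / 2 :=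
        fun η hη => not_lt.1 (hgood η hη)
      have hb1 : ∀ η ∈ bandwidths q n, η ≤ h → |η⁻¹ * smoothed K x₀ η f - f x₀| ≤ C₂ * r := by
        intro η hη hηh
        have hη0 := pos_of_mem_bandwidths hη
        refine (abs_smoothed_sub_le hKD hK hm hsm hs hL hf hη0).trans ?_
        rw [hrs]
        have := hηh.trans hle
        gcongr
      have hb2 : MHat K q x₀ h (observations X n ω) ≤ C₁ * r := by
        refine (MHat_le hn hl hq hB hh
          (smoothed_sq_le hKD hX hh0 (Icc_subset_nbhd x₀ hh)) (hgood' h hh)).trans ?_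
        have e1 : Real.log n / (n * h) ≤ 2 * r ^ 2 := by
          have e2 : r ^ 2 * (Real.log n / n) ^ (1 / (2 * s + 1)) = Real.log n / n := by
            rw [hr, ← Real.rpow_natCast, ← Real.rpow_mul (by positivity),
              ← Real.rpow_add (by positivity)]
            have : κ * ((2 : ℕ) : ℝ) + 1 / (2 * s + 1) = 1 := by
              rw [hκ]
              push_cast
              field_simp
            rw [this, Real.rpow_one]
          rw [← div_div, div_le_iff₀ hh0, ← e2]
          nlinarith [sq_nonneg r]
        rw [hC₁, ← Real.sqrt_sq hr0.le, ← Real.sqrt_mul (by positivity)]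
        refine Real.sqrt_le_sqrt ?_
        calc 2 * q * (4 * D ^ 2 * B + 2) * (Real.log n / (n * h))
            ≤ 2 * q * (4 * D ^ 2 * B + 2) * (2 * r ^ 2) := by gcongr
          _ = _ := by ring
      have key := abs_adaptiveEstimator_sub_rpow_le hn hq hsel hh hb1 hb2 hgood'
      refine key.trans ?_
      have : 0 ≤ (D * n + B) ^ q * ∑ η ∈ 𝓗, (E η).indicator (1 : Ω → ℝ) ω :=
        mul_nonneg (by positivity) (Finset.sum_nonneg fun η _ =>
          Set.indicator_nonneg (fun _ _ => zero_le_one) _)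
      simp only [hΨ, hT]
      linarith
    · push Not at hgood
      obtain ⟨η, hη, hωη⟩ := hgood
      have h1 : |adaptiveEstimator K x₀ hhat (observations X n ω) - f x₀| ≤ D * n + B :=
        (abs_sub _ _).trans (add_le_add (abs_kernelEstimator_le hKD hn (hsel.mem _) _) hfx)
      have h2 : 1 ≤ ∑ η ∈ 𝓗, (E η).indicator (1 : Ω → ℝ) ω := by
        refine le_trans (le_of_eq ?_) (Finset.single_le_sum
          (f := fun η => (E η).indicator (1 : Ω → ℝ) ω)
          (fun η _ => Set.indicator_nonneg (fun _ _ => zero_le_one) _)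
          ((Set.Finite.mem_toFinset _).2 hη))
        simp [Set.indicator_of_mem hωη]
      have h3 : 0 ≤ ∑ η ∈ 𝓗, T η ω := Finset.sum_nonneg fun η hη => hT0 η hη ω
      have h4 : (D * n + B) ^ q ≤ (D * n + B) ^ q * ∑ η ∈ 𝓗, (E η).indicator (1 : Ω → ℝ) ω :=
        le_mul_of_one_le_right (by positivity) h2
      have h5 : 0 ≤ (39 : ℝ) ^ q * ∑ η ∈ 𝓗, T η ω := by positivity
      have h6 : 0 ≤ (21 * (C₁ * r)) ^ q + (39 * (C₂ * r)) ^ q := by positivity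
      have h7 := Real.rpow_le_rpow (abs_nonneg _) h1 hq.le
      simp only [hΨ]
      linarith
  · have p1 : ∫ ω, 39 ^ q * (∑ η ∈ 𝓗, T η ω) ∂P ≤ r ^ q := by
      rw [integral_const_mul, integral_finsetSum _ fun η _ => hTb η]
      calc 39 ^ q * ∑ η ∈ 𝓗, ∫ ω, T η ω ∂P
          ≤ 39 ^ q * ∑ _η ∈ 𝓗, (n : ℝ) ^ (-(1 - ε) * (q / 2)) := by
            gcongr with η hη
            exact htail Ω P X f x₀ η hX (hmem hη)
        _ = 39 ^ q * (𝓗.card * (n : ℝ) ^ (-(1 - ε) * (q / 2))) := by simp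
        _ ≤ 39 ^ q * (3 * Real.log n * (n : ℝ) ^ (-(1 - ε) * (q / 2))) := by gcongr
        _ = (39 ^ q * 3 * Real.log n) * (n : ℝ) ^ (-(1 - ε) * (q / 2)) := by ring
        _ ≤ (n : ℝ) ^ (ε / 2 * q) * (n : ℝ) ^ (-(1 - ε) * (q / 2)) := by gcongr
        _ = (n : ℝ) ^ (-(κ * q)) := by
            rw [← Real.rpow_add hn0]
            congr 1
            rw [hκ, hε]
            field_simp
            ring
        _ ≤ _ := hrq
    -- In the exponent `q + κ q + 1`, the first term cancels the crude error `n^q`, the last pays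
    -- for the size of the grid and constants, and the middle one is the rate.
    have p2 : ∫ ω, (D * n + B) ^ q * ∑ η ∈ 𝓗, (E η).indicator (1 : Ω → ℝ) ω ∂P ≤ r ^ q := by
      rw [integral_const_mul, integral_finsetSum _ fun η _ => hEi η]
      simp_rw [integral_indicator_one (hEm _)]
      have hn1 : (1 : ℝ) ≤ n := by exact_mod_cast hn
      calc (D * n + B) ^ q * ∑ η ∈ 𝓗, P.real (E η)
          ≤ ((D + B) * n) ^ q * ∑ _η ∈ 𝓗, (n : ℝ) ^ (-(q + κ * q + 1)) := by
            gcongr with η hη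
            · nlinarith
            · exact hdevi Ω P X f x₀ η hX (hmem hη)
        _ = ((D + B) * n) ^ q * (𝓗.card * (n : ℝ) ^ (-(q + κ * q + 1))) := by simp
        _ ≤ ((D + B) * n) ^ q * (3 * Real.log n * (n : ℝ) ^ (-(q + κ * q + 1))) := by gcongr
        _ = ((D + B) ^ q * 3 * Real.log n) * ((n : ℝ) ^ q * (n : ℝ) ^ (-(q + κ * q + 1))) := by
            rw [Real.mul_rpow (by positivity) hn0.le]
            ring
        _ ≤ n * ((n : ℝ) ^ q * (n : ℝ) ^ (-(q + κ * q + 1))) := by gcongr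
        _ = (n : ℝ) ^ (-(κ * q)) := by
            nth_rewrite 1 [← Real.rpow_one (n : ℝ)]
            rw [← Real.rpow_add hn0, ← Real.rpow_add hn0]
            congr 1
            ring
        _ ≤ _ := hrq
    have e : ∫ ω, Ψ ω ∂P = ∫ ω, 39 ^ q * (∑ η ∈ 𝓗, T η ω) ∂P
        + ((21 * (C₁ * r)) ^ q + (39 * (C₂ * r)) ^ q)
        + ∫ ω, (D * n + B) ^ q * ∑ η ∈ 𝓗, (E η).indicator (1 : Ω → ℝ) ω ∂P := by
      simp only [hΨ]
      rw [integral_add hi3 hi2, integral_add hi1 (integrable_const _)]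
      simp
    have e21 : (21 * (C₁ * r)) ^ q = (21 * C₁) ^ q * r ^ q := by
      rw [← mul_assoc, Real.mul_rpow (by positivity) hr0.le]
    have e39 : (39 * (C₂ * r)) ^ q = (39 * C₂) ^ q * r ^ q := by
      rw [← mul_assoc, Real.mul_rpow (by positivity) hr0.le]
    have eW : (W₀ ^ (1 / q) * r) ^ q = W₀ * r ^ q := by
      rw [Real.mul_rpow (by positivity) hr0.le, ← Real.rpow_mul hW₀0.le,
        one_div_mul_cancel hq.ne', Real.rpow_one]
    rw [e, eW, e21, e39, hW₀]
    nlinarith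

/-- A crude bound on the risk, valid for every sample size. -/
theorem risk_le_mul_natCast (hB : 0 < B) (hq : 0 < q) (hKD : IsBump D K) {n : ℕ} (hn : 1 ≤ n)
    {x₀ : ℝ} {hhat : (Fin n → ℝ) → ℝ} (hsel : IsSelectionRule K q x₀ hhat) {Ω : Type u}
    [MeasurableSpace Ω] (P : Measure Ω) [IsProbabilityMeasure P] (X : ℤ → Ω → ℝ) {y : ℝ}
    (hy : |y| ≤ B) :
    risk q P (fun ω => adaptiveEstimator K x₀ hhat (observations X n ω)) y
      ≤ ENNReal.ofReal (D * n + B) := by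
  have hD := hKD.one_le
  refine risk_le (Ψ := fun _ => (D * n + B) ^ q) hq (by positivity) (integrable_const _)
    (fun ω => ?_) (by simp)
  exact Real.rpow_le_rpow (abs_nonneg _) ((abs_sub _ _).trans
    (add_le_add (abs_kernelEstimator_le hKD hn (hsel.mem _) _) hy)) hq.le

/-- The finitely many sample sizes below the asymptotic regime are covered by the crude bound, since
the rate stays bounded below there. -/
theorem exists_risk_le (ha : 0 < a) (hb : 0 < b) (hc : 0 < c) (hM : 0 < M)
    (hB : 0 < B) (hq : 0 < q) (hs : 0 < s) (hL : 0 < L) (hK : IsKernel K) :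
    ∃ C : ℝ, 0 < C ∧ ∀ m : ℕ, HasOrder K m → holderIndex s ≤ m → ∀ n : ℕ, 2 ≤ n →
      ∀ (x₀ : ℝ) (hhat : (Fin n → ℝ) → ℝ), IsSelectionRule K q x₀ hhat →
      ∀ (Ω : Type u) [MeasurableSpace Ω] (P : Measure Ω) [IsProbabilityMeasure P]
        (X : ℤ → Ω → ℝ) (f : ℝ → ℝ), IsWeaklyDependent (nbhd q n x₀) a b c M B P X f →
        IsHolderClass (nbhd q n x₀) s L B f →
        risk q P (fun ω => adaptiveEstimator K x₀ hhat (observations X n ω)) (f x₀)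
          ≤ ENNReal.ofReal (C * (Real.log n / n) ^ (s / (2 * s + 1))) := by
  obtain ⟨D, hKD⟩ := hK.exists_isBump
  have hD := hKD.one_le
  obtain ⟨W, hW, hev⟩ := eventually_risk_le.{u} ha hb hc hM hB hq hs hL hK hKD
  obtain ⟨N, hN⟩ := Filter.eventually_atTop.1 hev
  have hlog2 : 0 < Real.log 2 := Real.log_pos one_lt_two
  -- A lower bound for the rate when `2 ≤ n ≤ N`; `N + 1` avoids a vanishing denominator.
  set ρ := (Real.log 2 / (N + 1)) ^ (s / (2 * s + 1)) with hρ
  have hρ0 : 0 < ρ := by positivity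
  refine ⟨max W ((D * N + B) / ρ), lt_max_of_lt_left hW, ?_⟩
  intro m hm hsm n hn x₀ hhat hsel Ω _ P _ X f hX hf
  have hn2 : (2 : ℝ) ≤ n := by exact_mod_cast hn
  have hrate : 0 ≤ (Real.log n / n) ^ (s / (2 * s + 1)) :=
    Real.rpow_nonneg (div_nonneg (Real.log_natCast_nonneg n) (by linarith)) _
  rcases le_total N n with hNn | hNn
  · refine (hN n hNn m hm hsm x₀ hhat hsel Ω P X f hX hf).trans (ENNReal.ofReal_le_ofReal ?_)
    exact mul_le_mul_of_nonneg_right (le_max_left _ _) hrate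
  · have hfx : |f x₀| ≤ B := by
      rw [abs_of_nonneg (hX.density.nonneg x₀)]
      exact hX.le_on_window x₀ (self_mem_nbhd q n x₀)
    refine (risk_le_mul_natCast hB hq hKD (by omega) hsel P X hfx).trans
      (ENNReal.ofReal_le_ofReal ?_)
    have hNn' : (n : ℝ) ≤ N := by exact_mod_cast hNn
    have h1 : ρ ≤ (Real.log n / n) ^ (s / (2 * s + 1)) := by
      refine Real.rpow_le_rpow (by positivity) ?_ (by positivity)
      gcongr
      linarith
    calc D * n + B ≤ D * N + B := by gcongr
      _ = (D * N + B) / ρ * ρ := by field_simp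
      _ ≤ (D * N + B) / ρ * (Real.log n / n) ^ (s / (2 * s + 1)) := by gcongr
      _ ≤ _ := mul_le_mul_of_nonneg_right (le_max_right _ _) hrate

end WeakDepDensity

open WeakDepDensity in
theorem theorem2 (a b c B M s L q : ℝ) (ha : 0 < a) (hb : 0 < b) (hc : 0 < c) (hB : 0 < B)
    (hM : 0 < M) (hs : 0 < s) (hL : 0 < L) (hq : 0 < q)
    (K : ℝ → ℝ) (hK : IsKernel K) :
    ∃ C : ℝ, 0 < C ∧
      ∀ m : ℕ, HasOrder K m → holderIndex s ≤ m →
      ∀ n : ℕ, 2 ≤ n → ∀ x₀ : ℝ,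
      ∀ hhat : (Fin n → ℝ) → ℝ, IsSelectionRule K q x₀ hhat →
      ∀ (Ω : Type*) [MeasurableSpace Ω] (P : Measure Ω) [IsProbabilityMeasure P]
        (X : ℤ → Ω → ℝ) (f : ℝ → ℝ),
        HasMarginalDensity P X f →
        (∀ r : ℕ, 1 ≤ r →
          rho (nbhd q n x₀) P X r ≤ ENNReal.ofReal (c * Real.exp (-a * (r : ℝ) ^ b))) →
        mu (nbhd q n x₀) P X ≤ ENNReal.ofReal M →
        IsHolderClass (nbhd q n x₀) s L B f →
        risk q P (fun ω => adaptiveEstimator K x₀ hhat (observations X n ω)) (f x₀)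
          ≤ ENNReal.ofReal (C * (Real.log n / n) ^ (s / (2 * s + 1))) := by
  obtain ⟨C, hC, h⟩ := exists_risk_le ha hb hc hM hB hq hs hL hK
  refine ⟨C, hC, fun m hm hsm n hn x₀ hhat hsel Ω _ P _ X f hden hrho hmu hf => ?_⟩
  exact h m hm hsm n hn x₀ hhat hsel Ω P X f
    ⟨hden, hrho, hmu, hf.le_on_window, hf.continuous hs, hc, hM, hB⟩ hf
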